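/- Let $\Omega$ be a finite set with $d=|\Omega|\ge 3$, let $p$ be a prime and let $T_d$ be the $d$-regular tree with a base vertex $b$ and a legal colouring $l$ of its oriented edges by $\Omega$ (that is, $l(\bar e)=l(e)$, and for each vertex $x$ the map $l$ restricts to a bijection $l_x$ from the set of edges issuing from $x$ onto $\Omega$). For $g\in\mathrm{Aut}(T_d)$ and a vertex $x$ put $\sigma(g,x)=l_{gx}\circ g\circ l_x^{-1}\in\mathrm{Sym}(\Omega)$. For $F\le\mathrm{Sym}(\Omega)$ let $\mathrm U(F)=\{g\in\mathrm{Aut}(T_d)\mid \sigma(g,x)\in F\text{ for all vertices }x\}$, with the permutation topology, and let $\widehat F$ be the group of all permutations of $\Omega$ that map each $F$-orbit onto itself. A finite subtree $T\subseteq T_d$ is complete if it contains $b$ and all its non-leaf vertices have valency $d$, where a leaf is a vertex of valency $1$ in $T$. For a leaf $v$ of $T$ let $T_v$ be the subtree spanned by $v$ and the vertices outside $T$ whose closest vertex in $T$ is $v$, and let $T_d\backslash T=\bigsqcup_v T_v$, $v$ ranging over the leaves of $T$. Let $\mathrm N(F)$ be Lederle's coloured Neretin group. Its elements are represented by the forest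 isomorphisms $\varphi:T_d\backslash T\to T_d\backslash T'$, with $T,T'$ finite complete subtrees with equally many leaves, that coincide on each $T_v$ with an element of $\mathrm U(F)$. Two of them represent the same element if and only if they agree on $T_d\backslash T''$ for some finite complete subtree $T''$ containing both of their trees $T$, and the product is composition of suitable representatives. $\mathrm N(F)$ carries the unique group topology for which the inclusion $\mathrm U(F)\to\mathrm N(F)$ is continuous and open. A local $p$-Sylow subgroup of a totally disconnected locally compact group $G$ is a maximal pro-$p$ subgroup of a compact open subgroup of $G$. The $p$-localization of $G$ is $G_{(p)}=\mathrm{Comm}_G(S)$, where $S$ is a local $p$-Sylow subgroup of $G$ and $\mathrm{Comm}_G(S)$ is the group of those $g\in G$ for which $S\cap gSg^{-1}$ has finite index in both $S$ and $gSg^{-1}$, with the unique group topology for which the inclusion of $S$ is continuous and open. **Theorem.** Let $F\le\mathrm{Sym}(\Omega)$ and let $F(p)$ be a $p$-Sylow subgroup of $F$. Assume that $F$ and $F(p)$ have the same orbits on $\Omega$ and that $N_{\widehat F_\omega}(F(p)_\omega)=F(p)_\omega$ for all $\omega\in\Omega$, where the index $\omega$ denotes the stabilizer of $\omega$. Then $\mathrm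 N(F)_{(p)}=\mathrm N(F(p))$ as topological groups. Precisely: there is a local $p$-Sylow subgroup $S$ of $\mathrm N(F)$ such that $\mathrm{Comm}_{\mathrm N(F)}(S)=\mathrm N(F(p))$, with the same topology; and for every local $p$-Sylow subgroup $S$ of $\mathrm N(F)$ there is $g\in\mathrm N(F)$ such that conjugation by $g$ maps $\mathrm{Comm}_{\mathrm N(F)}(S)$, with its topology above, isomorphically and homeomorphically onto $\mathrm N(F(p))$. -/

import Mathlib

open scoped Pointwise

namespace NeretinLoc

/-! ### Complete subtrees of a tree -/

section Subtrees

variable {V : Type*} (G : SimpleGraph V)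

/-- The leaves of the subtree spanned by `T`: vertices of `T` with exactly one neighbour in `T`. -/
def leaves (T : Set V) : Set V := {v | v ∈ T ∧ ∃! u, u ∈ T ∧ G.Adj v u}

/-- `T` is (the vertex set of) a finite complete subtree with respect to the base vertex `b`:
it contains `b`, it is connected, and each of its non-leaf vertices has all its neighbours in `T`
(equivalently, full valency). -/
structure IsComplete (b : V) (T : Set V) : Prop where
  finite : T.Finite
  base_mem : b ∈ T
  connected : (G.induce T).Connected
  full : ∀ v ∈ T, v ∉ leaves G T → ∀ u, G.Adj v u → u ∈ T

/-- The vertex set of the subtree `T_v` at a vertex `v` of `T`: it consists of `v` and the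
vertices outside `T` whose closest vertex in `T` is `v`. -/
def branch (T : Set V) (v : V) : Set V :=
  {x | x = v ∨ (x ∉ T ∧ ∀ w ∈ T, w ≠ v → G.dist x v < G.dist x w)}

/-- The vertex set of the forest `T_d \ T`, the union of the `T_v` for `v` a leaf of `T`. -/
def forestVerts (T : Set V) : Set V := {x | ∃ v ∈ leaves G T, x ∈ branch G T v}

/-- The forest `T_d \ T`: the disjoint union of the trees `T_v`, `v` a leaf of `T`. -/
def forest (T : Set V) : SimpleGraph (forestVerts G T) where
  Adj x y := G.Adj x y ∧ ∃ v ∈ leaves G T, (x : V) ∈ branch G T v ∧ (y : V) ∈ branch G T v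
  symm := ⟨fun _ _ ⟨h, v, hv, hx, hy⟩ => ⟨h.symm, v, hv, hy, hx⟩⟩
  loopless := ⟨fun _ h => G.loopless.irrefl _ h.1⟩

variable {G} {b : V} {T T' : Set V} {u v w x y z : V}

theorem leaves_subset : leaves G T ⊆ T := fun _ h => h.1

theorem mem_branch_iff (hG : G.Connected) :
    x ∈ branch G T v ↔ ∀ w ∈ T, w ≠ v → G.dist x v < G.dist x w := by
  constructor
  · rintro (rfl | h) w hw hne
    · rw [SimpleGraph.dist_self]
      exact hG.pos_dist_of_ne hne.symm
    · exact h.2 w hw hne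
  · intro h
    by_cases hx : x ∈ T
    · left
      by_contra hne
      simpa using h x hx hne
    · exact Or.inr ⟨hx, h⟩

theorem closer_unique (hG : G.IsTree) (h1 : G.Adj x y) (h2 : G.Adj x z)
    (d1 : G.dist b y < G.dist b x) (d2 : G.dist b z < G.dist b x) : y = z := by
  obtain ⟨p, hp⟩ := hG.connected.exists_walk_length_eq_dist b y
  obtain ⟨q, hq⟩ := hG.connected.exists_walk_length_eq_dist b z
  have e1 := hG.dist_eq_dist_add_one_of_adj b h1
  have e2 := hG.dist_eq_dist_add_one_of_adj b h2
  have hp' : (p.concat h1.symm).IsPath := SimpleGraph.Walk.isPath_of_length_eq_dist _ (by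
    rw [SimpleGraph.Walk.length_concat]; omega)
  have hq' : (q.concat h2.symm).IsPath := SimpleGraph.Walk.isPath_of_length_eq_dist _ (by
    rw [SimpleGraph.Walk.length_concat]; omega)
  have h := congrArg Subtype.val
    ((hG.isAcyclic.subsingleton_path b x).elim ⟨_, hp'⟩ ⟨_, hq'⟩)
  exact (SimpleGraph.Walk.concat_inj h).1

theorem exists_closer (hG : G.Connected) (hne : x ≠ b) :
    ∃ y, G.Adj x y ∧ G.dist x b = G.dist y b + 1 := by
  obtain ⟨p, hp⟩ := hG.exists_walk_length_eq_dist x b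
  cases p with
  | nil => exact absurd rfl hne
  | @cons _ y _ h q =>
    refine ⟨y, h, ?_⟩
    have h1 := SimpleGraph.dist_le q
    have h2 := hG.dist_triangle (u := x) (v := y) (w := b)
    have h3 : G.dist x y = 1 := SimpleGraph.dist_eq_one_iff_adj.2 h
    rw [SimpleGraph.Walk.length_cons] at hp
    omega

/-- In a tree, the only edge leaving the half-tree of an edge is that edge. -/
theorem sep (hG : G.IsTree) (huv : G.Adj v u) (hyz : G.Adj y z)
    (hy : G.dist y v < G.dist y u) (hz : ¬ G.dist z v < G.dist z u) : y = v ∧ z = u := by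
  have c := fun a b => SimpleGraph.dist_comm (G := G) (u := a) (v := b)
  have e1 := hG.dist_eq_dist_add_one_of_adj y huv
  have e2 := hG.dist_eq_dist_add_one_of_adj z huv
  have e3 := hG.dist_eq_dist_add_one_of_adj u hyz
  have e4 := hG.dist_eq_dist_add_one_of_adj v hyz
  rw [c u y, c u z] at e3
  rw [c v y, c v z] at e4
  by_cases h0 : y = v
  · subst h0
    rw [SimpleGraph.dist_self] at *
    refine ⟨rfl, ?_⟩
    have : G.dist z u = 0 := by omega
    exact hG.connected.dist_eq_zero_iff.1 this
  · exfalso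
    obtain ⟨y', h1, h2⟩ := exists_closer hG.connected h0
    have h3 := hG.dist_eq_dist_add_one_of_adj u h1
    have h4 := hG.dist_eq_dist_add_one_of_adj y' huv
    rw [c u y, c u y'] at h3
    have : y' = z := closer_unique hG (b := u) h1 hyz (by rw [c u y, c u y']; omega)
      (by rw [c u y, c u z]; omega)
    subst this
    omega

theorem dist_apply (hG : G.Connected) (h : G ≃g G) (x y : V) :
    G.dist (h x) (h y) = G.dist x y := by
  have key : ∀ (k : G ≃g G) (x y : V), G.dist (k x) (k y) ≤ G.dist x y := by
    intro k x y
    obtain ⟨p, hp⟩ := hG.exists_walk_length_eq_dist x y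
    rw [← hp, ← SimpleGraph.Walk.length_map k.toHom p]
    exact SimpleGraph.dist_le (p.map k.toHom)
  refine le_antisymm (key h x y) ?_
  simpa using key h.symm (h x) (h y)

theorem self_mem_branch : v ∈ branch G T v := Or.inl rfl

theorem eq_of_mem_branch (hx : x ∈ branch G T v) (hxT : x ∈ T) : x = v := by
  rcases hx with h | h
  · exact h
  · exact absurd hxT h.1

theorem branch_disjoint (hG : G.Connected) (hv : v ∈ T) (hw : w ∈ T)
    (hxv : x ∈ branch G T v) (hxw : x ∈ branch G T w) : v = w := by
  by_contra hne
  have h1 := (mem_branch_iff hG).1 hxv w hw (Ne.symm hne)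
  have h2 := (mem_branch_iff hG).1 hxw v hv hne
  omega

theorem mem_forestVerts (hv : v ∈ leaves G T) (hx : x ∈ branch G T v) :
    x ∈ forestVerts G T := ⟨v, hv, hx⟩

/-- The tree `T_v` at a leaf `v` with neighbour `u` in `T` is a half-tree. -/
theorem mem_branch_iff_half (hG : G.IsTree) (hc : (G.induce T).Connected)
    (hv : v ∈ leaves G T) (hu : u ∈ T) (huv : G.Adj v u) :
    x ∈ branch G T v ↔ G.dist x v < G.dist x u := by
  rw [mem_branch_iff hG.connected]
  refine ⟨fun h => h u hu huv.ne', fun h w hw hne => ?_⟩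
  have huniq : ∀ z ∈ T, G.Adj v z → z = u := fun z hz hvz => hv.2.unique ⟨hz, hvz⟩ ⟨hu, huv⟩
  -- `w` does not lie in the half-tree
  have hside : ∀ (s t : T), (G.induce T).Walk s t → (t : V) = v →
      (s : V) ≠ v → ¬ G.dist (s : V) v < G.dist (s : V) u := by
    intro s t p
    induction p with
    | nil => intro h1 h2; exact absurd h1 h2
    | @cons s s' t hs q ih =>
      intro ht hsv hlt
      have hadj : G.Adj (s : V) (s' : V) := hs
      by_cases hs' : (s' : V) = v
      · have : (s : V) = u := huniq _ s.2 (by rw [← hs']; exact hadj.symm)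
        rw [this, SimpleGraph.dist_self] at hlt
        omega
      · exact hsv (sep hG huv hadj hlt (ih ht hs')).1
  obtain ⟨p⟩ := hc.preconnected ⟨w, hw⟩ ⟨v, hv.1⟩
  have hwside := hside _ _ p rfl hne
  -- a geodesic from `x` to `w` crosses the edge
  have hcross : ∀ n x, G.dist x w = n → G.dist x v < G.dist x u → G.dist x v < n := by
    intro n
    induction n with
    | zero =>
      intro x hx hlt
      have : x = w := hG.connected.dist_eq_zero_iff.1 hx
      subst this
      exact absurd hlt hwside
    | succ n ih =>
      intro x hx hlt
      have hxw : x ≠ w := by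
        rintro rfl
        rw [SimpleGraph.dist_self] at hx; omega
      obtain ⟨y, hy, hd⟩ := exists_closer hG.connected hxw
      by_cases hys : G.dist y v < G.dist y u
      · have h1 := ih y (by omega) hys
        have h2 := hG.connected.dist_triangle (u := x) (v := y) (w := v)
        have h3 : G.dist x y = 1 := SimpleGraph.dist_eq_one_iff_adj.2 hy
        omega
      · have := (sep hG huv hy hlt hys).1
        subst this
        rw [SimpleGraph.dist_self]
        omega
  exact hcross _ x rfl h

/-- Neighbours of vertices of `T_v` lie in `T_v`, except for the neighbour `u` of `v` in `T`. -/
theorem branch_adj (hG : G.IsTree) (hc : (G.induce T).Connected)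
    (hv : v ∈ leaves G T) (hu : u ∈ T) (huv : G.Adj v u)
    (hx : x ∈ branch G T v) (hxy : G.Adj x y) :
    y ∈ branch G T v ∨ (x = v ∧ y = u) := by
  by_cases hy : y ∈ branch G T v
  · exact Or.inl hy
  · rw [mem_branch_iff_half hG hc hv hu huv] at hx hy
    exact Or.inr (sep hG huv hxy hx hy)

theorem parent_notMem (hu : u ∈ T) (huv : G.Adj v u) : u ∉ branch G T v := fun h =>
  huv.ne (eq_of_mem_branch h hu).symm

/-- Every vertex which is not an inner vertex of `T` lies in the forest. -/
theorem cover (hG : G.IsTree) (hT : IsComplete G b T) (hx : x ∈ T → x ∈ leaves G T) :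
    x ∈ forestVerts G T := by
  by_cases hxT : x ∈ T
  · exact ⟨x, hx hxT, self_mem_branch⟩
  obtain ⟨v, hv, hmin⟩ := Set.exists_min_image T (fun w => G.dist x w) hT.finite ⟨b, hT.base_mem⟩
  have hxv : x ≠ v := by rintro rfl; exact hxT hv
  obtain ⟨z, hz, hd⟩ := exists_closer hG.connected hxv.symm
  have c := fun a b => SimpleGraph.dist_comm (G := G) (u := a) (v := b)
  have hzT : z ∉ T := by
    intro hzT
    have := hmin z hzT
    simp only [c x] at this
    omega
  have hvl : v ∈ leaves G T := by
    by_contra hcon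
    exact hzT (hT.full v hv hcon z hz)
  obtain ⟨u, ⟨hu, huv⟩, -⟩ := hvl.2
  refine ⟨v, hvl, (mem_branch_iff_half hG hT.connected hvl hu huv).2 ?_⟩
  have h1 := hmin u hu
  have h2 := hG.dist_ne_of_adj x huv
  have h1' : G.dist x v ≤ G.dist x u := h1
  omega

/-- A vertex of `T_v` other than `v` has a neighbour in `T_v` which is closer to `v`. -/
theorem branch_closer (hG : G.Connected) (hx : x ∈ branch G T v) (hne : x ≠ v) :
    ∃ y ∈ branch G T v, G.Adj x y ∧ G.dist x v = G.dist y v + 1 := by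
  obtain ⟨y, hy, hd⟩ := exists_closer hG hne
  refine ⟨y, (mem_branch_iff hG).2 fun w hw hwv => ?_, hy, hd⟩
  have h1 := (mem_branch_iff hG).1 hx w hw hwv
  have h2 := hG.dist_triangle (u := x) (v := y) (w := w)
  have h3 : G.dist x y = 1 := SimpleGraph.dist_eq_one_iff_adj.2 hy
  omega

/-- The trees `T_v` are connected in the forest. -/
theorem forest_reachable (hG : G.Connected) (hv : v ∈ leaves G T) (x : forestVerts G T)
    (hx : (x : V) ∈ branch G T v) :
    (forest G T).Reachable x ⟨v, v, hv, self_mem_branch⟩ := by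
  suffices ∀ n, ∀ x : forestVerts G T, (x : V) ∈ branch G T v → G.dist (x : V) v = n →
      (forest G T).Reachable x ⟨v, v, hv, self_mem_branch⟩ from this _ x hx rfl
  intro n
  induction n with
  | zero =>
    intro x hx hn
    have : (x : V) = v := hG.dist_eq_zero_iff.1 hn
    rw [Subtype.ext (a1 := x) (a2 := ⟨v, v, hv, self_mem_branch⟩) this]
  | succ n ih =>
    intro x hx hn
    have hne : (x : V) ≠ v := by
      intro h
      rw [h, SimpleGraph.dist_self] at hn; omega
    obtain ⟨y, hy, hadj, hd⟩ := branch_closer hG hx hne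
    have h1 : (forest G T).Adj x ⟨y, v, hv, hy⟩ := ⟨hadj, v, hv, hx, hy⟩
    exact h1.reachable.trans (ih ⟨y, v, hv, hy⟩ hy (by simp only; omega))

theorem mem_branch_of_reachable (hG : G.Connected) (hv : v ∈ leaves G T)
    {x y : forestVerts G T} (h : (forest G T).Reachable x y)
    (hx : (x : V) ∈ branch G T v) : (y : V) ∈ branch G T v := by
  obtain ⟨p⟩ := h
  induction p with
  | nil => exact hx
  | cons hs _ ih =>
    obtain ⟨-, w, hw, h1, h2⟩ := hs
    have : v = w := branch_disjoint hG hv.1 hw.1 hx h1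
    subst this
    exact ih h2

/-! Balls are complete. -/

theorem ball_finite (hG : G.Connected) (hfin : ∀ v, (G.neighborSet v).Finite) (b : V) (n : ℕ) :
    {x | G.dist x b ≤ n}.Finite := by
  induction n with
  | zero =>
    refine (Set.finite_singleton b).subset fun x hx => ?_
    exact hG.dist_eq_zero_iff.1 (Nat.le_zero.1 hx)
  | succ n ih =>
    refine (ih.union (ih.biUnion fun v _ => hfin v)).subset fun x hx => ?_
    by_cases hxb : x = b
    · left
      subst hxb
      simp
    · obtain ⟨y, hy, hd⟩ := exists_closer hG hxb
      right
      have hx' : G.dist x b ≤ n + 1 := hx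
      simp only [Set.mem_iUnion]
      exact ⟨y, show G.dist y b ≤ n by omega, hy.symm⟩

theorem ball_complete (hG : G.IsTree) (hfin : ∀ v, (G.neighborSet v).Finite) (b : V) (n : ℕ)
    (hn : 1 ≤ n) : IsComplete G b {x | G.dist x b ≤ n} := by
  have c := fun a b => SimpleGraph.dist_comm (G := G) (u := a) (v := b)
  have hb : G.dist b b ≤ n := by rw [SimpleGraph.dist_self]; omega
  refine ⟨ball_finite hG.connected hfin b n, hb, ?_, ?_⟩
  · have key : ∀ m, ∀ x : {x | G.dist x b ≤ n}, G.dist (x : V) b = m →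
        (G.induce {x | G.dist x b ≤ n}).Reachable x ⟨b, hb⟩ := by
      intro m
      induction m with
      | zero =>
        intro x hx
        rw [Subtype.ext (a1 := x) (a2 := ⟨b, hb⟩) (hG.connected.dist_eq_zero_iff.1 hx)]
      | succ m ih =>
        intro x hx
        have hne : (x : V) ≠ b := by
          intro h
          rw [h, SimpleGraph.dist_self] at hx; omega
        obtain ⟨y, hy, hd⟩ := exists_closer hG.connected hne
        have hxn : G.dist (x : V) b ≤ n := x.2
        have hyn : G.dist y b ≤ n := by omega
        have h1 : (G.induce {x | G.dist x b ≤ n}).Adj x ⟨y, hyn⟩ := hy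
        exact h1.reachable.trans (ih ⟨y, hyn⟩ (by simp only; omega))
    have : Nonempty {x | G.dist x b ≤ n} := ⟨⟨b, hb⟩⟩
    exact ⟨fun x y => (key _ x rfl).trans (key _ y rfl).symm⟩
  · intro v hv hnl u hu
    by_contra hun
    apply hnl
    have hv' : G.dist v b ≤ n := hv
    have hu' : ¬ G.dist u b ≤ n := hun
    have e := hG.dist_eq_dist_add_one_of_adj b hu
    rw [c b v, c b u] at e
    have hne : v ≠ b := by
      rintro rfl
      rw [SimpleGraph.dist_self] at e
      omega
    obtain ⟨y, hy, hd⟩ := exists_closer hG.connected hne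
    refine ⟨hv, y, ⟨show G.dist y b ≤ n by omega, hy⟩, ?_⟩
    rintro z ⟨hz, hvz⟩
    have hz' : G.dist z b ≤ n := hz
    have e2 := hG.dist_eq_dist_add_one_of_adj b hvz
    rw [c b v, c b z] at e2
    refine closer_unique hG (b := b) hvz hy ?_ ?_ <;> rw [c b v, c b] <;> omega

end Subtrees

/-! ### Near permutations -/

section NearPermutations

/-- Self-maps of `V` for which preimages of finite sets are finite. -/
def nearEnd (V : Type*) : Submonoid (Function.End V) where
  carrier := {f | Filter.Tendsto f Filter.cofinite Filter.cofinite}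
  one_mem' := Filter.tendsto_id
  mul_mem' hf hg := Filter.Tendsto.comp hf hg

/-- Two such maps are identified when they agree outside a finite set. -/
def nearCon (V : Type*) : Con (nearEnd V) where
  r f g := (f.1 : V → V) =ᶠ[Filter.cofinite] (g.1 : V → V)
  iseqv := ⟨fun _ => Filter.EventuallyEq.rfl, fun h => h.symm, fun h h' => h.trans h'⟩
  mul' := by
    intro f f' g g' hf hg
    have h1 : ((f.1 : V → V) ∘ (g.1 : V → V)) =ᶠ[Filter.cofinite] ((f'.1 : V → V) ∘ (g.1 : V → V)) :=
      hf.comp_tendsto g.2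
    have h2 : ((f'.1 : V → V) ∘ (g.1 : V → V)) =ᶠ[Filter.cofinite] ((f'.1 : V → V) ∘ (g'.1 : V → V)) :=
      hg.fun_comp (f'.1 : V → V)
    exact h1.trans h2

/-- The group of near permutations of `V`: bijections between cofinite subsets of `V`, two of them
being identified when they agree outside a finite set; the product is composition, which is
defined outside a finite set. -/
abbrev NearPerm (V : Type*) : Type _ := (nearCon V).Quotientˣ

variable {V : Type*}

open Classical in
/-- The extension by the identity of a bijection between subsets. -/
noncomputable def extend {A B : Set V} (e : A ≃ B) (x : V) : V :=
  if h : x ∈ A then (e ⟨x, h⟩ : V) else x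

theorem extend_of_mem {A B : Set V} (e : A ≃ B) {x : V} (h : x ∈ A) :
    extend e x = e ⟨x, h⟩ := dif_pos h

theorem tendsto_extend {A B : Set V} (hA : Aᶜ.Finite) (e : A ≃ B) :
    Filter.Tendsto (extend e) Filter.cofinite Filter.cofinite := by
  intro s hs
  rw [Filter.mem_map, Filter.mem_cofinite] at *
  have hfin : (Subtype.val '' ((fun x : A => (e x : V)) ⁻¹' sᶜ)).Finite :=
    (hs.preimage (fun x _ y _ h => e.injective (Subtype.ext h))).image _
  refine (hA.union hfin).subset fun x hx => ?_
  by_cases hxA : x ∈ A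
  · refine Or.inr ⟨⟨x, hxA⟩, fun h => hx ?_, rfl⟩
    rw [Set.mem_preimage, extend_of_mem _ hxA]
    exact h
  · exact Or.inl hxA

/-- The near permutation given by a bijection between two cofinite subsets. -/
noncomputable def NearPerm.ofEquiv {A B : Set V} (hA : Aᶜ.Finite) (hB : Bᶜ.Finite) (e : A ≃ B) :
    NearPerm V where
  val := (⟨extend e, tendsto_extend hA e⟩ : nearEnd V)
  inv := (⟨extend e.symm, tendsto_extend hB e.symm⟩ : nearEnd V)
  val_inv := by
    refine (Con.eq _).2 ?_
    refine Filter.eventually_cofinite.2 (hB.subset fun x hx hxB => hx ?_)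
    change extend e (extend e.symm x) = x
    rw [extend_of_mem _ hxB, extend_of_mem _ (e.symm ⟨x, hxB⟩).2]
    simp
  inv_val := by
    refine (Con.eq _).2 ?_
    refine Filter.eventually_cofinite.2 (hA.subset fun x hx hxA => hx ?_)
    change extend e.symm (extend e x) = x
    rw [extend_of_mem _ hxA, extend_of_mem _ (e ⟨x, hxA⟩).2]
    simp

theorem NearPerm.ofEquiv_eq_iff {A B C D : Set V} {hA : Aᶜ.Finite} {hB : Bᶜ.Finite}
    {hC : Cᶜ.Finite} {hD : Dᶜ.Finite} {e : A ≃ B} {e' : C ≃ D} :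
    NearPerm.ofEquiv hA hB e = NearPerm.ofEquiv hC hD e' ↔
      {x | extend e x ≠ extend e' x}.Finite := by
  rw [Units.ext_iff]
  exact (Con.eq _).trans Filter.eventually_cofinite

theorem NearPerm.ofEquiv_mul {A B C D E F : Set V} {hA : Aᶜ.Finite} {hB : Bᶜ.Finite}
    {hC : Cᶜ.Finite} {hD : Dᶜ.Finite} {hE : Eᶜ.Finite} {hF : Fᶜ.Finite}
    {e : A ≃ B} {e' : C ≃ D} {e'' : E ≃ F}
    (h : {x | extend e'' x ≠ extend e (extend e' x)}.Finite) :
    NearPerm.ofEquiv hE hF e'' = NearPerm.ofEquiv hA hB e * NearPerm.ofEquiv hC hD e' := by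
  rw [Units.ext_iff]
  exact (Con.eq _).2 (Filter.eventually_cofinite.2 h)

theorem NearPerm.ofEquiv_inv {A B : Set V} (hA : Aᶜ.Finite) (hB : Bᶜ.Finite) (e : A ≃ B) :
    (NearPerm.ofEquiv hA hB e)⁻¹ = NearPerm.ofEquiv hB hA e.symm := rfl

theorem NearPerm.ofEquiv_one {A : Set V} (hA hA' : Aᶜ.Finite) :
    NearPerm.ofEquiv hA hA' (Equiv.refl A) = 1 := by
  rw [Units.ext_iff]
  refine (Con.eq _).2 (Filter.eventually_cofinite.2 (hA.subset fun x hx hxA => hx ?_))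
  exact extend_of_mem _ hxA

end NearPermutations


/-! ### Almost automorphisms -/

section AlmostAutomorphisms

variable {V : Type*}

/-- An `H`-honest almost automorphism of the tree `G` with base vertex `b`: a forest isomorphism
`T_d \ T → T_d \ T'` between the complements of finite complete subtrees with equally many leaves
which coincides on each `T_v`, `v` a leaf of `T`, with an element of `H`. -/
structure HonestAlmostAut (G : SimpleGraph V) (b : V) (H : Subgroup (G ≃g G)) where
  dom : Set V
  cod : Set V
  dom_complete : IsComplete G b dom
  cod_complete : IsComplete G b cod
  card_leaves : (leaves G dom).ncard = (leaves G cod).ncard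
  iso : forest G dom ≃g forest G cod
  honest : ∀ v ∈ leaves G dom, ∃ h ∈ H, ∀ x : forestVerts G dom,
    (x : V) ∈ branch G dom v → (iso x : V) = h x

variable {G : SimpleGraph V} {b : V} {H : Subgroup (G ≃g G)}

/-- The complement of the forest is finite. -/
theorem IsComplete.finite_compl (hG : G.IsTree) {T : Set V} (hT : IsComplete G b T) :
    (forestVerts G T)ᶜ.Finite := by
  refine hT.finite.subset fun x hx => ?_
  by_contra h
  exact hx (cover hG hT fun h' => absurd h' h)

/-- The class of an almost automorphism, as a near permutation of the set of vertices. -/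
noncomputable def HonestAlmostAut.toNearPerm (hG : G.IsTree) (φ : HonestAlmostAut G b H) :
    NearPerm V :=
  NearPerm.ofEquiv (φ.dom_complete.finite_compl hG) (φ.cod_complete.finite_compl hG) φ.iso.toEquiv

/-- Almost automorphisms on the level of maps between vertex sets. -/
structure Honest (b : V) (H : Subgroup (G ≃g G)) (T T' : Set V) (f : V → V) : Prop where
  dom_complete : IsComplete G b T
  cod_complete : IsComplete G b T'
  bij : Set.BijOn f (leaves G T) (leaves G T')
  honest : ∀ v ∈ leaves G T, ∃ h ∈ H, (∀ x, x ∈ branch G T v ↔ h x ∈ branch G T' (f v)) ∧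
    ∀ x ∈ branch G T v, f x = h x

theorem Honest.injOn (hG : G.Connected) {T T' : Set V} {f : V → V} (hf : Honest b H T T' f) :
    Set.InjOn f (forestVerts G T) := by
  rintro x ⟨v, hv, hx⟩ y ⟨w, hw, hy⟩ hxy
  obtain ⟨h, -, h1, h2⟩ := hf.honest v hv
  obtain ⟨k, -, k1, k2⟩ := hf.honest w hw
  have hx' : f x ∈ branch G T' (f v) := by rw [h2 x hx]; exact (h1 x).1 hx
  have hy' : f y ∈ branch G T' (f w) := by rw [k2 y hy]; exact (k1 y).1 hy
  rw [← hxy] at hy'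
  have := branch_disjoint hG (hf.bij.mapsTo hv).1 (hf.bij.mapsTo hw).1 hx' hy'
  have := hf.bij.injOn hv hw this
  subst this
  rw [h2 x hx, h2 y hy] at hxy
  exact h.injective hxy

theorem Honest.bijOn (hG : G.Connected) {T T' : Set V} {f : V → V} (hf : Honest b H T T' f) :
    Set.BijOn f (forestVerts G T) (forestVerts G T') := by
  refine ⟨?_, hf.injOn hG, ?_⟩
  · rintro x ⟨v, hv, hx⟩
    obtain ⟨h, -, h1, h2⟩ := hf.honest v hv
    refine ⟨f v, hf.bij.mapsTo hv, ?_⟩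
    rw [h2 x hx]; exact (h1 x).1 hx
  · rintro y ⟨w, hw, hy⟩
    obtain ⟨v, hv, rfl⟩ := hf.bij.surjOn hw
    obtain ⟨h, -, h1, h2⟩ := hf.honest v hv
    have hx : h.symm y ∈ branch G T v := by
      rw [h1]; simpa using hy
    refine ⟨h.symm y, ⟨v, hv, hx⟩, ?_⟩
    rw [h2 _ hx]; simp

theorem Honest.symm {T T' : Set V} {f g : V → V} (hf : Honest b H T T' f)
    (hg : ∀ x ∈ forestVerts G T, g (f x) = x) : Honest b H T' T g := by
  have hL : ∀ v ∈ leaves G T, g (f v) = v := fun v hv => hg v ⟨v, hv, self_mem_branch⟩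
  refine ⟨hf.cod_complete, hf.dom_complete, ⟨?_, ?_, ?_⟩, ?_⟩
  · rintro w hw
    obtain ⟨v, hv, rfl⟩ := hf.bij.surjOn hw
    rwa [hL v hv]
  · rintro w hw w' hw' heq
    obtain ⟨v, hv, rfl⟩ := hf.bij.surjOn hw
    obtain ⟨v', hv', rfl⟩ := hf.bij.surjOn hw'
    rw [hL v hv, hL v' hv'] at heq
    rw [heq]
  · intro v hv
    exact ⟨f v, hf.bij.mapsTo hv, hL v hv⟩
  · rintro w hw
    obtain ⟨v, hv, rfl⟩ := hf.bij.surjOn hw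
    obtain ⟨h, hH, h1, h2⟩ := hf.honest v hv
    refine ⟨h⁻¹, H.inv_mem hH, fun y => ?_, fun y hy => ?_⟩
    · rw [hL v hv, h1]
      exact iff_of_eq (congrArg (· ∈ branch G T' (f v)) (h.apply_symm_apply y).symm)
    · have hx : h.symm y ∈ branch G T v := by
        rw [h1]; simpa using hy
      have := hg _ ⟨v, hv, hx⟩
      rw [h2 _ hx] at this
      rw [h.apply_symm_apply] at this
      exact this

theorem Honest.comp {T T' T'' : Set V} {f g : V → V} (hf : Honest b H T T' f)
    (hg : Honest b H T' T'' g) : Honest b H T T'' (g ∘ f) := by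
  refine ⟨hf.dom_complete, hg.cod_complete, hg.bij.comp hf.bij, fun v hv => ?_⟩
  obtain ⟨h, hH, h1, h2⟩ := hf.honest v hv
  obtain ⟨k, kH, k1, k2⟩ := hg.honest (f v) (hf.bij.mapsTo hv)
  refine ⟨k * h, H.mul_mem kH hH, fun x => ?_, fun x hx => ?_⟩
  · rw [h1, k1]; rfl
  · have : f x ∈ branch G T' (f v) := by rw [h2 x hx]; exact (h1 x).1 hx
    change g (f x) = k (h x)
    rw [k2 _ this, h2 x hx]

/-- The root of `T_v` is mapped to the root of its image, and the neighbour of `v` in `T` to the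
neighbour of the image. -/
theorem root_eq (hG : G.IsTree) {T T' : Set V} {v v' u u' : V} {h : G ≃g G}
    (hT' : (G.induce T').Connected) (hv' : v' ∈ leaves G T') (hu : u ∈ T) (huv : G.Adj v u)
    (hu' : u' ∈ T') (huv' : G.Adj v' u')
    (h1 : ∀ x, x ∈ branch G T v ↔ h x ∈ branch G T' v') : h v = v' ∧ h u = u' := by
  have a : h v ∈ branch G T' v' := (h1 v).1 self_mem_branch
  have c : h u ∉ branch G T' v' := fun hc => parent_notMem hu huv ((h1 u).2 hc)
  have := branch_adj hG hT' hv' hu' huv' a (h.map_adj_iff.2 huv)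
  exact this.resolve_left c

theorem HonestAlmostAut.toHonest (hG : G.IsTree) (φ : HonestAlmostAut G b H) :
    Honest b H φ.dom φ.cod (extend φ.iso.toEquiv) := by
  have hext : ∀ x (hx : x ∈ forestVerts G φ.dom), extend φ.iso.toEquiv x = φ.iso ⟨x, hx⟩ :=
    fun x hx => extend_of_mem _ hx
  have key : ∀ v ∈ leaves G φ.dom, extend φ.iso.toEquiv v ∈ leaves G φ.cod ∧ ∃ h ∈ H,
      (∀ x, x ∈ branch G φ.dom v ↔ h x ∈ branch G φ.cod (extend φ.iso.toEquiv v)) ∧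
      ∀ x ∈ branch G φ.dom v, extend φ.iso.toEquiv x = h x := by
    intro v hv
    obtain ⟨h, hH, hh⟩ := φ.honest v hv
    have hvF : v ∈ forestVerts G φ.dom := ⟨v, hv, self_mem_branch⟩
    obtain ⟨w, hw, hvw⟩ := (φ.iso ⟨v, hvF⟩).2
    have hE : ∀ x ∈ branch G φ.dom v, extend φ.iso.toEquiv x = h x := fun x hx => by
      rw [hext x ⟨v, hv, hx⟩, hh ⟨x, v, hv, hx⟩ hx]
    have h1 : ∀ x, x ∈ branch G φ.dom v ↔ h x ∈ branch G φ.cod w := by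
      intro x
      constructor
      · intro hx
        have hr := forest_reachable hG.connected hv ⟨x, v, hv, hx⟩ hx
        have hr' := (hr.map φ.iso.toHom).symm
        have := mem_branch_of_reachable hG.connected hw hr' hvw
        rw [← hh ⟨x, v, hv, hx⟩ hx]
        exact this
      · intro hx
        have hyF : h x ∈ forestVerts G φ.cod := ⟨w, hw, hx⟩
        have r1 := forest_reachable hG.connected hw ⟨h x, hyF⟩ hx
        have r2 := forest_reachable hG.connected hw (φ.iso ⟨v, hvF⟩) hvw
        have r3 := (r2.trans r1.symm).map φ.iso.symm.toHom
        have e1 : φ.iso.symm.toHom (φ.iso ⟨v, hvF⟩) = ⟨v, hvF⟩ := φ.iso.symm_apply_apply _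
        rw [e1] at r3
        have hb := mem_branch_of_reachable hG.connected hv r3 self_mem_branch
        have e2 := hh _ hb
        have e3 : φ.iso (φ.iso.symm.toHom ⟨h x, hyF⟩) = ⟨h x, hyF⟩ := φ.iso.apply_symm_apply _
        rw [e3] at e2
        have e4 := h.injective e2
        rw [e4]
        exact hb
    obtain ⟨u, ⟨hu, huv⟩, -⟩ := hv.2
    obtain ⟨u', ⟨hu', huv'⟩, -⟩ := hw.2
    have hroot := (root_eq hG φ.cod_complete.connected hw hu huv
      hu' huv' h1).1
    have hw' : extend φ.iso.toEquiv v = w := by rw [hE v self_mem_branch, hroot]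
    rw [hw']
    exact ⟨hw, h, hH, h1, hE⟩
  refine ⟨φ.dom_complete, φ.cod_complete, ⟨fun v hv => (key v hv).1, ?_, ?_⟩,
    fun v hv => (key v hv).2⟩
  · intro v hv w hw heq
    rw [hext v ⟨v, hv, self_mem_branch⟩, hext w ⟨w, hw, self_mem_branch⟩] at heq
    exact congrArg Subtype.val (φ.iso.injective (Subtype.ext heq))
  · intro w hw
    have hwF : w ∈ forestVerts G φ.cod := ⟨w, hw, self_mem_branch⟩
    obtain ⟨v, hv, hb⟩ := (φ.iso.symm ⟨w, hwF⟩).2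
    obtain ⟨h0, h, hH, h1, h2⟩ := key v hv
    refine ⟨v, hv, ?_⟩
    have e : extend φ.iso.toEquiv (φ.iso.symm ⟨w, hwF⟩ : forestVerts G φ.dom) = w := by
      rw [hext _ (φ.iso.symm ⟨w, hwF⟩).2]
      exact congrArg Subtype.val (φ.iso.apply_symm_apply ⟨w, hwF⟩)
    have hm := (h1 _).1 hb
    rw [← h2 _ hb, e] at hm
    exact (eq_of_mem_branch hm hw.1).symm

/-- The converse passage. -/
theorem Honest.exists_toNearPerm (hG : G.IsTree) {T T' : Set V} {f : V → V}
    (hf : Honest b H T T' f) :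
    ∃ φ : HonestAlmostAut G b H, φ.dom = T ∧ φ.cod = T' ∧
      ∀ x ∈ forestVerts G T, extend φ.iso.toEquiv x = f x := by
  have hb := hf.bijOn hG.connected
  let e : forestVerts G T ≃ forestVerts G T' := hb.equiv f
  have he : ∀ x, (e x : V) = f x := fun x => rfl
  refine ⟨⟨T, T', hf.dom_complete, hf.cod_complete, ?_, ⟨e, ?_⟩, ?_⟩, rfl, rfl, ?_⟩
  · rw [← hf.bij.image_eq, hf.bij.injOn.ncard_image]
  · intro x y
    change (G.Adj (f x) (f y) ∧ ∃ v ∈ leaves G T', f x ∈ branch G T' v ∧ f y ∈ branch G T' v) ↔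
      (G.Adj x y ∧ ∃ v ∈ leaves G T, (x : V) ∈ branch G T v ∧ (y : V) ∈ branch G T v)
    have hpull : ∀ v ∈ leaves G T, ∀ x : forestVerts G T, f x ∈ branch G T' (f v) →
        (x : V) ∈ branch G T v := by
      rintro v hv ⟨x, w, hw, hx⟩ hfx
      obtain ⟨k, -, k1, k2⟩ := hf.honest w hw
      have : f x ∈ branch G T' (f w) := by rw [k2 x hx]; exact (k1 x).1 hx
      have := branch_disjoint hG.connected (hf.bij.mapsTo hv).1 (hf.bij.mapsTo hw).1 hfx this
      rw [hf.bij.injOn hv hw this]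
      exact hx
    constructor
    · rintro ⟨hadj, w, hw, hx, hy⟩
      obtain ⟨v, hv, rfl⟩ := hf.bij.surjOn hw
      have hx' := hpull v hv x hx
      have hy' := hpull v hv y hy
      obtain ⟨h, -, h1, h2⟩ := hf.honest v hv
      rw [h2 _ hx', h2 _ hy'] at hadj
      exact ⟨h.map_adj_iff.1 hadj, v, hv, hx', hy'⟩
    · rintro ⟨hadj, v, hv, hx, hy⟩
      obtain ⟨h, -, h1, h2⟩ := hf.honest v hv
      rw [h2 _ hx, h2 _ hy]
      exact ⟨h.map_adj_iff.2 hadj, f v, hf.bij.mapsTo hv, (h1 _).1 hx, (h1 _).1 hy⟩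
  · intro v hv
    obtain ⟨h, hH, -, h2⟩ := hf.honest v hv
    exact ⟨h, hH, fun x hx => h2 x hx⟩
  · intro x hx
    exact extend_of_mem _ hx

/-- Refinement: the domain of an almost automorphism can be replaced by any larger finite
complete subtree. -/
theorem Honest.refine (hG : G.IsTree) (hdeg : ∀ v, (G.neighborSet v).Nontrivial)
    {T T' S : Set V} {f : V → V} (hf : Honest b H T T' f) (hS : IsComplete G b S) (hTS : T ⊆ S) :
    ∃ S', T' ⊆ S' ∧ Honest b H S S' f := by
  have hT := hf.dom_complete
  have hT' := hf.cod_complete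
  have hcon := hG.connected
  have hinj := hf.injOn hcon
  -- data at a leaf `v` of `T`
  have hloc : ∀ v ∈ leaves G T, ∃ h ∈ H, ∃ u ∈ T, G.Adj v u ∧ f v = h v ∧ h u ∈ T' ∧
      (∀ x, x ∈ branch G T v ↔ h x ∈ branch G T' (f v)) ∧ ∀ x ∈ branch G T v, f x = h x := by
    intro v hv
    obtain ⟨h, hH, h1, h2⟩ := hf.honest v hv
    obtain ⟨u, ⟨hu, huv⟩, -⟩ := hv.2
    obtain ⟨u', ⟨hu', huv'⟩, -⟩ := (hf.bij.mapsTo hv).2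
    have := root_eq hG hT'.connected (hf.bij.mapsTo hv) hu huv hu' huv' h1
    exact ⟨h, hH, u, hu, huv, h2 v self_mem_branch, this.2 ▸ hu', h1, h2⟩
  set S' : Set V := T' ∪ f '' (S ∩ forestVerts G T) with hS'
  -- membership in `S'` corresponds to membership in `S`
  have hmem : ∀ v ∈ leaves G T, ∀ h : G ≃g G,
      (∀ x, x ∈ branch G T v ↔ h x ∈ branch G T' (f v)) → (∀ x ∈ branch G T v, f x = h x) →
      ∀ x ∈ branch G T v, (x ∈ S ↔ h x ∈ S') := by
    intro v hv h h1 h2 x hx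
    constructor
    · intro hxS
      exact Or.inr ⟨x, ⟨hxS, v, hv, hx⟩, h2 x hx⟩
    · rintro (hxT | ⟨y, ⟨hyS, w, hw, hy⟩, hyx⟩)
      · have e := eq_of_mem_branch ((h1 x).1 hx) hxT
        rw [h2 v self_mem_branch] at e
        rw [h.injective e]
        exact hTS hv.1
      · have : f y = f x := by rw [hyx, h2 x hx]
        rw [← hinj ⟨w, hw, hy⟩ ⟨v, hv, hx⟩ this]
        exact hyS
  -- the same for neighbours of vertices of the forest
  have hmem' : ∀ v ∈ leaves G T, ∀ x ∈ branch G T v, ∃ h ∈ H, f x = h x ∧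
      (∀ y ∈ branch G T v, f y = h y) ∧ ∀ y, G.Adj x y → (y ∈ S ↔ h y ∈ S') := by
    intro v hv x hx
    obtain ⟨h, hH, u, hu, huv, hv', hu', h1, h2⟩ := hloc v hv
    refine ⟨h, hH, h2 x hx, h2, fun y hxy => ?_⟩
    rcases branch_adj hG hT.connected hv hu huv hx hxy with hy | ⟨rfl, rfl⟩
    · exact hmem v hv h h1 h2 y hy
    · exact iff_of_true (hTS hu) (Or.inl hu')
  have hleaf : ∀ v ∈ leaves G T, ∀ x ∈ branch G T v, x ∈ S →
      (x ∈ leaves G S ↔ f x ∈ leaves G S') := by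
    intro v hv x hx hxS
    obtain ⟨h, -, hfx, -, hadj⟩ := hmem' v hv x hx
    have hfS : f x ∈ S' := Or.inr ⟨x, ⟨hxS, v, hv, hx⟩, rfl⟩
    constructor
    · rintro ⟨-, z, ⟨hz, hxz⟩, huniq⟩
      refine ⟨hfS, h z, ⟨(hadj z hxz).1 hz, by rw [hfx]; exact h.map_adj_iff.2 hxz⟩, ?_⟩
      rintro y ⟨hy, hxy⟩
      obtain ⟨y, rfl⟩ := h.surjective y
      rw [hfx] at hxy
      have hxy' := h.map_adj_iff.1 hxy
      rw [huniq y ⟨(hadj y hxy').2 hy, hxy'⟩]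
    · rintro ⟨-, z, ⟨hz, hxz⟩, huniq⟩
      obtain ⟨z, rfl⟩ := h.surjective z
      rw [hfx] at hxz
      have hxz' := h.map_adj_iff.1 hxz
      refine ⟨hxS, z, ⟨(hadj z hxz').2 hz, hxz'⟩, ?_⟩
      rintro y ⟨hy, hxy⟩
      exact h.injective (huniq (h y)
        ⟨(hadj y hxy).1 hy, by rw [hfx]; exact h.map_adj_iff.2 hxy⟩)
  -- inner vertices of `T` are not leaves of larger sets
  have hinner : ∀ {A A' : Set V}, IsComplete G b A → A ⊆ A' → ∀ x ∈ A, x ∉ leaves G A →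
      x ∉ leaves G A' := by
    intro A A' hA hAA x hx hxl hxl'
    obtain ⟨y, hy, z, hz, hyz⟩ := hdeg x
    exact hyz (hxl'.2.unique ⟨hAA (hA.full x hx hxl y hy), hy⟩
      ⟨hAA (hA.full x hx hxl z hz), hz⟩)
  have hsub : leaves G S ⊆ forestVerts G T := by
    intro x hx
    refine cover hG hT fun hxT => ?_
    by_contra hxl
    exact hinner hT hTS x hxT hxl hx
  have hT'S' : T' ⊆ S' := Set.subset_union_left
  have himg : ∀ y ∈ S', (y ∈ T' ∧ y ∉ leaves G T') ∨
      ∃ v ∈ leaves G T, ∃ x ∈ branch G T v, x ∈ S ∧ f x = y := by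
    intro y hy
    by_cases h0 : y ∈ T' ∧ y ∉ leaves G T'
    · exact Or.inl h0
    right
    rcases hy with hy | ⟨x, ⟨hxS, v, hv, hx⟩, rfl⟩
    · have hyl : y ∈ leaves G T' := by
        by_contra hcon'
        exact h0 ⟨hy, hcon'⟩
      obtain ⟨v, hv, rfl⟩ := hf.bij.surjOn hyl
      exact ⟨v, hv, v, self_mem_branch, hTS hv.1, rfl⟩
    · exact ⟨v, hv, x, hx, hxS, rfl⟩
  have hS'c : IsComplete G b S' := by
    refine ⟨hT'.finite.union ((hS.finite.inter_of_left _).image _), Or.inl hT'.base_mem, ?_, ?_⟩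
    · -- connectedness
      have hb' : b ∈ S' := Or.inl hT'.base_mem
      have hTr : ∀ y (hy : y ∈ T'), (G.induce S').Reachable ⟨y, hT'S' hy⟩ ⟨b, hb'⟩ := by
        intro y hy
        have := hT'.connected.preconnected ⟨y, hy⟩ ⟨b, hT'.base_mem⟩
        exact this.map (SimpleGraph.induceHomOfLE G hT'S').toHom
      have hFr : ∀ v, ∀ hv : v ∈ leaves G T, ∀ (s t : S), (G.induce S).Walk s t → (t : V) = v →
          ∀ hs : (s : V) ∈ branch G T v,
          (G.induce S').Reachable ⟨f s, Or.inr ⟨s, ⟨s.2, v, hv, hs⟩, rfl⟩⟩ ⟨b, hb'⟩ := by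
        intro v hv s t p
        obtain ⟨h, -, u, hu, huv, hv', hu', h1, h2⟩ := hloc v hv
        induction p with
        | @nil s =>
          intro ht hs
          have : f s ∈ T' := by rw [ht]; exact (hf.bij.mapsTo hv).1
          exact hTr _ this
        | @cons s s' t hadj q ih =>
          intro ht hs
          have hadj' : G.Adj (s : V) (s' : V) := hadj
          rcases branch_adj hG hT.connected hv hu huv hs hadj' with hs' | ⟨hs', -⟩
          · refine SimpleGraph.Reachable.trans (SimpleGraph.Adj.reachable ?_) (ih ht hs')
            change G.Adj (f s) (f s')
            rw [h2 _ hs, h2 _ hs']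
            exact h.map_adj_iff.2 hadj'
          · have : f s ∈ T' := by rw [hs']; exact (hf.bij.mapsTo hv).1
            exact hTr _ this
      have hall : ∀ y : S', (G.induce S').Reachable y ⟨b, hb'⟩ := by
        rintro ⟨y, hy⟩
        rcases id hy with hyT | ⟨x, ⟨hxS, v, hv, hx⟩, rfl⟩
        · exact hTr y hyT
        · obtain ⟨p⟩ := hS.connected.preconnected ⟨x, hxS⟩ ⟨v, hTS hv.1⟩
          exact hFr v hv _ _ p rfl hx
      have : Nonempty S' := ⟨⟨b, hb'⟩⟩
      exact ⟨fun x y => (hall x).trans (hall y).symm⟩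
    · intro y hy hyl z hyz
      rcases himg y hy with ⟨h1, h2⟩ | ⟨v, hv, x, hx, hxS, rfl⟩
      · exact Or.inl (hT'.full y h1 h2 z hyz)
      · have hxl : x ∉ leaves G S := fun h' => hyl ((hleaf v hv x hx hxS).1 h')
        obtain ⟨h, -, hfx, -, hadj⟩ := hmem' v hv x hx
        obtain ⟨z, rfl⟩ := h.surjective z
        rw [hfx] at hyz
        have hxz := h.map_adj_iff.1 hyz
        exact (hadj z hxz).1 (hS.full x hxS hxl z hxz)
  refine ⟨S', hT'S', hS, hS'c, ⟨?_, hinj.mono hsub, ?_⟩, ?_⟩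
  · intro x hx
    obtain ⟨v, hv, hxv⟩ := hsub hx
    exact (hleaf v hv x hxv hx.1).1 hx
  · intro y hy
    rcases himg y hy.1 with ⟨h1, h2⟩ | ⟨v, hv, x, hx, hxS, rfl⟩
    · exact absurd hy (hinner hT' hT'S' y h1 h2)
    · exact ⟨x, (hleaf v hv x hx hxS).2 hy, rfl⟩
  · intro w hw
    obtain ⟨v, hv, hwv⟩ := hsub hw
    obtain ⟨h, hH, hfw, hfv, hadj⟩ := hmem' v hv w hwv
    obtain ⟨-, -, u, hu, huv, -, -, -, -⟩ := hloc v hv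
    obtain ⟨z, ⟨hz, hwz⟩, -⟩ := hw.2
    refine ⟨h, hH, fun x => ?_, ?_⟩
    · rw [mem_branch_iff_half hG hS.connected hw hz hwz,
        mem_branch_iff_half hG hS'c.connected ((hleaf v hv w hwv hw.1).1 hw)
          ((hadj z hwz).1 hz) (by rw [hfw]; exact h.map_adj_iff.2 hwz),
        hfw, dist_apply hcon, dist_apply hcon]
    · have hsubset : ∀ n x, G.dist x w = n → x ∈ branch G S w → x ∈ branch G T v := by
        intro n
        induction n with
        | zero =>
          intro x hx _
          rw [hcon.dist_eq_zero_iff.1 hx]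
          exact hwv
        | succ n ih =>
          intro x hx hxb
          have hne : x ≠ w := by
            rintro rfl
            rw [SimpleGraph.dist_self] at hx; omega
          obtain ⟨y, hy, hxy, hd⟩ := branch_closer hcon hxb hne
          have hyv := ih y (by omega) hy
          rcases branch_adj hG hT.connected hv hu huv hyv hxy.symm with h' | ⟨-, rfl⟩
          · exact h'
          · exact absurd (eq_of_mem_branch hxb (hTS hu)) hne
      intro x hx
      exact hfv x (hsubset _ x rfl hx)

/-- Automorphisms are honest almost automorphisms. -/
theorem honest_of_aut (hG : G.IsTree) (hfin : ∀ v, (G.neighborSet v).Finite)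
    (b : V) {h : G ≃g G} (hH : h ∈ H) : ∃ T T', Honest b H T T' h := by
  have c := fun a b => SimpleGraph.dist_comm (G := G) (u := a) (v := b)
  set n := G.dist (h b) b + 1 with hn
  have hT := ball_complete hG hfin b n (by omega)
  set T : Set V := {x | G.dist x b ≤ n} with hTdef
  have hl : ∀ x, x ∈ leaves G T ↔ h x ∈ leaves G (h '' T) := by
    intro x
    constructor
    · rintro ⟨hx, z, ⟨hz, hxz⟩, huniq⟩
      refine ⟨⟨x, hx, rfl⟩, h z, ⟨⟨z, hz, rfl⟩, h.map_adj_iff.2 hxz⟩, ?_⟩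
      rintro _ ⟨⟨y, hy, rfl⟩, hxy⟩
      rw [huniq y ⟨hy, h.map_adj_iff.1 hxy⟩]
    · rintro ⟨⟨x', hx, hxx⟩, z, ⟨⟨z, hz, rfl⟩, hxz⟩, huniq⟩
      rw [h.injective hxx] at hx
      refine ⟨hx, z, ⟨hz, h.map_adj_iff.1 hxz⟩, ?_⟩
      rintro y ⟨hy, hxy⟩
      exact h.injective (huniq (h y) ⟨⟨y, hy, rfl⟩, h.map_adj_iff.2 hxy⟩)
  refine ⟨T, h '' T, hT, ⟨hT.finite.image _, ?_, ?_, ?_⟩, ⟨fun x hx => (hl x).1 hx,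
    h.injective.injOn, ?_⟩, fun v hv => ⟨h, hH, fun x => ?_, fun _ _ => rfl⟩⟩
  · refine ⟨h.symm b, ?_, by simp⟩
    change G.dist (h.symm b) b ≤ n
    have := dist_apply hG.connected h (h.symm b) b
    rw [h.apply_symm_apply, c] at this
    omega
  · have : Nonempty (h '' T) := ⟨⟨h b, b, hT.base_mem, rfl⟩⟩
    refine ⟨?_⟩
    rintro ⟨_, x, hx, rfl⟩ ⟨_, y, hy, rfl⟩
    let F : G.induce T →g G.induce (h '' T) :=
      ⟨fun x => ⟨h x, x, x.2, rfl⟩, fun hadj => h.map_adj_iff.2 hadj⟩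
    exact (hT.connected.preconnected ⟨x, hx⟩ ⟨y, hy⟩).map F
  · rintro _ ⟨x, hx, rfl⟩ hxl z hz
    obtain ⟨z, rfl⟩ := h.surjective z
    exact ⟨z, hT.full x hx (fun h' => hxl ((hl x).1 h')) z (h.map_adj_iff.1 hz), rfl⟩
  · rintro y hy
    obtain ⟨x, hx, rfl⟩ := hy.1
    exact ⟨x, (hl x).2 hy, rfl⟩
  · rw [mem_branch_iff hG.connected, mem_branch_iff hG.connected]
    constructor
    · rintro hx _ ⟨w, hw, rfl⟩ hne
      rw [dist_apply hG.connected, dist_apply hG.connected]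
      exact hx w hw fun e => hne (congrArg h e)
    · rintro hx w hw hne
      have := hx (h w) ⟨w, hw, rfl⟩ fun e => hne (h.injective e)
      rwa [dist_apply hG.connected, dist_apply hG.connected] at this

theorem exists_ball_superset (G : SimpleGraph V) (b : V) {A : Set V} (hA : A.Finite) : ∃ n, 1 ≤ n ∧ ∀ x ∈ A, G.dist x b < n := by
  obtain ⟨n, hn⟩ := (hA.image fun x => G.dist x b).bddAbove
  exact ⟨n + 1, by omega, fun x hx => Nat.lt_succ_of_le (hn ⟨x, hx, rfl⟩)⟩

theorem le_dist_of_mem_forestVerts_ball (hG : G.IsTree)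
    (hdeg : ∀ v, (G.neighborSet v).Nontrivial) {n : ℕ}
    {x : V} (hx : x ∈ forestVerts G {x | G.dist x b ≤ n}) : n ≤ G.dist x b := by
  have hG' := hG.connected
  obtain ⟨v, hv, rfl | hx⟩ := hx
  · by_contra hlt
    obtain ⟨y, hy, z, hz, hyz⟩ := hdeg x
    have hin : ∀ y, G.Adj x y → G.dist y b ≤ n := by
      intro y hy
      have h1 := hG'.dist_triangle (u := y) (v := x) (w := b)
      have h2 : G.dist y x = 1 := SimpleGraph.dist_eq_one_iff_adj.2 hy.symm
      omega
    exact hyz (hv.2.unique ⟨hin y hy, hy⟩ ⟨hin z hz, hz⟩)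
  · have : ¬ G.dist x b ≤ n := hx.1
    omega

/-- Two almost automorphisms define the same near permutation if and only if they are equivalent
in the sense that they coincide on the complement of a common finite complete subtree. -/
theorem HonestAlmostAut.toNearPerm_eq_iff (hG : G.IsTree)
    (hfin : ∀ v, (G.neighborSet v).Finite) (hdeg : ∀ v, (G.neighborSet v).Nontrivial)
    (φ ψ : HonestAlmostAut G b H) :
    φ.toNearPerm hG = ψ.toNearPerm hG ↔
      ∃ T, IsComplete G b T ∧ φ.dom ∪ ψ.dom ⊆ T ∧ ∀ x ∈ forestVerts G T,
        ∃ (hx : x ∈ forestVerts G φ.dom) (hx' : x ∈ forestVerts G ψ.dom),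
          (φ.iso ⟨x, hx⟩ : V) = ψ.iso ⟨x, hx'⟩ := by
  refine NearPerm.ofEquiv_eq_iff.trans ⟨fun h => ?_, ?_⟩
  · obtain ⟨n, hn, hlt⟩ := exists_ball_superset G b
      ((φ.dom_complete.finite.union ψ.dom_complete.finite).union h)
    refine ⟨_, ball_complete hG hfin b n hn, fun x hx => (hlt x (Or.inl hx)).le, fun x hx => ?_⟩
    have hxn := le_dist_of_mem_forestVerts_ball hG hdeg hx
    have hnot := fun hc => not_lt.2 hxn (hlt x hc)
    have h1 : x ∈ forestVerts G φ.dom :=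
      cover hG φ.dom_complete fun hc => (hnot (Or.inl (Or.inl hc))).elim
    have h2 : x ∈ forestVerts G ψ.dom :=
      cover hG ψ.dom_complete fun hc => (hnot (Or.inl (Or.inr hc))).elim
    refine ⟨h1, h2, ?_⟩
    by_contra hne
    refine hnot (Or.inr ?_)
    change extend φ.iso.toEquiv x ≠ extend ψ.iso.toEquiv x
    rw [extend_of_mem _ h1, extend_of_mem _ h2]
    exact hne
  · rintro ⟨T, hT, -, h⟩
    refine (hT.finite_compl hG).subset fun x hx hxT => hx ?_
    obtain ⟨h1, h2, he⟩ := h x hxT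
    rw [extend_of_mem _ h1, extend_of_mem _ h2]
    exact he

variable (b H) in
/-- The group of classes of `H`-honest almost automorphisms. -/
noncomputable def almostAutGroup (hG : G.IsTree) (hfin : ∀ v, (G.neighborSet v).Finite)
    (hdeg : ∀ v, (G.neighborSet v).Nontrivial) : Subgroup (NearPerm V) where
  carrier := {g | ∃ φ : HonestAlmostAut G b H, φ.toNearPerm hG = g}
  one_mem' := by
    obtain ⟨T, T', hT⟩ := honest_of_aut hG hfin b (H.one_mem)
    obtain ⟨φ, rfl, rfl, hφ⟩ := hT.exists_toNearPerm hG
    refine ⟨φ, ?_⟩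
    rw [← NearPerm.ofEquiv_one (φ.dom_complete.finite_compl hG) (φ.dom_complete.finite_compl hG)]
    refine NearPerm.ofEquiv_eq_iff.2
      ((φ.dom_complete.finite_compl hG).subset fun x hx hxT => hx ?_)
    rw [hφ x hxT, extend_of_mem _ hxT]
    rfl
  mul_mem' := by
    rintro _ _ ⟨φ, rfl⟩ ⟨ψ, rfl⟩
    obtain ⟨n, hn, hlt⟩ := exists_ball_superset G b
      (φ.dom_complete.finite.union ψ.cod_complete.finite)
    have hB := ball_complete hG hfin b n hn
    obtain ⟨S, -, hS⟩ := (φ.toHonest hG).refine hG hdeg hB fun x hx => (hlt x (Or.inl hx)).le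
    have hψi : ∀ x ∈ forestVerts G ψ.dom,
        extend ψ.iso.symm.toEquiv (extend ψ.iso.toEquiv x) = x := by
      intro x hx
      rw [extend_of_mem ψ.iso.toEquiv hx, extend_of_mem _ (ψ.iso.toEquiv ⟨x, hx⟩).2]
      exact congrArg Subtype.val (ψ.iso.symm_apply_apply ⟨x, hx⟩)
    have hψi' : ∀ x ∈ forestVerts G ψ.cod,
        extend ψ.iso.toEquiv (extend ψ.iso.symm.toEquiv x) = x := by
      intro x hx
      rw [extend_of_mem ψ.iso.symm.toEquiv hx, extend_of_mem _ (ψ.iso.symm.toEquiv ⟨x, hx⟩).2]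
      exact congrArg Subtype.val (ψ.iso.apply_symm_apply ⟨x, hx⟩)
    obtain ⟨S', hS'sub, hS'⟩ := ((ψ.toHonest hG).symm hψi).refine hG hdeg hB
      fun x hx => (hlt x (Or.inr hx)).le
    have hsub : forestVerts G {x | G.dist x b ≤ n} ⊆ forestVerts G ψ.cod := by
      intro x hx
      have hxn := le_dist_of_mem_forestVerts_ball hG hdeg hx
      exact cover hG ψ.cod_complete fun hc => absurd (hlt x (Or.inr hc)) (not_lt.2 hxn)
    obtain ⟨χ, hχ, -, hχf⟩ := ((hS'.symm fun x hx => hψi' x (hsub hx)).comp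
      hS).exists_toNearPerm hG
    refine ⟨χ, NearPerm.ofEquiv_mul ?_⟩
    refine (χ.dom_complete.finite_compl hG).subset fun x hx hxT => hx ?_
    rw [hχ] at hxT
    exact hχf x hxT
  inv_mem' := by
    rintro _ ⟨φ, rfl⟩
    have hφi : ∀ x ∈ forestVerts G φ.dom,
        extend φ.iso.symm.toEquiv (extend φ.iso.toEquiv x) = x := by
      intro x hx
      rw [extend_of_mem φ.iso.toEquiv hx, extend_of_mem _ (φ.iso.toEquiv ⟨x, hx⟩).2]
      exact congrArg Subtype.val (φ.iso.symm_apply_apply ⟨x, hx⟩)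
    obtain ⟨ψ, hψ, -, hψf⟩ := ((φ.toHonest hG).symm hφi).exists_toNearPerm hG
    refine ⟨ψ, (NearPerm.ofEquiv_eq_iff (hA := ψ.dom_complete.finite_compl hG)
      (hB := ψ.cod_complete.finite_compl hG) (hC := φ.cod_complete.finite_compl hG)
      (hD := φ.dom_complete.finite_compl hG) (e' := φ.iso.symm.toEquiv)).2
      ((ψ.dom_complete.finite_compl hG).subset fun x hx hxT => hx ?_)⟩
    rw [hψ] at hxT
    exact hψf x hxT

/-- An automorphism of the tree, viewed as a near permutation of its set of vertices. -/
noncomputable def autToNearPerm : (G ≃g G) →* NearPerm V where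
  toFun h := NearPerm.ofEquiv (A := Set.univ) (B := Set.univ) (by simp) (by simp)
    ((Equiv.Set.univ V).trans (h.toEquiv.trans (Equiv.Set.univ V).symm))
  map_one' := NearPerm.ofEquiv_one _ _
  map_mul' g h := NearPerm.ofEquiv_mul (by simp [extend])

theorem autToNearPerm_mem (hG : G.IsTree) (hfin : ∀ v, (G.neighborSet v).Finite)
    (hdeg : ∀ v, (G.neighborSet v).Nontrivial) {h : G ≃g G} (hH : h ∈ H) :
    autToNearPerm h ∈ almostAutGroup b H hG hfin hdeg := by
  obtain ⟨T, T', hT⟩ := honest_of_aut hG hfin b hH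
  obtain ⟨φ, rfl, rfl, hφ⟩ := hT.exists_toNearPerm hG
  refine ⟨φ, (NearPerm.ofEquiv_eq_iff (hA := φ.dom_complete.finite_compl hG)
    (hB := φ.cod_complete.finite_compl hG) (hC := by simp) (hD := by simp)).2
    ((φ.dom_complete.finite_compl hG).subset fun x hx hxT => hx ?_)⟩
  rw [hφ x hxT]
  simp [extend]

end AlmostAutomorphisms

/-! ### Topologies, pro-`p` subgroups and localization -/

section Topologies

/-- The topology on `G` determined by a homomorphism `f : H →* G` from a topological group: a set is
open if and only if all its preimages under the maps `h ↦ g * f h` are open. -/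
@[reducible] def cosetTopology {H G : Type*} [Group H] [TopologicalSpace H] [Group G] (f : H →* G) :
    TopologicalSpace G :=
  ⨆ g : G, TopologicalSpace.coinduced (fun h => g * f h) inferInstance

/-- If there is a group topology on `G` such that `f` is continuous and open,
then it is `cosetTopology f`. In particular there is at most one such topology. -/
theorem eq_cosetTopology {H G : Type*} [Group H] [TopologicalSpace H] [Group G]
    [t : TopologicalSpace G] [IsTopologicalGroup G] (f : H →* G)
    (hf : Continuous f) (hf' : IsOpenMap f) : t = cosetTopology f := by
  refine le_antisymm (fun s hs => ?_) (iSup_le fun g => ?_)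
  · rw [cosetTopology, isOpen_iSup_iff] at hs
    refine isOpen_iff_forall_mem_open.2 fun x hx => ?_
    refine ⟨(fun y => x * y) '' (f '' ((fun h => x * f h) ⁻¹' s)), ?_, ?_, ?_⟩
    · rintro _ ⟨_, ⟨h, hh, rfl⟩, rfl⟩
      exact hh
    · exact isOpenMap_mul_left x _ (hf' _ (isOpen_coinduced.1 (hs x)))
    · exact ⟨1, ⟨1, by simpa using hx, map_one f⟩, mul_one x⟩
  · exact continuous_iff_coinduced_le.1 (continuous_const.mul hf)

/-- Pro-`p` groups: profinite groups all of whose open normal subgroups have `p`-power index. -/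
structure IsProP (p : ℕ) (S : Type*) [Group S] [TopologicalSpace S] : Prop where
  compact : CompactSpace S
  hausdorff : T2Space S
  totallyDisconnected : TotallyDisconnectedSpace S
  index_eq : ∀ N : Subgroup S, N.Normal → IsOpen (N : Set S) → ∃ k : ℕ, N.index = p ^ k

/-- Local `p`-Sylow subgroups: maximal pro-`p` subgroups of compact open subgroups. -/
def IsLocalSylow (p : ℕ) {G : Type*} [Group G] [TopologicalSpace G] (S : Subgroup G) : Prop :=
  ∃ K : Subgroup G, IsCompact (K : Set G) ∧ IsOpen (K : Set G) ∧
    Maximal (fun S' : Subgroup G => S' ≤ K ∧ IsProP p S') S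

variable {G : Type*} [Group G]

/-- The commensurator of `S` in `G`, as a group to be equipped with the localized topology. -/
def PLocalization (S : Subgroup G) : Type _ := Subgroup.Commensurable.commensurator S

instance PLocalization.instGroup (S : Subgroup G) : Group (PLocalization S) :=
  inferInstanceAs (Group (Subgroup.Commensurable.commensurator S))

/-- The inclusion of the commensurator into `G`. -/
def PLocalization.val (S : Subgroup G) : PLocalization S →* G :=
  (Subgroup.Commensurable.commensurator S).subtype

theorem le_commensurator (S : Subgroup G) : S ≤ Subgroup.Commensurable.commensurator S := by
  intro s hs
  rw [Subgroup.Commensurable.commensurator_mem_iff]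
  have : ConjAct.toConjAct s • S = S := Subgroup.conj_smul_eq_self_of_mem hs
  rw [this]

/-- The inclusion of `S` into its commensurator. -/
def PLocalization.incl (S : Subgroup G) : S →* PLocalization S :=
  Subgroup.inclusion (le_commensurator S)

/-- The commensurator carries the group topology for which the inclusion of `S` is continuous
and open. -/
instance PLocalization.instTopologicalSpace [TopologicalSpace G] (S : Subgroup G) : TopologicalSpace (PLocalization S) :=
  cosetTopology (PLocalization.incl S)

/-- The permutation topology on the automorphism group of a graph (pointwise convergence on the
discrete set of vertices). -/
instance permutationTopology {V : Type*} (Γ : SimpleGraph V) : TopologicalSpace (Γ ≃g Γ) :=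
  TopologicalSpace.induced (fun g (v : V) => g v) (@Pi.topologicalSpace V (fun _ => V) fun _ => ⊥)

end Topologies

/-! ### Coloured trees and universal groups -/

section Coloured

/-- A `d`-regular tree, `d = |Ω| ≥ 3`, with a legal colouring of its (oriented) edges by `Ω`. -/
structure ColouredTree (V Ω : Type*) where
  graph : SimpleGraph V
  isTree : graph.IsTree
  three_le : 3 ≤ Nat.card Ω
  colour : graph.Dart → Ω
  colour_symm : ∀ e, colour e.symm = colour e
  colour_bij : ∀ x : V, Function.Bijective fun e : {e : graph.Dart // e.fst = x} => colour e

variable {V Ω : Type*} (X : ColouredTree V Ω)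

/-- The bijection `l_x` from the edges issuing from `x` to `Ω`. -/
noncomputable def ColouredTree.star (x : V) : {e : X.graph.Dart // e.fst = x} ≃ Ω :=
  Equiv.ofBijective _ (X.colour_bij x)

/-- The map induced by an automorphism on the edges issuing from `x`. -/
def ColouredTree.starMap (g : X.graph ≃g X.graph) (x : V) :
    {e : X.graph.Dart // e.fst = x} ≃ {e : X.graph.Dart // e.fst = g x} where
  toFun e := ⟨g.toHom.mapDart e.1, congrArg g e.2⟩
  invFun e := ⟨g.symm.toHom.mapDart e.1,
    (congrArg g.symm e.2).trans (g.symm_apply_apply x)⟩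
  left_inv e := by
    apply Subtype.ext
    apply SimpleGraph.Dart.ext
    exact Prod.ext (g.symm_apply_apply _) (g.symm_apply_apply _)
  right_inv e := by
    apply Subtype.ext
    apply SimpleGraph.Dart.ext
    exact Prod.ext (g.apply_symm_apply _) (g.apply_symm_apply _)

/-- The local permutation `σ(g, x)` of `g` at `x`. -/
noncomputable def ColouredTree.localPerm (g : X.graph ≃g X.graph) (x : V) : Equiv.Perm Ω :=
  (X.star x).symm.trans ((X.starMap g x).trans (X.star (g x)))

theorem ColouredTree.localPerm_one (x : V) : X.localPerm 1 x = 1 := by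
  ext ω
  exact (X.star x).apply_symm_apply ω

theorem ColouredTree.localPerm_mul (g h : X.graph ≃g X.graph) (x : V) :
    X.localPerm (g * h) x = X.localPerm g (h x) * X.localPerm h x := by
  ext ω
  change X.star _ (X.starMap (g * h) x ((X.star x).symm ω)) = X.star _ (X.starMap g (h x)
    ((X.star (h x)).symm (X.star (h x) (X.starMap h x ((X.star x).symm ω)))))
  rw [Equiv.symm_apply_apply]
  rfl

/-- The Burger--Mozes universal group `U(F)`. -/
def universalGroup (F : Subgroup (Equiv.Perm Ω)) : Subgroup (X.graph ≃g X.graph) where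
  carrier := {g | ∀ x, X.localPerm g x ∈ F}
  one_mem' x := by rw [X.localPerm_one]; exact F.one_mem
  mul_mem' hg hh x := by rw [X.localPerm_mul]; exact F.mul_mem (hg _) (hh _)
  inv_mem' := by
    intro g hg x
    have h := X.localPerm_mul g g⁻¹ x
    rw [mul_inv_cancel, X.localPerm_one] at h
    rw [← inv_eq_of_mul_eq_one_right h.symm]
    exact F.inv_mem (hg _)

theorem ColouredTree.finite_neighborSet (v : V) : (X.graph.neighborSet v).Finite := by
  have : Finite Ω := Nat.finite_of_card_ne_zero (by have := X.three_le; omega)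
  have : Finite {e : X.graph.Dart // e.fst = v} := Finite.of_equiv Ω (X.star v).symm
  refine (Set.finite_range fun e : {e : X.graph.Dart // e.fst = v} => e.1.snd).subset ?_
  intro u hu
  exact ⟨⟨⟨(v, u), hu⟩, rfl⟩, rfl⟩

theorem ColouredTree.nontrivial_neighborSet (v : V) : (X.graph.neighborSet v).Nontrivial := by
  have : Finite Ω := Nat.finite_of_card_ne_zero (by have := X.three_le; omega)
  have : Nontrivial Ω := Finite.one_lt_card_iff_nontrivial.1 (by have := X.three_le; omega)
  have : Nontrivial {e : X.graph.Dart // e.fst = v} := (X.star v).nontrivial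
  obtain ⟨⟨e, he⟩, ⟨e', he'⟩, hne⟩ := exists_pair_ne {e : X.graph.Dart // e.fst = v}
  refine ⟨e.snd, by have := e.adj; rwa [he] at this, e'.snd,
    by have := e'.adj; rwa [he'] at this, fun h => hne (Subtype.ext ?_)⟩
  exact SimpleGraph.Dart.ext _ _ (Prod.ext (he.trans he'.symm) h)

/-- Lederle's coloured Neretin group `N(F)`: the group of classes of `U(F)`-honest almost
automorphisms. -/
noncomputable def neretinGroup (b : V) (F : Subgroup (Equiv.Perm Ω)) : Subgroup (NearPerm V) :=
  almostAutGroup b (universalGroup X F) X.isTree X.finite_neighborSet X.nontrivial_neighborSet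

/-- The inclusion of `U(F)` into `N(F)`. -/
noncomputable def universalToNeretin (b : V) (F : Subgroup (Equiv.Perm Ω)) :
    universalGroup X F →* neretinGroup X b F :=
  (autToNearPerm.comp (universalGroup X F).subtype).codRestrict _
    fun h => autToNearPerm_mem _ _ _ h.2

/-- `N(F)` carries the group topology for which the inclusion of `U(F)` is continuous and open;
here `U(F)` has the subspace topology of the automorphism group of the tree. -/
noncomputable instance neretinGroup.instTopologicalSpace (b : V) (F : Subgroup (Equiv.Perm Ω)) :
    TopologicalSpace (neretinGroup X b F) :=
  cosetTopology (universalToNeretin X b F)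

/-- The group `F̂` of all permutations preserving each orbit of `F` setwise. -/
def orbitHull (F : Subgroup (Equiv.Perm Ω)) : Subgroup (Equiv.Perm Ω) where
  carrier := {σ | ∀ ω, MulAction.orbit F (σ ω) = MulAction.orbit F ω}
  one_mem' _ := rfl
  mul_mem' hσ hτ ω := (hσ _).trans (hτ ω)
  inv_mem' := by
    intro σ hσ ω
    have := hσ (σ⁻¹ ω)
    rw [← Equiv.Perm.mul_apply, mul_inv_cancel, Equiv.Perm.one_apply] at this
    exact this.symm

end Coloured

end NeretinLoc

namespace NeretinLoc

/-! ### Sylow theory of profinite groups -/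

section Profinite

open Topology

/-! Let S be the stabilizer of b in U(F(p)), seen inside N(F) (`vertexStab`). The normalizer
hypothesis enters through one statement about permutations (`mem_of_conj_stabilizer_le`): if σ ∈ F
conjugates F(p)_ω into F(p), then σ ∈ F(p). Indeed, since F and F(p) have the same orbits, some t ∈
F(p) satisfies tω = σω, and t⁻¹σ fixes ω and normalizes F(p)_ω.

S is a local Sylow subgroup (`isLocalSylow_vertexStab`). It is pro-p because raising an element to
the power |F(p)| enlarges its fixed ball by one. Let R be a pro-p group between S and the stabilizer
of b in U(F). The local permutations at x of the elements of R fixing x form a p-group. For x = b it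
contains F(p), hence equals it. For x ≠ b it fixes the colour ω of the edge towards b and contains
F(p)_ω, which by the hypothesis is its own normalizer in it; a proper subgroup of a finite p-group
never is, so the group is F(p)_ω. Dividing by elements of S, ball after ball, gives R ≤ U(F(p)).

The commensurator of S is N(F(p)). Elements of N(F(p)) conjugate the fixator in U(F(p)) of a large
ball into S. Conversely, let g commensurate S and suppose that at infinitely many vertices x the
local permutation of g conjugates some a_x ∈ F(p)_ω out of F(p), where ω is the colour towards b.
Choose s_x ∈ S supported on the half-tree behind x, with local permutation a_x at x. Two of them,
s_i and s_j, agree modulo S ∩ g⁻¹Sg, and s_i⁻¹s_j has local permutation a_j at j or a_i⁻¹ at i; its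
conjugate must lie in F(p), a contradiction. So all but finitely many local permutations of g lie in
F(p), and g can be represented by pieces of U(F(p)) (`mem_of_mem_commensurator`).

The two topologies coincide because both are determined by S
(`exists_localization_vertexStab_equiv`). Finally, Sylow theory of profinite groups shows that two
local Sylow subgroups, after conjugating one of them, have the same intersection with some open
subgroup (`IsLocalSylow.exists_conj`); the commensurator and its topology depend on no more than
that (`PLocalization.exists_equiv_of_inf_eq`). -/

/-- The isomorphism of topological groups from a subgroup to its image under an embedding. -/
noncomputable def mapEquivOfIsEmbedding {H G : Type*} [Group H] [TopologicalSpace H] [Group G]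
    [TopologicalSpace G] (f : H →* G) (hf : IsEmbedding f) (P : Subgroup H) :
    P ≃ₜ* P.map f where
  toMulEquiv := P.equivMapOfInjective f hf.injective
  continuous_toFun := by
    refine continuous_induced_rng.2 ?_
    exact hf.continuous.comp continuous_subtype_val
  continuous_invFun := by
    refine continuous_induced_rng.2 (hf.isInducing.continuous_iff.2 ?_)
    refine continuous_subtype_val.congr fun x => ?_
    obtain ⟨x, rfl⟩ := (P.equivMapOfInjective f hf.injective).surjective x
    change _ = f (((P.equivMapOfInjective f hf.injective).symm _ : P) : H)
    rw [MulEquiv.symm_apply_apply]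
    rfl

theorem mapEquivOfIsEmbedding_symm_apply {H G : Type*} [Group H] [TopologicalSpace H] [Group G]
    [TopologicalSpace G] (f : H →* G) (hf : IsEmbedding f) (P : Subgroup H) (y : P.map f) :
    f ((mapEquivOfIsEmbedding f hf P).symm y) = y := by
  obtain ⟨x, rfl⟩ := (mapEquivOfIsEmbedding f hf P).surjective y
  rw [ContinuousMulEquiv.symm_apply_apply]
  rfl

variable {p : ℕ}

/-- An open normal subgroup `N` of `R` contains the preimage of an open normal subgroup `M` of `S`,
and the index of that preimage divides the index of `M`, a power of `p`. -/
theorem IsProP.of_isClosedEmbedding {R S : Type*} [Group R] [TopologicalSpace R] [Group S]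
    [TopologicalSpace S] [IsTopologicalGroup S] [Fact p.Prime] (hS : IsProP p S) (f : R →* S)
    (hf : IsClosedEmbedding f) : IsProP p R := by
  have := hS.compact
  have := hS.hausdorff
  have := hS.totallyDisconnected
  refine ⟨hf.compactSpace, hf.isEmbedding.t2Space, ?_, fun N _ hN => ?_⟩
  · exact ⟨isTotallyDisconnected_of_image hf.continuous.continuousOn hf.injective
      (isTotallyDisconnected_of_totallyDisconnectedSpace _)⟩
  · obtain ⟨W, hW, hWN⟩ := hf.isInducing.isOpen_iff.1 hN
    have h1 : (1 : S) ∈ W := by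
      have : (1 : R) ∈ f ⁻¹' W := hWN ▸ N.one_mem
      simpa using this
    obtain ⟨M, hM⟩ := ProfiniteGrp.exist_openNormalSubgroup_sub_open_nhds_of_one hW h1
    obtain ⟨k, hk⟩ := hS.index_eq M.toSubgroup M.isNormal' M.isOpen'
    have hle : M.toSubgroup.comap f ≤ N := by
      intro x hx
      have : x ∈ f ⁻¹' W := hM hx
      rw [hWN] at this
      exact this
    have h2 : N.index ∣ p ^ k := by
      rw [← hk]
      refine (Subgroup.index_dvd_of_le hle).trans ?_
      have := M.isNormal'
      rw [Subgroup.index_comap]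
      exact Subgroup.relIndex_dvd_index_of_normal _ _
    obtain ⟨j, -, hj⟩ := (Nat.dvd_prime_pow Fact.out).1 h2
    exact ⟨j, hj⟩

theorem IsProP.of_equiv {R S : Type*} [Group R] [TopologicalSpace R] [Group S]
    [TopologicalSpace S] [IsTopologicalGroup S] [Fact p.Prime] (hS : IsProP p S) (f : R ≃ₜ* S) :
    IsProP p R :=
  hS.of_isClosedEmbedding f.toMulEquiv.toMonoidHom f.toHomeomorph.isClosedEmbedding

theorem IsProP.map_of_isEmbedding {H G : Type*} [Group H] [TopologicalSpace H]
    [IsTopologicalGroup H] [Group G] [TopologicalSpace G] [Fact p.Prime] {P : Subgroup H}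
    (hP : IsProP p P) (f : H →* G) (hf : IsEmbedding f) : IsProP p (P.map f) :=
  hP.of_equiv (mapEquivOfIsEmbedding f hf P).symm

section Compact

variable {K : Type*} [Group K] [TopologicalSpace K] [IsTopologicalGroup K] [CompactSpace K]
  [Fact p.Prime]

/-- A pro-`p` group fixes a coset of every open subgroup of index prime to `p`. -/
theorem IsProP.exists_conj_mem_of_isOpen {Q : Type*} [Group Q] [TopologicalSpace Q]
    (hQ : IsProP p Q) (f : Q →* K) (hf : Continuous f) {U : Subgroup K}
    (hU : IsOpen (U : Set K)) (hi : ¬ p ∣ U.index) : ∃ k : K, ∀ q, k⁻¹ * f q * k ∈ U := by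
  have hfin : Finite (K ⧸ U) := U.quotient_finite_of_isOpen hU
  have : U.FiniteIndex := Subgroup.finiteIndex_of_finite_quotient
  have hMo : IsOpen (U.normalCore : Set K) := Subgroup.isOpen_of_isClosed_of_finiteIndex _
    (U.normalCore_isClosed (U.isClosed_of_isOpen hU))
  -- The image of `Q` in the permutations of the finite set `K ⧸ U` is a `p`-group, since the kernel
  -- is open. As `p` does not divide the number of cosets, some coset `gU` is fixed, and `g` is the
  -- required element.
  let F : Q →* Equiv.Perm (K ⧸ U) := (MulAction.toPermHom K (K ⧸ U)).comp f
  have hker : F.ker = U.normalCore.comap f := by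
    rw [Subgroup.normalCore_eq_ker, MonoidHom.comap_ker]
  obtain ⟨k, hk⟩ := hQ.index_eq F.ker inferInstance (by
    rw [hker]; exact hMo.preimage hf)
  have hpg : IsPGroup p F.range := IsPGroup.of_card (n := k) (by
    rw [← Subgroup.index_ker, hk])
  obtain ⟨x, hx⟩ := hpg.nonempty_fixed_point_of_prime_not_dvd_card (K ⧸ U) hi
  obtain ⟨g, rfl⟩ := QuotientGroup.mk_surjective x
  refine ⟨g, fun q => ?_⟩
  have h1 := hx ⟨F q, q, rfl⟩
  have h2 : ((f q * g : K) : K ⧸ U) = (g : K ⧸ U) := h1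
  have := QuotientGroup.eq.1 h2.symm
  rwa [← mul_assoc] at this

variable [TotallyDisconnectedSpace K]

/-- A closed subgroup is pro-`p` if it is minimal among those which lie only in open subgroups of
index prime to `p`. -/
theorem isProP_of_minimal [T2Space K] {P : Subgroup K} (hP : Minimal (fun H : Subgroup K =>
      IsClosed (H : Set K) ∧ ∀ U : Subgroup K, IsOpen (U : Set K) → H ≤ U → ¬ p ∣ U.index) P) :
    IsProP p P := by
  obtain ⟨⟨hPc, hPi⟩, hmin⟩ := hP
  have : CompactSpace P := isCompact_iff_compactSpace.1 hPc.isCompact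
  refine ⟨inferInstance, inferInstance, inferInstance, fun N hN hNo => ?_⟩
  have hfin : Finite (P ⧸ N) := N.quotient_finite_of_isOpen hNo
  -- The preimage `Q` in `P` of a Sylow subgroup of `P ⧸ N` will be shown to have the property for
  -- which `P` is minimal. Then `Q = P`, so `P ⧸ N` is a `p`-group.
  let Q₀ : Sylow p (P ⧸ N) := default
  set Q₁ : Subgroup P := (Q₀ : Subgroup (P ⧸ N)).comap (QuotientGroup.mk' N) with hQ₁
  have hNQ : N ≤ Q₁ := by
    intro x hx
    have : (QuotientGroup.mk' N) x = 1 := (QuotientGroup.eq_one_iff x).2 hx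
    rw [hQ₁, Subgroup.mem_comap, this]
    exact one_mem _
  have hQ₁o : IsOpen (Q₁ : Set P) := Subgroup.isOpen_mono hNQ hNo
  have hQ₁i : ¬ p ∣ Q₁.index := by
    rw [hQ₁, Subgroup.index_comap_of_surjective _ (QuotientGroup.mk'_surjective N)]
    exact Q₀.not_dvd_index
  set Q : Subgroup K := Q₁.map P.subtype with hQ
  have hQP : Q ≤ P := Subgroup.map_subtype_le Q₁
  have hQrel : Q.relIndex P = Q₁.index := by
    rw [Subgroup.relIndex, hQ, Subgroup.subgroupOf, Subgroup.comap_map_eq_self_of_injective]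
    exact P.subtype_injective
  obtain ⟨W, hW, hWN⟩ := isOpen_induced_iff.1 hNo
  have key : P ≤ Q := by
    refine hmin ⟨?_, fun U hU hQU hdvd => ?_⟩ hQP
    · have : IsClosed (Q₁ : Set P) := Q₁.isClosed_of_isOpen hQ₁o
      exact hPc.isClosedEmbedding_subtypeVal.isClosedMap _ this
    · have h1 : (1 : K) ∈ W ∩ U :=
        ⟨by have : (1 : P) ∈ ((↑) : P → K) ⁻¹' W := hWN ▸ N.one_mem
            simpa using this, U.one_mem⟩
      -- Since `M ∩ P ≤ N ≤ Q`, the groups `Q` and `P` have the same intersection with `M`.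
      -- Comparing indices through `M` gives [K : QM] = [P : Q][K : PM], and `p` divides neither
      -- factor, although it would divide the left side because QM ≤ U.
      obtain ⟨M, hM⟩ := ProfiniteGrp.exist_openNormalSubgroup_sub_open_nhds_of_one
        (hW.inter hU) h1
      have := M.isNormal'
      set M' := M.toSubgroup
      have hMo : IsOpen (M' : Set K) := M.isOpen'
      have hMi : M'.index ≠ 0 := by
        have := M'.quotient_finite_of_isOpen hMo
        exact Subgroup.index_ne_zero_of_finite
      have hMP : M' ⊓ P ≤ Q := by
        rintro x ⟨hx, hxP⟩
        have : (⟨x, hxP⟩ : P) ∈ ((↑) : P → K) ⁻¹' W := (hM hx).1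
        rw [hWN] at this
        exact ⟨⟨x, hxP⟩, hNQ this, rfl⟩
      have hdvdQ : p ∣ (Q ⊔ M').index := hdvd.trans
        (Subgroup.index_dvd_of_le (sup_le hQU fun x hx => (hM hx).2))
      have e1 := Subgroup.relIndex_mul_index (H := M') (K := Q ⊔ M') le_sup_right
      have e2 := Subgroup.relIndex_mul_index (H := M') (K := P ⊔ M') le_sup_right
      rw [Subgroup.relIndex_sup_right] at e1 e2
      have e3 := Subgroup.relIndex_mul_relIndex _ _ _ hMP hQP
      rw [Subgroup.inf_relIndex_right] at e3
      have e4 : (M' ⊓ P).relIndex Q = M'.relIndex Q := by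
        rw [← Subgroup.inf_relIndex_right (M' ⊓ P), inf_assoc, inf_eq_right.2 hQP,
          Subgroup.inf_relIndex_right]
      rw [e4] at e3
      have hne : M'.relIndex Q ≠ 0 := fun h => hMi (by rw [← e1, h, zero_mul])
      have e5 : (Q ⊔ M').index = Q.relIndex P * (P ⊔ M').index := by
        refine Nat.eq_of_mul_eq_mul_left (Nat.pos_of_ne_zero hne) ?_
        rw [e1, ← mul_assoc, e3, e2]
      rw [e5, hQrel] at hdvdQ
      refine ((Nat.Prime.dvd_mul Fact.out).1 hdvdQ).elim hQ₁i ?_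
      exact hPi _ (Subgroup.isOpen_mono le_sup_right hMo) le_sup_left
  have hQ₁top : Q₁ = ⊤ := by
    have : Q.relIndex P = 1 := Subgroup.relIndex_eq_one.2 key
    rw [hQrel] at this
    exact Subgroup.index_eq_one.1 this
  have hQ₀top : (Q₀ : Subgroup (P ⧸ N)) = ⊤ := by
    refine Subgroup.comap_injective (QuotientGroup.mk'_surjective N) ?_
    rw [Subgroup.comap_top]
    exact hQ₁top
  have hpg : IsPGroup p (P ⧸ N) := by
    have := Q₀.isPGroup'
    rw [hQ₀top] at this
    exact this.of_equiv Subgroup.topEquiv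
  obtain ⟨k, hk⟩ := IsPGroup.iff_card.1 hpg
  exact ⟨k, hk⟩

variable (p K) in
/-- Existence of Sylow subgroups of profinite groups. -/
theorem exists_isProP_not_dvd_index [T2Space K] : ∃ P : Subgroup K, IsProP p P ∧
    IsClosed (P : Set K) ∧ ∀ U : Subgroup K, IsOpen (U : Set K) → P ≤ U → ¬ p ∣ U.index := by
  -- Zorn's lemma in the reversed order. Compactness makes chains bounded: an open subgroup
  -- containing the intersection of a chain of closed subgroups already contains a member of the
  -- chain.
  obtain ⟨P, -, hP⟩ := @zorn_le_nonempty₀ (Subgroup K)ᵒᵈ _ {H : Subgroup K |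
      IsClosed (H : Set K) ∧ ∀ U : Subgroup K, IsOpen (U : Set K) → H ≤ U → ¬ p ∣ U.index}
    (by
      intro c hc hchain (y : Subgroup K) hy
      have hne : Nonempty c := ⟨⟨y, hy⟩⟩
      refine ⟨(sInf (show Set (Subgroup K) from c) : Subgroup K), ⟨?_, fun U hU hle => ?_⟩,
        fun z hz => sInf_le (α := Subgroup K) hz⟩
      · rw [Subgroup.coe_sInf]
        exact isClosed_biInter fun H hH => (hc hH).1
      · obtain ⟨H, hH⟩ := exists_subset_nhds_of_isCompact' (X := K) (ι := c)
          (V := fun H => ((show Subgroup K from H.1) : Set K))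
          (by
            intro a b
            rcases hchain.total a.2 b.2 with h | h
            · exact ⟨b, h, le_rfl⟩
            · exact ⟨a, le_rfl, h⟩)
          (fun H => (hc H.2).1.isCompact) (fun H => (hc H.2).1) (U := U)
          (by
            intro x hx
            refine hU.mem_nhds (hle ?_)
            rw [Subgroup.mem_sInf]
            intro H hH
            exact Set.mem_iInter.1 hx ⟨H, hH⟩)
        exact (hc H.2).2 U hU hH)
    (⊤ : Subgroup K) ⟨isClosed_univ, fun U _ hle => by
      rw [top_le_iff.1 hle, Subgroup.index_top]
      exact (Fact.out : p.Prime).not_dvd_one⟩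
  have hP' : Minimal (fun H : Subgroup K =>
      IsClosed (H : Set K) ∧ ∀ U : Subgroup K, IsOpen (U : Set K) → H ≤ U → ¬ p ∣ U.index)
      (show Subgroup K from P) := hP
  exact ⟨P, isProP_of_minimal hP', hP'.1.1, hP'.1.2⟩

/-- Conjugacy of Sylow subgroups of profinite groups. -/
theorem IsProP.exists_conj_mem {Q : Type*} [Group Q] [TopologicalSpace Q]
    (hQ : IsProP p Q) (f : Q →* K) (hf : Continuous f) {P : Subgroup K}
    (hP : IsClosed (P : Set K))
    (hi : ∀ U : Subgroup K, IsOpen (U : Set K) → P ≤ U → ¬ p ∣ U.index) :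
    ∃ k : K, ∀ q, k⁻¹ * f q * k ∈ P := by
  let ι := {U : Subgroup K // IsOpen (U : Set K) ∧ P ≤ U}
  -- `P` is the intersection of the open subgroups `U` containing it. The elements conjugating the
  -- image of `Q` into such a `U` form a nonempty closed set, and these sets are directed, so by
  -- compactness they have a common element.
  let X : ι → Set K := fun U => {k | ∀ q, k⁻¹ * f q * k ∈ U.1}
  have hXc : ∀ U, IsClosed (X U) := by
    intro U
    have : X U = ⋂ q, (fun k : K => k⁻¹ * f q * k) ⁻¹' (U.1 : Set K) := by
      ext k; simp [X]
    rw [this]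
    exact isClosed_iInter fun q => (U.1.isClosed_of_isOpen U.2.1).preimage (by fun_prop)
  have : Nonempty ι := ⟨⟨⊤, isOpen_univ, le_top⟩⟩
  obtain ⟨k, hk⟩ := IsCompact.nonempty_iInter_of_directed_nonempty_isCompact_isClosed X
    (fun U U' => ⟨⟨U.1 ⊓ U'.1, U.2.1.inter U'.2.1, le_inf U.2.2 U'.2.2⟩,
      fun k hk q => (hk q).1, fun k hk q => (hk q).2⟩)
    (fun U => hQ.exists_conj_mem_of_isOpen f hf U.2.1 (hi _ U.2.1 U.2.2))
    (fun U => (hXc U).isCompact) hXc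
  refine ⟨k, fun q => ?_⟩
  have e := ProfiniteGrp.closedSubgroup_eq_sInf_open (⟨P, hP⟩ : ClosedSubgroup K)
  have e' : P = sInf {N : Subgroup K | IsOpen (N : Set K) ∧ P ≤ N} := e
  rw [e', Subgroup.mem_sInf]
  intro N hN
  exact Set.mem_iInter.1 hk ⟨N, hN⟩ q

end Compact

/-! ### Local Sylow subgroups: conjugacy up to an open subgroup. -/

section LocalSylow

variable {G : Type*} [Group G]

theorem mem_map_conj {S : Subgroup G} {g x : G} :
    x ∈ S.map (MulAut.conj g).toMonoidHom ↔ g⁻¹ * x * g ∈ S := by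
  constructor
  · rintro ⟨y, hy, rfl⟩
    simpa [mul_assoc] using hy
  · intro h
    exact ⟨_, h, by simp [mul_assoc]⟩

theorem IsProP.isClosed [TopologicalSpace G] [T2Space G] {S : Subgroup G} (hS : IsProP p S) :
    IsClosed (S : Set G) :=
  (isCompact_iff_compactSpace.2 hS.compact).isClosed

variable [TopologicalSpace G] [Fact p.Prime]

theorem IsProP.mono [IsTopologicalGroup G] {R S : Subgroup G} (hS : IsProP p S)
    (hR : IsClosed (R : Set G)) (hle : R ≤ S) : IsProP p R :=
  hS.of_isClosedEmbedding (Subgroup.inclusion hle) (IsClosedEmbedding.inclusion hle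
    (hR.preimage continuous_subtype_val))

theorem IsProP.conj [IsTopologicalGroup G] {S : Subgroup G} (hS : IsProP p S) (g : G) :
    IsProP p (S.map (MulAut.conj g).toMonoidHom) :=
  hS.map_of_isEmbedding _
    ((Homeomorph.mulLeft g).trans (Homeomorph.mulRight g⁻¹)).isEmbedding

variable [NonarchimedeanGroup G] [T2Space G]

/-- Pro-`p` subgroups of a compact group are contained in conjugates of any maximal one. -/
theorem exists_conj_le_of_maximal {K S Q : Subgroup G} (hK : IsCompact (K : Set G))
    (hS : Maximal (fun S' : Subgroup G => S' ≤ K ∧ IsProP p S') S) (hQK : Q ≤ K)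
    (hQ : IsProP p Q) : ∃ k ∈ K, Q ≤ S.map (MulAut.conj k).toMonoidHom := by
  have : CompactSpace K := isCompact_iff_compactSpace.1 hK
  -- Both groups are compared with one Sylow subgroup `P` of `K`: S ≤ aPa⁻¹ and Q ≤ cPc⁻¹.
  -- Maximality turns the first inclusion into an equality, so `k = c * a⁻¹` works.
  obtain ⟨P, hPp, hPc, hPi⟩ := exists_isProP_not_dvd_index p K
  obtain ⟨a, ha⟩ := hS.1.2.exists_conj_mem (Subgroup.inclusion hS.1.1)
    (continuous_inclusion hS.1.1) hPc hPi
  obtain ⟨c, hc⟩ := hQ.exists_conj_mem (Subgroup.inclusion hQK) (continuous_inclusion hQK) hPc hPi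
  have hP₁ : IsProP p ((P.map K.subtype).map (MulAut.conj (a : G)).toMonoidHom) :=
    (hPp.map_of_isEmbedding K.subtype IsEmbedding.subtypeVal).conj _
  have hle := hS.2 (y := (P.map K.subtype).map (MulAut.conj (a : G)).toMonoidHom) ⟨by
      rintro _ ⟨_, ⟨y, -, rfl⟩, rfl⟩
      exact K.mul_mem (K.mul_mem a.2 y.2) (K.inv_mem a.2), hP₁⟩ (by
    intro s hs
    rw [mem_map_conj]
    exact ⟨_, ha ⟨s, hs⟩, rfl⟩)
  refine ⟨c * a⁻¹, K.mul_mem c.2 (K.inv_mem a.2), fun q hq => ?_⟩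
  rw [mem_map_conj]
  apply hle
  rw [mem_map_conj]
  refine ⟨_, hc ⟨q, hq⟩, ?_⟩
  simp [mul_assoc]

/-- The intersection of a maximal pro-`p` subgroup with an open normal subgroup is a maximal
pro-`p` subgroup of the latter. -/
theorem eq_inf_of_maximal {K S L Q : Subgroup G} (hK : IsCompact (K : Set G))
    (hS : Maximal (fun S' : Subgroup G => S' ≤ K ∧ IsProP p S') S)
    (hLK : L ≤ K) (hLn : ∀ k ∈ K, ∀ x ∈ L, k⁻¹ * x * k ∈ L)
    (hQ : IsProP p Q) (hQL : Q ≤ L) (hSQ : S ⊓ L ≤ Q) : Q = S ⊓ L := by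
  obtain ⟨k, hk, hle⟩ := exists_conj_le_of_maximal hK hS (hQL.trans hLK) hQ
  have hmem : ∀ q ∈ Q, k⁻¹ * q * k ∈ S ⊓ L := fun q hq =>
    ⟨mem_map_conj.1 (hle hq), hLn k hk q (hQL hq)⟩
  refine le_antisymm (fun q hq => ?_) hSQ
  -- the elements `x` of `K` with `x⁻¹ Q x ≤ Q` form a closed submonoid of a compact group
  suffices h : k * q * k⁻¹ ∈ Q by
    have := hmem _ h
    simpa [mul_assoc] using this
  have : CompactSpace K := isCompact_iff_compactSpace.1 hK
  have hmem' : ∀ n : ℕ, k⁻¹ ^ n * q * k ^ n ∈ Q := by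
    intro n
    induction n with
    | zero => simpa using hq
    | succ n ih =>
      have := hSQ (hmem _ ih)
      rw [pow_succ', pow_succ]
      simpa [mul_assoc] using this
  -- If k q k⁻¹ ∉ Q, the same holds for `k * x` in place of `k`, for all `x` in an open normal
  -- subgroup `N`. A suitable power k⁻⁽ⁿ⁺¹⁾ lies in `N`, and for this `x` the product is k⁻ⁿ,
  -- contradicting `hmem'`.
  by_contra hcon
  have hopen : IsOpen {x : K | (x : G) * q * (x : G)⁻¹ ∉ Q} :=
    (hQ.isClosed.isOpen_compl).preimage
      (by fun_prop : Continuous fun x : K => (x : G) * q * (x : G)⁻¹)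
  have hW : IsOpen ((fun x : K => (⟨k, hk⟩ : K) * x) ⁻¹'
      {x : K | (x : G) * q * (x : G)⁻¹ ∉ Q}) := hopen.preimage (continuous_const_mul _)
  obtain ⟨N, hN⟩ := ProfiniteGrp.exist_openNormalSubgroup_sub_open_nhds_of_one hW (by simpa using hcon)
  have hNn := N.isNormal'
  set N' := N.toSubgroup
  have hNi : N'.index ≠ 0 := by
    have := N'.quotient_finite_of_isOpen N.isOpen'
    exact Subgroup.index_ne_zero_of_finite
  have hpow : ((⟨k, hk⟩ : K)⁻¹) ^ N'.index ∈ N' := N'.pow_index_mem _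
  have h1 := hN hpow
  obtain ⟨n, hn⟩ := Nat.exists_eq_succ_of_ne_zero hNi
  apply h1
  have := hmem' n
  rw [hn]
  convert this using 1
  simp [pow_succ', mul_assoc]

/-- Any two local Sylow subgroups are conjugate up to finite index. -/
theorem IsLocalSylow.exists_conj {S S' : Subgroup G} (hS : IsLocalSylow p S)
    (hS' : IsLocalSylow p S') : ∃ (k : G) (L : Subgroup G), IsOpen (L : Set G) ∧
      S ⊓ L = S'.map (MulAut.conj k).toMonoidHom ⊓ L := by
  obtain ⟨K, hKc, hKo, hSK⟩ := hS
  obtain ⟨K', hKc', hKo', hSK'⟩ := hS'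
  have : CompactSpace K := isCompact_iff_compactSpace.1 hKc
  have hW : IsOpen ((K'.subgroupOf K : Subgroup K) : Set K) := hKo'.preimage continuous_subtype_val
  -- `L` is open and normal in `K` and also contained in `K'`. A conjugate kS'k⁻¹ contains S ∩ L by
  -- conjugacy in `K'`; since S ∩ L is maximal pro-`p` in `L`, it equals kS'k⁻¹ ∩ L.
  obtain ⟨N, hN⟩ := ProfiniteGrp.exist_openNormalSubgroup_sub_open_nhds_of_one hW (Subgroup.one_mem _)
  have hNn := N.isNormal'
  set L : Subgroup G := N.toSubgroup.map K.subtype with hL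
  have hLo : IsOpen (L : Set G) := hKo.isOpenMap_subtype_val _ N.isOpen'
  have hLK : L ≤ K := Subgroup.map_subtype_le _
  have hLK' : L ≤ K' := by
    rintro _ ⟨x, hx, rfl⟩
    exact hN hx
  have hLc : IsClosed (L : Set G) := L.isClosed_of_isOpen hLo
  have hLn : ∀ k ∈ K, ∀ x ∈ L, k⁻¹ * x * k ∈ L := by
    rintro k hk _ ⟨x, hx, rfl⟩
    exact ⟨_, by simpa using hNn.conj_mem x hx (⟨k, hk⟩ : K)⁻¹, rfl⟩
  have hSL : IsProP p (S ⊓ L : Subgroup G) := hSK.1.2.mono (hSK.1.2.isClosed.inter hLc) inf_le_left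
  obtain ⟨k, -, hle⟩ := exists_conj_le_of_maximal hKc' hSK' (inf_le_right.trans hLK') hSL
  refine ⟨k, L, hLo, (eq_inf_of_maximal hKc hSK hLK hLn ?_ inf_le_right
    (le_inf hle inf_le_right)).symm⟩
  have := hSK'.1.2.conj k
  exact this.mono (this.isClosed.inter hLc) inf_le_left

end LocalSylow

end Profinite

/-! ### Topologies determined by an open subgroup -/

section CosetTopology

open Topology

variable {H G : Type*} [Group H] [TopologicalSpace H] [Group G]

/-- The topology is given through an equation so that the lemma applies by `rfl` to the instances on
`neretinGroup` and `PLocalization`. -/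
theorem isOpen_cosetTopology_iff [t : TopologicalSpace G] {f : H →* G} (ht : t = cosetTopology f)
    {s : Set G} : IsOpen s ↔ ∀ g : G, IsOpen ((fun h => g * f h) ⁻¹' s) := by
  subst ht
  rw [isOpen_iSup_iff]
  exact Iff.rfl

/-- For open `W`, the preimage of `f '' W` under `h ↦ g * f h` is a translate of `W` when `g` lies
in the image of `f`, and empty otherwise. This is where injectivity is needed. -/
theorem isOpenEmbedding_of_cosetTopology [t : TopologicalSpace G] [IsTopologicalGroup H]
    {f : H →* G} (ht : t = cosetTopology f) (hf : Function.Injective f) : IsOpenEmbedding f := by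
  refine IsOpenEmbedding.of_continuous_injective_isOpenMap ⟨fun s hs => ?_⟩ hf fun W hW => ?_
  · simpa using (isOpen_cosetTopology_iff ht).1 hs 1
  · refine (isOpen_cosetTopology_iff ht).2 fun g => ?_
    by_cases h : ∃ h₀, g * f h₀ ∈ f '' W
    · obtain ⟨h₀, w₀, -, hw⟩ := h
      have hg : g = f (w₀ * h₀⁻¹) := by rw [map_mul, map_inv, hw]; group
      have : (fun h => g * f h) ⁻¹' (f '' W) = (fun h => w₀ * h₀⁻¹ * h) ⁻¹' W := by
        ext h
        rw [Set.mem_preimage, hg, ← map_mul, hf.mem_set_image]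
        rfl
      rw [this]
      exact hW.preimage (continuous_const_mul _)
    · convert isOpen_empty
      rw [Set.eq_empty_iff_forall_notMem]
      exact fun h₀ hh => h ⟨h₀, hh⟩

theorem continuous_const_mul_of_cosetTopology [t : TopologicalSpace G] {f : H →* G}
    (ht : t = cosetTopology f) (g : G) : Continuous fun x : G => g * x := by
  refine ⟨fun s hs => (isOpen_cosetTopology_iff ht).2 fun a => ?_⟩
  convert (isOpen_cosetTopology_iff ht).1 hs (g * a) using 1
  ext h
  simp [mul_assoc]

/-- If conjugation by elements of `G` is continuous at `1` on the image of `f`, then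
`cosetTopology f` is a group topology. -/
theorem isTopologicalGroup_of_cosetTopology [t : TopologicalSpace G] [IsTopologicalGroup H]
    {f : H →* G} (ht : t = cosetTopology f) (hf : Function.Injective f)
    (hconj : ∀ g : G, ∀ W ∈ 𝓝 (1 : H), ∀ᶠ h in 𝓝 (1 : H), ∃ w ∈ W, g * f h * g⁻¹ = f w) :
    IsTopologicalGroup G := by
  have hemb := isOpenEmbedding_of_cosetTopology ht hf
  have h1 : 𝓝 (1 : G) = Filter.map f (𝓝 1) := by
    rw [hemb.map_nhds_eq, map_one]
  have hcont := continuous_const_mul_of_cosetTopology ht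
  -- Multiplication and inversion near 1 are inherited from `H`, left translations are
  -- homeomorphisms for any coset topology, and conjugation is covered by `hconj`.
  refine IsTopologicalGroup.of_nhds_one ?_ ?_ (fun g => ?_) (fun g => ?_)
  · rw [h1, Filter.prod_map_map_eq, Filter.tendsto_map'_iff]
    have h2 : Filter.Tendsto (fun x : H × H => x.1 * x.2) (𝓝 1 ×ˢ 𝓝 1) (𝓝 1) := by
      have := (continuous_mul (M := H)).tendsto (1, 1)
      rwa [nhds_prod_eq, mul_one] at this
    refine ((Filter.tendsto_map (f := f)).comp h2).congr fun x => ?_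
    simp
  · rw [h1, Filter.tendsto_map'_iff]
    have h2 : Filter.Tendsto (fun x : H => x⁻¹) (𝓝 1) (𝓝 1) := by
      simpa using (continuous_inv (G := H)).tendsto 1
    refine ((Filter.tendsto_map (f := f)).comp h2).congr fun x => ?_
    simp
  · let e : G ≃ₜ G := ⟨Equiv.mulLeft g, hcont g, hcont g⁻¹⟩
    have := e.map_nhds_eq 1
    change Filter.map (fun x => g * x) _ = 𝓝 (g * 1) at this
    rw [this, mul_one]
  · rw [h1, Filter.tendsto_map'_iff]
    intro s hs
    rw [Filter.mem_map]
    filter_upwards [hconj g (f ⁻¹' s) hs] with h ⟨w, hw, e⟩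
    change g * f h * g⁻¹ ∈ s
    rw [e]
    exact hw

/-- Continuity of a homomorphism between groups with coset topologies. -/
theorem continuous_of_cosetTopology {H' G' H₀ : Type*} [Group H'] [TopologicalSpace H'] [Group G']
    [Group H₀] [TopologicalSpace H₀] [ContinuousMul H]
    [t : TopologicalSpace G] [t' : TopologicalSpace G'] {f : H →* G} {f' : H' →* G'}
    (ht : t = cosetTopology f) (ht' : t' = cosetTopology f') (e : G →* G') (j : H₀ →* H)
    (i : H₀ →* H') (hj : IsOpenMap j) (hi : Continuous i) (hij : ∀ x, e (f (j x)) = f' (i x)) :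
    Continuous e := by
  refine ⟨fun s hs => (isOpen_cosetTopology_iff ht).2 fun g => ?_⟩
  refine isOpen_iff_forall_mem_open.2 fun h hh => ?_
  -- It is enough to know `e` on the image of `j`, an open subgroup of `H`: translating it by `h`
  -- gives a neighbourhood on which `e` is a left translate of `f' ∘ i`.
  refine ⟨(fun y => h * y) '' (j '' (i ⁻¹' ((fun x => e (g * f h) * f' x) ⁻¹' s))), ?_, ?_, ?_⟩
  · rintro _ ⟨_, ⟨x, hx, rfl⟩, rfl⟩
    have hx' : e (g * f h) * f' (i x) ∈ s := hx
    change e (g * f (h * j x)) ∈ s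
    rwa [map_mul f, ← mul_assoc, map_mul e, hij]
  · exact (Homeomorph.mulLeft h).isOpenMap _
      (hj _ (((isOpen_cosetTopology_iff ht').1 hs _).preimage hi))
  · exact ⟨1, ⟨1, by simpa using hh, map_one j⟩, mul_one h⟩

end CosetTopology

/-! ### Dependence of the localization on the subgroup `S`. -/

section Localization

variable {G : Type*} [Group G]

theorem PLocalization.val_injective (S : Subgroup G) : Function.Injective (PLocalization.val S) :=
  Subtype.val_injective

/-- Conjugation by `g`, as an isomorphism between commensurators. -/
def PLocalization.conjEquiv (S S' : Subgroup G) (g : G)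
    (h : ∀ x, x ∈ Subgroup.Commensurable.commensurator S ↔
      g * x * g⁻¹ ∈ Subgroup.Commensurable.commensurator S') :
    PLocalization S ≃* PLocalization S' where
  toFun x := ⟨g * x.1 * g⁻¹, (h _).1 x.2⟩
  invFun y := ⟨g⁻¹ * y.1 * g, (h _).2 (by
    have := y.2
    simpa [mul_assoc] using this)⟩
  left_inv x := Subtype.ext (by simp [mul_assoc])
  right_inv y := Subtype.ext (by simp [mul_assoc])
  map_mul' x y := Subtype.ext (by
    change g * (x.1 * y.1) * g⁻¹ = (g * x.1 * g⁻¹) * (g * y.1 * g⁻¹)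
    group)

variable [TopologicalSpace G] [IsTopologicalGroup G]

/-- Continuity may be tested on the open subgroup S ∩ L of `S`. There `e` is conjugation by `g` with
values in `S'`, which is continuous for the topology of `G`. -/
theorem PLocalization.continuous_of_conj {S S' : Subgroup G} {g : G}
    (e : PLocalization S →* PLocalization S')
    (he : ∀ x, PLocalization.val S' (e x) = g * PLocalization.val S x * g⁻¹) {L : Subgroup G}
    (hL : IsOpen (L : Set G)) (hle : S ⊓ L ≤ S'.map (MulAut.conj g⁻¹).toMonoidHom) :
    Continuous e := by
  have hmem : ∀ x : (L.subgroupOf S : Subgroup S), g * (x : S) * g⁻¹ ∈ S' := by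
    rintro ⟨⟨x, hx⟩, hxL⟩
    obtain ⟨y, hy, hyx⟩ := hle ⟨hx, hxL⟩
    have : g * x * g⁻¹ = y := by
      rw [← hyx]; simp [mul_assoc]
    change g * x * g⁻¹ ∈ S'
    rwa [this]
  let i : (L.subgroupOf S : Subgroup S) →* S' :=
    (((MulAut.conj g).toMonoidHom.comp S.subtype).comp (L.subgroupOf S).subtype).codRestrict S' hmem
  have hi : ∀ x, (i x : G) = g * ((x : S) : G) * g⁻¹ := fun _ => rfl
  refine continuous_of_cosetTopology (f := PLocalization.incl S) (f' := PLocalization.incl S')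
    rfl rfl e (L.subgroupOf S).subtype i
    (hL.preimage continuous_subtype_val).isOpenMap_subtype_val ?_ fun x => ?_
  · refine continuous_induced_rng.2 ?_
    have : Continuous fun x : (L.subgroupOf S : Subgroup S) => g * ((x : S) : G) * g⁻¹ := by fun_prop
    exact this
  · apply PLocalization.val_injective
    rw [he]
    rfl

/-- Subgroups which are conjugate up to finite index have conjugate localizations. -/
theorem PLocalization.exists_equiv_of_inf_eq {S S' L : Subgroup G} {g : G}
    (hS : IsCompact (S : Set G)) (hS' : IsCompact (S' : Set G)) (hL : IsOpen (L : Set G))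
    (h : S ⊓ L = S'.map (MulAut.conj g).toMonoidHom ⊓ L) :
    ∃ e : PLocalization S ≃ₜ* PLocalization S', ∀ x,
      PLocalization.val S' (e x) = g⁻¹ * PLocalization.val S x * g := by
  -- A compact group meets an open subgroup in finite index, so agreement on `L` makes the two
  -- groups commensurable.
  have hrel : ∀ T : Subgroup G, IsCompact (T : Set G) → (T ⊓ L).relIndex T ≠ 0 := by
    intro T hT
    have : CompactSpace T := isCompact_iff_compactSpace.1 hT
    have hfin : Finite (T ⧸ L.subgroupOf T) :=
      (L.subgroupOf T).quotient_finite_of_isOpen (hL.preimage continuous_subtype_val)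
    rw [Subgroup.inf_relIndex_left]
    exact Subgroup.index_ne_zero_of_finite
  have hcomm : Subgroup.Commensurable S (S'.map (MulAut.conj g).toMonoidHom) := by
    have hc : IsCompact ((S'.map (MulAut.conj g).toMonoidHom : Subgroup G) : Set G) := by
      rw [Subgroup.coe_map]
      refine hS'.image ?_
      have : Continuous fun x : G => g * x * g⁻¹ := by fun_prop
      exact this
    have h1 := hrel _ hS
    have h2 := hrel _ hc
    refine ⟨?_, ?_⟩
    · rw [← h] at h2
      exact fun h0 => h2 (Subgroup.relIndex_eq_zero_of_le_left inf_le_left h0)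
    · rw [h] at h1
      exact fun h0 => h1 (Subgroup.relIndex_eq_zero_of_le_left inf_le_left h0)
  have hsm : ∀ (a : G) (T : Subgroup G),
      T.map (MulAut.conj a).toMonoidHom = ConjAct.toConjAct a • T := by
    intro a T
    rfl
  have hmem : ∀ x, x ∈ Subgroup.Commensurable.commensurator S ↔
      g⁻¹ * x * g⁻¹⁻¹ ∈ Subgroup.Commensurable.commensurator S' := by
    intro x
    rw [hcomm.eq, Subgroup.Commensurable.commensurator_mem_iff,
      Subgroup.Commensurable.commensurator_mem_iff, hsm,
      Subgroup.Commensurable.commensurable_conj (ConjAct.toConjAct g⁻¹)]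
    rw [← mul_smul, ← mul_smul, ← mul_smul, ← map_mul, ← map_mul, ← map_mul, inv_mul_cancel,
      map_one, one_smul, inv_inv, mul_assoc]
  let e := PLocalization.conjEquiv S S' g⁻¹ hmem
  have he : ∀ x, PLocalization.val S' (e x) = g⁻¹ * PLocalization.val S x * g⁻¹⁻¹ := fun _ => rfl
  have he' : ∀ y, PLocalization.val S (e.symm y) = g * PLocalization.val S' y * g⁻¹ := by
    intro y
    have := he (e.symm y)
    rw [MulEquiv.apply_symm_apply] at this
    rw [this]
    simp [mul_assoc]
  -- For the inverse map, the open subgroup is g⁻¹Lg, because conjugation by `g` must carry its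
  -- intersection with `S'` into S ∩ L.
  refine ⟨⟨e, PLocalization.continuous_of_conj e.toMonoidHom he hL ?_,
    PLocalization.continuous_of_conj (L := L.map (MulAut.conj g⁻¹).toMonoidHom)
      e.symm.toMonoidHom he' ?_ ?_⟩, fun x => by
        have := he x
        rwa [inv_inv] at this⟩
  · rw [inv_inv, h]
    exact inf_le_left
  · rw [Subgroup.coe_map]
    exact ((Homeomorph.mulLeft g⁻¹).trans (Homeomorph.mulRight g⁻¹⁻¹)).isOpenMap _ hL
  · rintro _ ⟨hx, y, hy, rfl⟩
    refine ⟨y, ?_, rfl⟩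
    have : y ∈ S ⊓ L := by
      rw [h]
      refine ⟨⟨_, hx, ?_⟩, hy⟩
      simp [mul_assoc]
    exact this.1

end Localization

/-! ### Automorphisms of coloured trees and their local permutations -/

section LocalPermutations

namespace ColouredTree

variable {V Ω : Type*} (X : ColouredTree V Ω)

theorem finite_colours {V Ω : Type*} (X : ColouredTree V Ω) : Finite Ω :=
  Nat.finite_of_card_ne_zero (by have := X.three_le; omega)

/-- The neighbour of `x` along the edge of colour `ω`. -/
noncomputable def nb (x : V) (ω : Ω) : V := ((X.star x).symm ω).1.snd

theorem nb_colour (e : X.graph.Dart) : X.nb e.fst (X.colour e) = e.snd := by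
  have : (X.star e.fst).symm (X.colour e) = ⟨e, rfl⟩ := by
    rw [Equiv.symm_apply_eq]
    rfl
  rw [nb, this]

theorem exists_dart (x : V) (ω : Ω) :
    ∃ e : X.graph.Dart, e.fst = x ∧ X.colour e = ω ∧ e.snd = X.nb x ω :=
  ⟨((X.star x).symm ω).1, ((X.star x).symm ω).2, (X.star x).apply_symm_apply ω, rfl⟩

theorem adj_nb (x : V) (ω : Ω) : X.graph.Adj x (X.nb x ω) := by
  obtain ⟨e, rfl, rfl, -⟩ := X.exists_dart x ω
  rw [X.nb_colour]
  exact e.adj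

theorem exists_eq_nb {x y : V} (h : X.graph.Adj x y) : ∃ ω, y = X.nb x ω :=
  ⟨X.colour ⟨(x, y), h⟩, (X.nb_colour ⟨(x, y), h⟩).symm⟩

/-- An edge has the same colour in both orientations. -/
theorem nb_nb (x : V) (ω : Ω) : X.nb (X.nb x ω) ω = x := by
  obtain ⟨e, rfl, rfl, h⟩ := X.exists_dart x ω
  rw [← h]
  have := X.nb_colour e.symm
  rwa [X.colour_symm] at this

theorem nb_injective (x : V) : Function.Injective (X.nb x) := by
  intro ω ω' h
  obtain ⟨e, he, rfl, h1⟩ := X.exists_dart x ω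
  obtain ⟨e', he', rfl, h2⟩ := X.exists_dart x ω'
  rw [SimpleGraph.Dart.ext e e' (Prod.ext (he.trans he'.symm) (h1.trans (h.trans h2.symm)))]

theorem apply_nb (g : X.graph ≃g X.graph) (x : V) (ω : Ω) :
    g (X.nb x ω) = X.nb (g x) (X.localPerm g x ω) := by
  change _ = ((X.star (g x)).symm (X.star (g x) (X.starMap g x ((X.star x).symm ω)))).1.snd
  rw [Equiv.symm_apply_apply]
  rfl

theorem localPerm_apply_eq {g : X.graph ≃g X.graph} {x : V} {ω ω' : Ω}
    (h : g (X.nb x ω) = X.nb (g x) ω') : X.localPerm g x ω = ω' :=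
  X.nb_injective (g x) ((X.apply_nb g x ω).symm.trans h)

theorem localPerm_eq {g : X.graph ≃g X.graph} {x : V} {σ : Equiv.Perm Ω}
    (h : ∀ ω, g (X.nb x ω) = X.nb (g x) (σ ω)) : X.localPerm g x = σ :=
  Equiv.ext fun ω => X.localPerm_apply_eq (h ω)

theorem localPerm_congr {g h : X.graph ≃g X.graph} {x : V} (hx : g x = h x)
    (hn : ∀ ω, g (X.nb x ω) = h (X.nb x ω)) : X.localPerm g x = X.localPerm h x :=
  X.localPerm_eq fun ω => by rw [hn, hx, X.apply_nb]

theorem localPerm_apply_of_fixed {g : X.graph ≃g X.graph} {x : V} {ω : Ω} (hx : g x = x)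
    (hn : g (X.nb x ω) = X.nb x ω) : X.localPerm g x ω = ω :=
  X.localPerm_apply_eq (by rw [hx, hn])

/-- Both ends of an edge see the same colour on its image. This is the only constraint on the family
of local permutations of an automorphism, as `exists_localPerm_eq` shows. -/
theorem localPerm_nb (g : X.graph ≃g X.graph) (x : V) (ω : Ω) :
    X.localPerm g (X.nb x ω) ω = X.localPerm g x ω := by
  apply X.localPerm_apply_eq
  rw [X.nb_nb, X.apply_nb, X.nb_nb]

theorem localPerm_inv (g : X.graph ≃g X.graph) (x : V) :
    X.localPerm g⁻¹ (g x) = (X.localPerm g x)⁻¹ := by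
  rw [eq_inv_iff_mul_eq_one, ← X.localPerm_mul, inv_mul_cancel, X.localPerm_one]

theorem localPerm_pow (g : X.graph ≃g X.graph) {x : V} (hx : g x = x) (n : ℕ) :
    X.localPerm (g ^ n) x = X.localPerm g x ^ n ∧ (g ^ n) x = x := by
  induction n with
  | zero => exact ⟨X.localPerm_one x, rfl⟩
  | succ n ih =>
    refine ⟨?_, ?_⟩
    · rw [pow_succ, X.localPerm_mul, hx, ih.1, pow_succ]
    · rw [pow_succ]
      change (g ^ n) (g x) = x
      rw [hx, ih.2]

/-- The colour of the edge from `x` towards `b`. -/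
theorem exists_parent (b : V) {x : V} (h : x ≠ b) :
    ∃ ω, X.graph.dist x b = X.graph.dist (X.nb x ω) b + 1 := by
  obtain ⟨y, hy, hd⟩ := exists_closer X.isTree.connected h
  obtain ⟨ω, rfl⟩ := X.exists_eq_nb hy
  exact ⟨ω, hd⟩

theorem parent_unique {b x : V} {ω ω' : Ω}
    (h : X.graph.dist (X.nb x ω) b < X.graph.dist x b)
    (h' : X.graph.dist (X.nb x ω') b < X.graph.dist x b) : ω = ω' := by
  rw [SimpleGraph.dist_comm, SimpleGraph.dist_comm (v := b)] at h h'
  exact X.nb_injective x (closer_unique X.isTree (X.adj_nb x ω) (X.adj_nb x ω') h h')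

theorem dist_nb (b x : V) (ω : Ω) :
    X.graph.dist x b = X.graph.dist (X.nb x ω) b + 1 ∨
    X.graph.dist (X.nb x ω) b = X.graph.dist x b + 1 := by
  have := X.isTree.dist_eq_dist_add_one_of_adj b (X.adj_nb x ω)
  rwa [SimpleGraph.dist_comm, SimpleGraph.dist_comm (v := X.nb x ω)] at this

/-- The map with prescribed local permutations and prescribed value at `b`. -/
noncomputable def develop (c : V → Equiv.Perm Ω) (b b' : V) (x : V) : V :=
  haveI := Classical.propDecidable (x = b)
  if h : x = b then b' else
    X.nb (develop c b b' (X.nb x (X.exists_parent b h).choose))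
      (c (X.nb x (X.exists_parent b h).choose) (X.exists_parent b h).choose)
termination_by X.graph.dist x b
decreasing_by
  have := (X.exists_parent b h).choose_spec
  omega

section Develop

variable {X} {c : V → Equiv.Perm Ω} (hc : ∀ x ω, c (X.nb x ω) ω = c x ω) (b b' : V)

theorem develop_base : X.develop c b b' b = b' := by
  rw [develop]
  simp

include hc

/-- The definition gives this along edges leading away from b; the compatibility `hc` makes it valid
in the other direction. -/
theorem develop_nb (x : V) (ω : Ω) :
    X.develop c b b' (X.nb x ω) = X.nb (X.develop c b b' x) (c x ω) := by
  have key : ∀ x ω, X.graph.dist x b = X.graph.dist (X.nb x ω) b + 1 →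
      X.develop c b b' x = X.nb (X.develop c b b' (X.nb x ω)) (c x ω) := by
    intro x ω h
    have hne : x ≠ b := by
      rintro rfl
      rw [SimpleGraph.dist_self] at h
      omega
    have hω : (X.exists_parent b hne).choose = ω :=
      X.parent_unique (b := b) (x := x) (by have := (X.exists_parent b hne).choose_spec; omega) (by omega)
    rw [develop]
    simp only [hne, ↓reduceDIte, hω, hc]
  rcases X.dist_nb b x ω with h | h
  · rw [key x ω h, X.nb_nb]
  · have := key (X.nb x ω) ω (by rw [X.nb_nb]; exact h)
    rwa [X.nb_nb, hc] at this

/-- Paths issuing from b do not fold: if the image of a step away from b went back towards `b'`,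
then by injectivity of `c y` this step would have the colour of the edge from y towards b. -/
theorem dist_develop (x : V) :
    X.graph.dist (X.develop c b b' x) b' = X.graph.dist x b := by
  suffices ∀ n x, X.graph.dist x b = n → X.graph.dist (X.develop c b b' x) b' = n from this _ x rfl
  intro n
  induction n using Nat.strong_induction_on with
  | _ n ih =>
    intro x hx
    by_cases hxb : x = b
    · subst hxb
      rw [develop_base, SimpleGraph.dist_self] at *
      exact hx
    obtain ⟨ω, hω⟩ := X.exists_parent b hxb
    obtain ⟨y, hy⟩ : ∃ y, y = X.nb x ω := ⟨_, rfl⟩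
    have hxy : x = X.nb y ω := by rw [hy, X.nb_nb]
    rw [← hy] at hω
    have ihy := ih _ (by omega) y rfl
    rw [hxy, develop_nb hc]
    rcases X.dist_nb b' (X.develop c b b' y) (c y ω) with h | h
    · exfalso
      have hyb : y ≠ b := by
        rintro rfl
        rw [SimpleGraph.dist_self] at ihy
        omega
      obtain ⟨ω', hω'⟩ := X.exists_parent b hyb
      have ihz := ih _ (by omega) (X.nb y ω') rfl
      rw [develop_nb hc] at ihz
      have := X.parent_unique (b := b') (x := X.develop c b b' y) (ω := c y ω) (ω' := c y ω')
        (by omega) (by omega)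
      have := (c y).injective this
      subst this
      rw [← hxy] at hω'
      omega
    · omega

/-- Vertices with the same image are at the same distance from b by `dist_develop`, and their
neighbours towards b both go to the unique neighbour of the image towards `b'`, so induction on the
distance applies. -/
theorem develop_injective : Function.Injective (X.develop c b b') := by
  suffices ∀ n x x', X.graph.dist x b = n → X.develop c b b' x = X.develop c b b' x' → x = x' from
    fun x x' h => this _ x x' rfl h
  intro n
  induction n with
  | zero =>
    intro x x' hx h
    have h1 := dist_develop hc b b' x
    have h2 := dist_develop hc b b' x'
    rw [h] at h1
    rw [X.isTree.connected.dist_eq_zero_iff.1 hx,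
      X.isTree.connected.dist_eq_zero_iff.1 (h2.symm.trans (h1.trans hx))]
  | succ n ih =>
    intro x x' hx h
    have h1 := dist_develop hc b b' x
    have h2 := dist_develop hc b b' x'
    have hxb : x ≠ b := by
      rintro rfl
      rw [SimpleGraph.dist_self] at hx; omega
    have hxb' : x' ≠ b := by
      rintro rfl
      rw [← h, SimpleGraph.dist_self] at h2; omega
    obtain ⟨ω, hω⟩ := X.exists_parent b hxb
    obtain ⟨ω', hω'⟩ := X.exists_parent b hxb'
    have e := dist_develop hc b b' (X.nb x ω)
    have e' := dist_develop hc b b' (X.nb x' ω')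
    rw [develop_nb hc] at e e'
    rw [← h] at e' h2
    have hcc := X.parent_unique (b := b') (x := X.develop c b b' x) (ω := c x ω) (ω' := c x' ω')
      (by omega) (by omega)
    have := ih (X.nb x ω) (X.nb x' ω') (by omega) (by
      rw [develop_nb hc, develop_nb hc, h, hcc])
    have hωω : ω = ω' := by
      apply (c (X.nb x ω)).injective
      rw [hc, this, hc, hcc]
    rw [← X.nb_nb x ω, this, hωω, X.nb_nb]

/-- A compatible family of permutations is the family of local permutations of an
automorphism with given value at `b`. -/
theorem exists_localPerm_eq :
    ∃ g : X.graph ≃g X.graph, g b = b' ∧ ∀ x, X.localPerm g x = c x := by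
  have hsurj : Function.Surjective (X.develop c b b') := by
    suffices ∀ y z, X.graph.Walk y z → b' = z → ∃ x, X.develop c b b' x = y by
      intro y
      obtain ⟨p⟩ := X.isTree.connected.preconnected y b'
      exact this y b' p rfl
    intro y z p hz
    induction p with
    | nil => exact ⟨b, (develop_base b b').trans hz⟩
    | cons h q ih =>
      obtain ⟨x, hx⟩ := ih hz
      obtain ⟨ω, hω⟩ := X.exists_eq_nb h.symm
      refine ⟨X.nb x ((c x).symm ω), ?_⟩
      rw [develop_nb hc, hx, Equiv.apply_symm_apply, hω]
  let e : V ≃ V := Equiv.ofBijective _ ⟨develop_injective hc b b', hsurj⟩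
  refine ⟨⟨e, ?_⟩, develop_base b b', fun x => X.localPerm_eq (develop_nb hc b b' x)⟩
  intro x y
  constructor
  · intro h
    obtain ⟨ω, hω⟩ := X.exists_eq_nb h
    have : X.develop c b b' y = X.develop c b b' (X.nb x ((c x).symm ω)) := by
      rw [develop_nb hc, Equiv.apply_symm_apply]
      exact hω
    rw [develop_injective hc b b' this]
    exact X.adj_nb _ _
  · intro h
    obtain ⟨ω, rfl⟩ := X.exists_eq_nb h
    change X.graph.Adj (X.develop c b b' x) (X.develop c b b' (X.nb x ω))
    rw [develop_nb hc]
    exact X.adj_nb _ _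

end Develop

/-- Automorphisms agree on a set which is star-shaped around a vertex at which they agree, if their
local permutations agree there. -/
theorem eqOn_of_localPerm_eq {A : Set V} {a : V} {g h : X.graph ≃g X.graph} (ha : g a = h a)
    (hA : ∀ x ∈ A, x ≠ a → ∃ y ∈ A, X.graph.Adj x y ∧ X.graph.dist x a = X.graph.dist y a + 1)
    (hl : ∀ x ∈ A, X.localPerm g x = X.localPerm h x) : ∀ x ∈ A, g x = h x := by
  suffices ∀ n, ∀ x ∈ A, X.graph.dist x a = n → g x = h x from fun x hx => this _ x hx rfl
  intro n
  induction n with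
  | zero =>
    intro x _ hx
    rw [X.isTree.connected.dist_eq_zero_iff.1 hx, ha]
  | succ n ih =>
    intro x hxA hx
    have hne : x ≠ a := by
      rintro rfl
      rw [SimpleGraph.dist_self] at hx; omega
    obtain ⟨y, hyA, hxy, hd⟩ := hA x hxA hne
    obtain ⟨ω, rfl⟩ := X.exists_eq_nb hxy.symm
    rw [X.apply_nb, X.apply_nb, ih y hyA (by omega), hl y hyA]

end ColouredTree

end LocalPermutations

/-! ### Extending automorphisms from half-trees and balls with local permutations in `F`. -/

section Extension

variable {V Ω : Type*} (X : ColouredTree V Ω)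

/-- The half-tree of the vertices which are closer to `v` than to its neighbour `u`. -/
def half (v u : V) : Set V := {x | X.graph.dist x v < X.graph.dist x u}

variable {X} {F : Subgroup (Equiv.Perm Ω)} {b u v x : V}

theorem self_mem_half (h : X.graph.Adj v u) : v ∈ half X v u := by
  change X.graph.dist v v < X.graph.dist v u
  rw [SimpleGraph.dist_self]
  exact X.isTree.connected.pos_dist_of_ne h.ne

theorem notMem_half : u ∉ half X v u := by
  change ¬ X.graph.dist u v < X.graph.dist u u
  rw [SimpleGraph.dist_self]
  omega

theorem half_sep (h : X.graph.Adj v u) {ω : Ω} (hx : x ∈ half X v u)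
    (hx' : X.nb x ω ∉ half X v u) : x = v ∧ X.nb x ω = u :=
  sep X.isTree h (X.adj_nb x ω) hx hx'

theorem half_closer (h : X.graph.Adj v u) (hx : x ∈ half X v u) (hne : x ≠ v) :
    ∃ y ∈ half X v u, X.graph.Adj x y ∧ X.graph.dist x v = X.graph.dist y v + 1 := by
  obtain ⟨y, hy, hd⟩ := exists_closer X.isTree.connected hne
  refine ⟨y, ?_, hy, hd⟩
  by_contra hcon
  exact hne (sep X.isTree h hy hx hcon).1

theorem compl_half_closer (h : X.graph.Adj v u) (hx : x ∉ half X v u) (hne : x ≠ u) :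
    ∃ y ∉ half X v u, X.graph.Adj x y ∧ X.graph.dist x u = X.graph.dist y u + 1 := by
  obtain ⟨y, hy, hd⟩ := exists_closer X.isTree.connected hne
  refine ⟨y, fun hcon => ?_, hy, hd⟩
  exact hne (sep X.isTree h hy.symm hcon hx).2

/-- An automorphism whose local permutations on a half-tree lie in `F` can be extended from this
half-tree to an element of `U(F)`. -/
theorem exists_extend_half (h : X.graph.Adj v u) (g : X.graph ≃g X.graph)
    (hg : ∀ x ∈ half X v u, X.localPerm g x ∈ F) :
    ∃ k ∈ universalGroup X F, (∀ x ∈ half X v u, k x = g x) ∧ k u = g u := by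
  classical
  -- Outside the half-tree the family is constant, equal to the local permutation at the root `v`.
  -- Compatibility only has to be examined at the edge from `v` to `u`, where it holds because both
  -- ends carry the same permutation.
  let c : V → Equiv.Perm Ω := fun x => X.localPerm g (if x ∈ half X v u then x else v)
  have hc1 : ∀ x ∈ half X v u, c x = X.localPerm g x := fun x hx => by simp [c, hx]
  have hc2 : ∀ x ∉ half X v u, c x = X.localPerm g v := fun x hx => by simp [c, hx]
  have key : ∀ x ω, x ∈ half X v u → X.nb x ω ∉ half X v u → c (X.nb x ω) ω = c x ω := by
    intro x ω hx hx'
    obtain ⟨rfl, -⟩ := half_sep h hx hx'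
    rw [hc1 _ hx, hc2 _ hx']
  have hc : ∀ x ω, c (X.nb x ω) ω = c x ω := by
    intro x ω
    by_cases hx : x ∈ half X v u <;> by_cases hx' : X.nb x ω ∈ half X v u
    · rw [hc1 _ hx, hc1 _ hx', X.localPerm_nb]
    · exact key x ω hx hx'
    · have := key (X.nb x ω) ω hx' (by rwa [X.nb_nb])
      rw [X.nb_nb] at this
      exact this.symm
    · rw [hc2 _ hx, hc2 _ hx']
  obtain ⟨k, hk, hkl⟩ := ColouredTree.exists_localPerm_eq hc v (g v)
  have hv := self_mem_half h
  have hag := X.eqOn_of_localPerm_eq hk (fun x hx hne => half_closer h hx hne)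
    (fun x hx => by rw [hkl, hc1 x hx])
  refine ⟨k, fun x => ?_, hag, ?_⟩
  · rw [hkl]
    by_cases hx : x ∈ half X v u
    · rw [hc1 x hx]; exact hg x hx
    · rw [hc2 x hx]; exact hg v hv
  · obtain ⟨ω, rfl⟩ := X.exists_eq_nb h
    rw [X.apply_nb, X.apply_nb, hk, hkl, hc1 v hv]

/-- Elements of `U(F)` supported on a half-tree with a given local permutation at its root. -/
theorem exists_twist_half {ω : Ω} {a : Equiv.Perm Ω} (ha : a ∈ F) (haω : a ω = ω) (v : V) :
    ∃ s ∈ universalGroup X F, X.localPerm s v = a ∧ s v = v ∧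
      ∀ x ∉ half X v (X.nb v ω), s x = x ∧ X.localPerm s x = 1 := by
  classical
  have h := X.adj_nb v ω
  obtain ⟨u, hu⟩ : ∃ u, u = X.nb v ω := ⟨_, rfl⟩
  rw [← hu] at h ⊢
  -- The value jumps from `a` to 1 only across the edge from `v` to `u`, whose colour `ω` is fixed
  -- by both.
  let c : V → Equiv.Perm Ω := fun x => if x ∈ half X v u then a else 1
  have key : ∀ x ω', x ∈ half X v u → X.nb x ω' ∉ half X v u → c (X.nb x ω') ω' = c x ω' := by
    intro x ω' hx hx'
    obtain ⟨rfl, e⟩ := half_sep h hx hx'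
    have := X.nb_injective _ (e.trans hu)
    subst this
    simp [c, hx, hx', haω]
  have hc : ∀ x ω, c (X.nb x ω) ω = c x ω := by
    intro x ω
    by_cases hx : x ∈ half X v u <;> by_cases hx' : X.nb x ω ∈ half X v u
    · simp [c, hx, hx']
    · exact key x ω hx hx'
    · have := key (X.nb x ω) ω hx' (by rwa [X.nb_nb])
      rw [X.nb_nb] at this
      exact this.symm
    · simp [c, hx, hx']
  obtain ⟨s, hs, hsl⟩ := ColouredTree.exists_localPerm_eq hc u u
  have hv := self_mem_half h
  have hl : ∀ x ∉ half X v u, X.localPerm s x = 1 := fun x hx => by rw [hsl]; simp [c, hx]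
  have hag := X.eqOn_of_localPerm_eq (A := (half X v u)ᶜ) (g := s) (h := 1) (a := u) hs
    (fun x hx hne => compl_half_closer h hx hne)
    (fun x hx => by rw [hl x hx, X.localPerm_one])
  refine ⟨s, fun x => ?_, ?_, ?_, fun x hx => ⟨hag x hx, hl x hx⟩⟩
  · rw [hsl]
    by_cases hx : x ∈ half X v u
    · simp [c, hx, ha]
    · simp [c, hx, F.one_mem]
  · rw [hsl]; simp [c, hv]
  · have e : v = X.nb u ω := by rw [hu, X.nb_nb]
    rw [e, X.apply_nb, hs, hl u notMem_half]
    rfl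

/-- Elements of `U(F)` with a given local permutation at a fixed vertex. -/
theorem exists_twist {a : Equiv.Perm Ω} (ha : a ∈ F) (v : V) :
    ∃ s ∈ universalGroup X F, X.localPerm s v = a ∧ s v = v := by
  obtain ⟨s, hs, hsl⟩ := ColouredTree.exists_localPerm_eq (X := X) (c := fun _ => a)
    (fun _ _ => rfl) v v
  exact ⟨s, fun x => by rw [hsl]; exact ha, hsl v, hs⟩

variable (X b) in
/-- The last vertex at distance at most `n` from `b` on the path from `b` to `x`. -/
noncomputable def ballProj (n : ℕ) (x : V) : V :=
  haveI := Classical.propDecidable (x = b)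
  if h : X.graph.dist x b ≤ n then x else
    ballProj n (X.nb x (X.exists_parent b (x := x) (by
      rintro rfl
      rw [SimpleGraph.dist_self] at h
      omega)).choose)
termination_by X.graph.dist x b
decreasing_by
  have hx : x ≠ b := by
    rintro rfl
    rw [SimpleGraph.dist_self] at h
    omega
  have := (X.exists_parent b hx).choose_spec
  omega

theorem ballProj_of_le {n : ℕ} (h : X.graph.dist x b ≤ n) : ballProj X b n x = x := by
  rw [ballProj]
  simp [h]

theorem ballProj_of_lt {n : ℕ} (h : n < X.graph.dist x b) {ω : Ω}
    (hω : X.graph.dist x b = X.graph.dist (X.nb x ω) b + 1) :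
    ballProj X b n x = ballProj X b n (X.nb x ω) := by
  have hne : x ≠ b := by
    rintro rfl
    rw [SimpleGraph.dist_self] at h
    omega
  have hω : (X.exists_parent b hne).choose = ω :=
    X.parent_unique (b := b) (x := x) (by have := (X.exists_parent b hne).choose_spec; omega) (by omega)
  rw [ballProj]
  simp [not_le.2 h, hω]

theorem dist_ballProj_le (n : ℕ) (x : V) : X.graph.dist (ballProj X b n x) b ≤ n := by
  suffices ∀ m x, X.graph.dist x b = m → X.graph.dist (ballProj X b n x) b ≤ n from this _ x rfl
  intro m
  induction m with
  | zero =>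
    intro x hx
    rw [ballProj_of_le (by omega)]
    omega
  | succ m ih =>
    intro x hx
    by_cases h : X.graph.dist x b ≤ n
    · rwa [ballProj_of_le h]
    · have hne : x ≠ b := by
        rintro rfl
        rw [SimpleGraph.dist_self] at h
        omega
      obtain ⟨ω, hω⟩ := X.exists_parent b hne
      rw [ballProj_of_lt (by omega) hω]
      exact ih _ (by omega)

/-- An automorphism whose local permutations on a ball lie in `F` agrees on the ball of radius one
more with an element of `U(F)`. -/
theorem exists_extend_ball (n : ℕ) (g : X.graph ≃g X.graph)
    (hg : ∀ x, X.graph.dist x b ≤ n → X.localPerm g x ∈ F) :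
    ∃ k ∈ universalGroup X F, ∀ x, X.graph.dist x b ≤ n + 1 → k x = g x := by
  -- Outside the ball, local permutations are copied from the vertex where the path to b enters the
  -- ball, so they are constant along every edge leading outwards. The sphere of radius `n + 1` is
  -- governed by the local permutations on the ball of radius `n`.
  let c : V → Equiv.Perm Ω := fun x => X.localPerm g (ballProj X b n x)
  have key : ∀ x ω, X.graph.dist x b = X.graph.dist (X.nb x ω) b + 1 →
      c (X.nb x ω) ω = c x ω := by
    intro x ω h
    by_cases hx : X.graph.dist x b ≤ n
    · simp only [c]
      rw [ballProj_of_le hx, ballProj_of_le (x := X.nb x ω) (by omega), X.localPerm_nb]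
    · simp only [c]
      rw [ballProj_of_lt (not_le.1 hx) h]
  have hc : ∀ x ω, c (X.nb x ω) ω = c x ω := by
    intro x ω
    rcases X.dist_nb b x ω with h | h
    · exact key x ω h
    · have := key (X.nb x ω) ω (by rw [X.nb_nb]; exact h)
      rw [X.nb_nb] at this
      exact this.symm
  obtain ⟨k, hk, hkl⟩ := ColouredTree.exists_localPerm_eq hc b (g b)
  have hag := X.eqOn_of_localPerm_eq (A := {x | X.graph.dist x b ≤ n}) hk
    (fun x hx hne => by
      obtain ⟨y, hy, hd⟩ := exists_closer X.isTree.connected hne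
      have hx' : X.graph.dist x b ≤ n := hx
      exact ⟨y, show X.graph.dist y b ≤ n by omega, hy, hd⟩)
    (fun x hx => by
      rw [hkl]
      simp only [c]
      rw [ballProj_of_le hx])
  refine ⟨k, fun x => ?_, fun x hx => ?_⟩
  · rw [hkl]
    exact hg _ (dist_ballProj_le n x)
  · by_cases hxn : X.graph.dist x b ≤ n
    · exact hag x hxn
    · have hne : x ≠ b := by
        rintro rfl
        rw [SimpleGraph.dist_self] at hxn
        omega
      obtain ⟨ω, hω⟩ := X.exists_parent b hne
      have hy : X.graph.dist (X.nb x ω) b ≤ n := by omega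
      have e := X.apply_nb k (X.nb x ω) ω
      rw [hkl, hag _ hy] at e
      simp only [c] at e
      rwa [ballProj_of_le hy, ← X.apply_nb, X.nb_nb] at e

end Extension

/-! ### The permutation topology on automorphism groups -/

section PermutationTopology

open Topology

variable {V : Type*} {Γ : SimpleGraph V}

/-- With `V` discrete, basic neighbourhoods prescribe the values on a finite set. -/
theorem mem_nhds_aut {g : Γ ≃g Γ} {W : Set (Γ ≃g Γ)} :
    W ∈ 𝓝 g ↔ ∃ A : Set V, A.Finite ∧ ∀ h : Γ ≃g Γ, (∀ x ∈ A, h x = g x) → h ∈ W := by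
  let _ : TopologicalSpace V := ⊥
  have : DiscreteTopology V := ⟨rfl⟩
  have e : 𝓝 g = Filter.comap (fun (g : Γ ≃g Γ) (v : V) => g v) (𝓝 fun v => g v) :=
    nhds_induced _ _
  rw [e, nhds_pi, Filter.mem_comap]
  constructor
  · rintro ⟨t, ht, htW⟩
    obtain ⟨I, hI, t', ht', hle⟩ := Filter.mem_pi.1 ht
    refine ⟨I, hI, fun h hh => htW (hle fun x hx => ?_)⟩
    change h x ∈ t' x
    rw [hh x hx]
    exact mem_of_mem_nhds (ht' x)
  · rintro ⟨A, hA, hW⟩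
    refine ⟨A.pi fun x => {g x}, Filter.pi_mem_pi hA fun x _ => ?_, fun h hh => hW h hh⟩
    rw [nhds_discrete]
    exact Set.mem_singleton _

instance : IsTopologicalGroup (Γ ≃g Γ) where
  continuous_mul := by
    refine continuous_iff_continuousAt.2 fun ⟨g, h⟩ W hW => ?_
    obtain ⟨A, hA, hAW⟩ := mem_nhds_aut.1 hW
    rw [Filter.mem_map, nhds_prod_eq]
    refine Filter.mem_of_superset (Filter.prod_mem_prod
      (mem_nhds_aut.2 ⟨h '' A, hA.image _, fun _ => id⟩) (mem_nhds_aut.2 ⟨A, hA, fun _ => id⟩)) ?_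
    rintro ⟨g', h'⟩ ⟨hg, hh⟩
    refine hAW _ fun x hx => ?_
    change g' (h' x) = g (h x)
    rw [hh x hx, hg _ ⟨x, hx, rfl⟩]
  continuous_inv := by
    refine continuous_iff_continuousAt.2 fun g W hW => ?_
    obtain ⟨A, hA, hAW⟩ := mem_nhds_aut.1 hW
    refine mem_nhds_aut.2 ⟨g.symm '' A, hA.image _, fun h hh => hAW _ fun x hx => ?_⟩
    have := hh _ ⟨x, hx, rfl⟩
    rw [g.apply_symm_apply] at this
    change h.symm x = g.symm x
    rw [← this, h.symm_apply_apply, this]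

instance : T2Space (Γ ≃g Γ) := by
  let _ : TopologicalSpace V := ⊥
  have : DiscreteTopology V := ⟨rfl⟩
  have : IsEmbedding (fun (g : Γ ≃g Γ) (v : V) => g v) := ⟨⟨rfl⟩, DFunLike.coe_injective⟩
  exact this.t2Space

theorem mem_nhds_subgroup_aut {H : Subgroup (Γ ≃g Γ)} {g : H} {W : Set H} :
    W ∈ 𝓝 g ↔ ∃ A : Set V, A.Finite ∧ ∀ h : H, (∀ x ∈ A, h.1 x = g.1 x) → h ∈ W := by
  rw [mem_nhds_subtype]
  constructor
  · rintro ⟨U, hU, hUW⟩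
    obtain ⟨A, hA, hAU⟩ := mem_nhds_aut.1 hU
    exact ⟨A, hA, fun h hh => hUW (hAU _ hh)⟩
  · rintro ⟨A, hA, hAW⟩
    exact ⟨_, mem_nhds_aut.2 ⟨A, hA, fun _ => id⟩, fun h hh => hAW h hh⟩

end PermutationTopology

/-! ### Vertex stabilizers in `U(F)`: compactness and the pro-`p` property. -/

section UniversalTopology

open Topology

variable {V Ω : Type*} (X : ColouredTree V Ω) (b : V) (F : Subgroup (Equiv.Perm Ω))

/-- The pointwise stabilizer in `U(F)` of the ball of radius `n` around `b`. -/
def ballFix (n : ℕ) : Subgroup (universalGroup X F) where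
  carrier := {s | ∀ x, X.graph.dist x b ≤ n → s.1 x = x}
  one_mem' _ _ := rfl
  mul_mem' {s t} hs ht x hx := by
    change s.1 (t.1 x) = x
    rw [ht x hx, hs x hx]
  inv_mem' {s} hs x hx := by
    change s.1.symm x = x
    rw [RelIso.symm_apply_eq, hs x hx]

variable {X b F}

theorem mem_ballFix_zero {s : universalGroup X F} : s ∈ ballFix X b F 0 ↔ s.1 b = b := by
  refine ⟨fun h => h b (by simp), fun h x hx => ?_⟩
  rw [X.isTree.connected.dist_eq_zero_iff.1 (Nat.le_zero.1 hx), h]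

theorem ballFix_anti {m n : ℕ} (h : m ≤ n) : ballFix X b F n ≤ ballFix X b F m :=
  fun _ hs x hx => hs x (hx.trans h)

theorem dist_apply_of_fixed {g : X.graph ≃g X.graph} (hg : g b = b) (x : V) :
    X.graph.dist (g x) b = X.graph.dist x b := by
  have := dist_apply X.isTree.connected g x b
  rwa [hg] at this

theorem isOpen_ballFix (n : ℕ) : IsOpen (ballFix X b F n : Set (universalGroup X F)) := by
  refine Subgroup.isOpen_of_mem_nhds _ (g := 1) (mem_nhds_subgroup_aut.2
    ⟨_, ball_finite X.isTree.connected X.finite_neighborSet b n, fun h hh x hx => hh x hx⟩)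

variable (b) in
theorem exists_ballFix_subset {W : Set (universalGroup X F)} (hW : W ∈ 𝓝 1) :
    ∃ n, (ballFix X b F n : Set (universalGroup X F)) ⊆ W := by
  obtain ⟨A, hA, hAW⟩ := mem_nhds_subgroup_aut.1 hW
  obtain ⟨n, -, hn⟩ := exists_ball_superset X.graph b hA
  exact ⟨n, fun s hs => hAW s fun x hx => hs x (hn x hx).le⟩

/-- Automorphisms fixing b preserve the finite balls around b, so along an ultrafilter the values of
`g` and of its inverse are eventually constant at each vertex. The limits are inverse to each other,
and adjacency and membership of a local permutation in `F` involve only finitely many vertices, so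
both pass to the limit. -/
theorem isCompact_ballFix_zero : IsCompact (ballFix X b F 0 : Set (universalGroup X F)) := by
  rw [isCompact_iff_ultrafilter_le_nhds]
  intro 𝒰 h𝒰
  have hb : ∀ᶠ g : universalGroup X F in 𝒰, g.1 b = b :=
    Filter.mem_of_superset (Filter.le_principal_iff.1 h𝒰) fun g hg => mem_ballFix_zero.1 hg
  -- limits along the ultrafilter of functions with values in balls
  have hlim : ∀ (e : universalGroup X F → V → V),
      (∀ g : universalGroup X F, g.1 b = b → ∀ x, X.graph.dist (e g x) b = X.graph.dist x b) →
      ∀ x, ∃ y, ∀ᶠ g in 𝒰, e g x = y := by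
    intro e he x
    have hfin := ball_finite X.isTree.connected X.finite_neighborSet b (X.graph.dist x b)
    have : ∀ᶠ g in 𝒰, ∃ y ∈ {y | X.graph.dist y b ≤ X.graph.dist x b}, e g x = y := by
      filter_upwards [hb] with g hg
      exact ⟨_, (he g hg x).le, rfl⟩
    obtain ⟨y, -, hy⟩ := (Ultrafilter.eventually_exists_mem_iff hfin).1 this
    exact ⟨y, hy⟩
  choose f hf using hlim (fun g x => g.1 x) fun g hg x => dist_apply_of_fixed hg x
  choose f' hf' using hlim (fun g x => g.1.symm x) fun g hg x =>
    dist_apply_of_fixed (g := g.1.symm) (by rw [RelIso.symm_apply_eq, hg]) x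
  have hne : (𝒰 : Filter (universalGroup X F)).NeBot := 𝒰.neBot
  let k : X.graph ≃g X.graph :=
    { toFun := f
      invFun := f'
      left_inv := fun x => by
        obtain ⟨g, h1, h2⟩ := ((hf x).and (hf' (f x))).exists
        rw [← h2, ← h1]
        exact g.1.symm_apply_apply x
      right_inv := fun x => by
        obtain ⟨g, h1, h2⟩ := ((hf' x).and (hf (f' x))).exists
        rw [← h2, ← h1]
        exact g.1.apply_symm_apply x
      map_rel_iff' := fun {x y} => by
        obtain ⟨g, h1, h2⟩ := ((hf x).and (hf y)).exists
        change X.graph.Adj (f x) (f y) ↔ _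
        rw [← h1, ← h2]
        exact g.1.map_adj_iff }
  have := X.finite_colours
  have hk : k ∈ universalGroup X F := by
    intro x
    obtain ⟨g, h1, h2⟩ := ((hf x).and (Filter.eventually_all.2 fun ω => hf (X.nb x ω))).exists
    have : X.localPerm g.1 x = X.localPerm k x := X.localPerm_congr h1 h2
    rw [← this]
    exact g.2 x
  refine ⟨⟨k, hk⟩, ?_, fun W hW => ?_⟩
  · obtain ⟨g, h1, h2⟩ := ((hf b).and hb).exists
    exact mem_ballFix_zero.2 (h1.symm.trans h2)
  · obtain ⟨A, hA, hAW⟩ := mem_nhds_subgroup_aut.1 hW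
    exact Filter.mem_of_superset ((Filter.eventually_all_finite hA).2 fun x _ => hf x) hAW

instance : NonarchimedeanGroup (universalGroup X F) where
  is_nonarchimedean W hW := by
    obtain ⟨b⟩ := X.isTree.connected.nonempty
    obtain ⟨n, hn⟩ := exists_ballFix_subset b hW
    exact ⟨⟨ballFix X b F n, isOpen_ballFix n⟩, hn⟩

/-- At a vertex fixed by `s`, the local permutation of `s ^ q` is the `q`-th power of an element of
`F`, hence trivial, so all neighbours are fixed as well. -/
theorem pow_mem_ballFix_succ {q n : ℕ} (hq : ∀ a ∈ F, a ^ q = 1) {s : universalGroup X F}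
    (hs : s ∈ ballFix X b F n) : s ^ q ∈ ballFix X b F (n + 1) := by
  intro x hx
  by_cases hxn : X.graph.dist x b ≤ n
  · exact (ballFix X b F n).pow_mem hs q x hxn
  · obtain ⟨ω, hω⟩ := X.exists_parent b (x := x) (by
      rintro rfl
      rw [SimpleGraph.dist_self] at hxn
      omega)
    have h1 := X.localPerm_pow s.1 (hs (X.nb x ω) (by omega)) q
    rw [hq _ (s.2 _)] at h1
    have h2 := X.apply_nb (s.1 ^ q) (X.nb x ω) ω
    rw [h1.1, h1.2, Equiv.Perm.one_apply, X.nb_nb] at h2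
    exact h2

/-- Vertex stabilizers in `U(F)` are pro-`p` if `F` is a `p`-group. -/
theorem isProP_ballFix_zero {p : ℕ} [Fact p.Prime] (hF : IsPGroup p F) :
    IsProP p (ballFix X b F 0) := by
  have hΩ := X.finite_colours
  have : CompactSpace (ballFix X b F 0) := isCompact_iff_compactSpace.1 isCompact_ballFix_zero
  refine ⟨inferInstance, inferInstance, inferInstance, fun N hN hNo => ?_⟩
  have hfin : Finite (ballFix X b F 0 ⧸ N) := N.quotient_finite_of_isOpen hNo
  obtain ⟨r, hr⟩ := IsPGroup.iff_card.1 hF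
  have hq : ∀ a ∈ F, a ^ p ^ r = 1 := by
    intro a ha
    have := pow_card_eq_one' (x := (⟨a, ha⟩ : F))
    rw [hr] at this
    exact congrArg Subtype.val this
  -- Each further power of exponent `p ^ r = |F|` enlarges the fixed ball by one. As `N` contains
  -- the fixator of some ball, every element of the quotient by `N` has `p`-power order.
  have hpow : ∀ (s : ballFix X b F 0) (n : ℕ), (s : universalGroup X F) ^ p ^ (r * n) ∈
      ballFix X b F n := by
    intro s n
    induction n with
    | zero => simp
    | succ n ih =>
      rw [Nat.mul_succ, pow_add, pow_mul]
      exact pow_mem_ballFix_succ hq ih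
  obtain ⟨W, hW, hWN⟩ := isOpen_induced_iff.1 hNo
  obtain ⟨n, hn⟩ := exists_ballFix_subset b (hW.mem_nhds (x := 1) (by
    have : (1 : ballFix X b F 0) ∈ ((↑) : ballFix X b F 0 → universalGroup X F) ⁻¹' W :=
      hWN ▸ N.one_mem
    simpa using this))
  have hpg : IsPGroup p (ballFix X b F 0 ⧸ N) := by
    intro y
    obtain ⟨s, rfl⟩ := QuotientGroup.mk_surjective y
    refine ⟨r * n, ?_⟩
    rw [← QuotientGroup.mk_pow, QuotientGroup.eq_one_iff]
    have : s ^ p ^ (r * n) ∈ ((↑) : ballFix X b F 0 → universalGroup X F) ⁻¹' W := hn (hpow s n)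
    rwa [hWN] at this
  exact IsPGroup.iff_card.1 hpg

end UniversalTopology

/-! ### Representatives of near permutations -/

section Representatives

variable {V : Type*}

/-- The near permutation `g` is the class of the map `f`. -/
def NearPerm.Rep (g : NearPerm V) (f : V → V) : Prop :=
  ∃ hf : Filter.Tendsto f Filter.cofinite Filter.cofinite,
    g.val = ((⟨f, hf⟩ : nearEnd V) : (nearCon V).Quotient)

namespace NearPerm

variable {g g' : NearPerm V} {f f' : V → V}

theorem Rep.eq_iff (h : Rep g f) (h' : Rep g' f') : g = g' ↔ {x | f x ≠ f' x}.Finite := by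
  obtain ⟨hf, e⟩ := h
  obtain ⟨hf', e'⟩ := h'
  rw [Units.ext_iff, e, e']
  exact (Con.eq _).trans Filter.eventually_cofinite

theorem Rep.congr (h : Rep g f) (hff : {x | f x ≠ f' x}.Finite) : Rep g f' := by
  obtain ⟨hf, e⟩ := h
  have he : f =ᶠ[Filter.cofinite] f' := Filter.eventually_cofinite.2 hff
  exact ⟨hf.congr' he, e.trans ((Con.eq _).2 he)⟩

theorem Rep.mul (h : Rep g f) (h' : Rep g' f') : Rep (g * g') (f ∘ f') := by
  obtain ⟨hf, e⟩ := h
  obtain ⟨hf', e'⟩ := h'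
  refine ⟨hf.comp hf', ?_⟩
  rw [Units.val_mul, e, e']
  rfl

theorem rep_ofEquiv {A B : Set V} (hA : Aᶜ.Finite) (hB : Bᶜ.Finite) (e : A ≃ B) :
    Rep (ofEquiv hA hB e) (extend e) := ⟨tendsto_extend hA e, rfl⟩

theorem rep_autToNearPerm {G : SimpleGraph V} (h : G ≃g G) : Rep (autToNearPerm h) h :=
  (rep_ofEquiv (A := Set.univ) (B := Set.univ) (by simp) (by simp) _).congr (by simp [extend])

end NearPerm

variable {G : SimpleGraph V} {b : V} {H : Subgroup (G ≃g G)}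

/-- This replaces forest isomorphisms by maps `V → V` whose values outside the forest are
irrelevant, so that no dependent types intervene in products and conjugates. -/
theorem mem_almostAutGroup_iff {hG : G.IsTree} {hfin : ∀ v, (G.neighborSet v).Finite}
    {hdeg : ∀ v, (G.neighborSet v).Nontrivial} {g : NearPerm V} :
    g ∈ almostAutGroup b H hG hfin hdeg ↔ ∃ T T' f, Honest b H T T' f ∧ g.Rep f := by
  constructor
  · rintro ⟨φ, rfl⟩
    exact ⟨_, _, _, φ.toHonest hG, NearPerm.rep_ofEquiv _ _ _⟩
  · rintro ⟨T, T', f, hf, hg⟩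
    obtain ⟨φ, rfl, rfl, hφ⟩ := hf.exists_toNearPerm hG
    refine ⟨φ, ((NearPerm.rep_ofEquiv _ _ _).eq_iff hg).2
      ((φ.dom_complete.finite_compl hG).subset fun x hx hxT => hx (hφ x hxT))⟩

/-- Almost automorphisms are defined on the complements of all large balls. -/
theorem exists_honest_ball {hG : G.IsTree} {hfin : ∀ v, (G.neighborSet v).Finite}
    {hdeg : ∀ v, (G.neighborSet v).Nontrivial} {g : NearPerm V}
    (hg : g ∈ almostAutGroup b H hG hfin hdeg) : ∃ f n₀, g.Rep f ∧ 1 ≤ n₀ ∧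
      ∀ n ≥ n₀, ∃ T', Honest b H {x | G.dist x b ≤ n} T' f := by
  obtain ⟨T, T', f, hf, hr⟩ := mem_almostAutGroup_iff.1 hg
  obtain ⟨n₀, hn₀, hlt⟩ := exists_ball_superset G b hf.dom_complete.finite
  refine ⟨f, n₀, hr, hn₀, fun n hn => ?_⟩
  obtain ⟨T'', -, h⟩ := hf.refine hG hdeg (ball_complete hG hfin b n (by omega))
    fun x hx => ((hlt x hx).trans_le hn).le
  exact ⟨T'', h⟩

theorem Honest.rep_mem {hG : G.IsTree} {hfin : ∀ v, (G.neighborSet v).Finite}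
    {hdeg : ∀ v, (G.neighborSet v).Nontrivial} {g : NearPerm V} {T T' : Set V} {f : V → V}
    (hf : Honest b H T T' f) (hg : g.Rep f) : g ∈ almostAutGroup b H hG hfin hdeg :=
  mem_almostAutGroup_iff.2 ⟨_, _, _, hf, hg⟩

theorem Honest.mono {H' : Subgroup (G ≃g G)} (hH : H ≤ H') {T T' : Set V} {f : V → V}
    (hf : Honest b H T T' f) : Honest b H' T T' f :=
  ⟨hf.dom_complete, hf.cod_complete, hf.bij, fun v hv => by
    obtain ⟨h, hh, h1⟩ := hf.honest v hv
    exact ⟨h, hH hh, h1⟩⟩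

/-- Automorphisms fixing `T` preserve its branches. -/
theorem apply_mem_branch (hG : G.Connected) {T : Set V} {s : G ≃g G} (hs : ∀ x ∈ T, s x = x)
    {v x : V} (hv : v ∈ T) (hx : x ∈ branch G T v) : s x ∈ branch G T v := by
  rw [mem_branch_iff hG] at hx ⊢
  intro w hw hne
  have h1 := dist_apply hG s x v
  have h2 := dist_apply hG s x w
  rw [hs v hv] at h1
  rw [hs w hw] at h2
  rw [h1, h2]
  exact hx w hw hne

end Representatives

/-! ### Conjugation by almost automorphisms -/

section Conjugation

variable {V Ω : Type*} {X : ColouredTree V Ω} {F : Subgroup (Equiv.Perm Ω)} {b : V} {T T' : Set V}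

/-- Automorphisms fixing the leaves of a complete subtree and their neighbours in it can be glued
along the subtree. -/
theorem exists_glue (hT : IsComplete X.graph b T) (t : V → X.graph ≃g X.graph)
    (ht : ∀ w ∈ leaves X.graph T, t w ∈ universalGroup X F ∧ t w w = w ∧
      ∀ u ∈ T, X.graph.Adj w u → t w u = u) :
    ∃ s ∈ universalGroup X F, (∀ y ∈ T, s y = y) ∧
      ∀ w ∈ leaves X.graph T, ∀ y ∈ branch X.graph T w, s y = t w y := by
  classical
  have hcon := X.isTree.connected
  -- Local permutations are those of `t w` on the branch at `w`, and trivial at the inner vertices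
  -- of `T`. An edge either lies in one branch or joins vertices of `T`; in the second case its
  -- colour is fixed at both ends.
  let c : V → Equiv.Perm Ω := fun y =>
    if h : y ∈ forestVerts X.graph T then X.localPerm (t h.choose) y else 1
  have hc1 : ∀ w ∈ leaves X.graph T, ∀ y ∈ branch X.graph T w, c y = X.localPerm (t w) y := by
    intro w hw y hy
    have h : y ∈ forestVerts X.graph T := ⟨w, hw, hy⟩
    have := branch_disjoint hcon hw.1 h.choose_spec.1.1 hy h.choose_spec.2
    simp only [c, h, ↓reduceDIte]
    rw [← this]
  have hc2 : ∀ y ∉ forestVerts X.graph T, c y = 1 := fun y hy => by simp only [c, hy, ↓reduceDIte]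
  have hcF : ∀ y, c y ∈ F := by
    intro y
    by_cases hy : y ∈ forestVerts X.graph T
    · obtain ⟨w, hw, hy⟩ := hy
      rw [hc1 w hw y hy]
      exact (ht w hw).1 y
    · rw [hc2 y hy]
      exact F.one_mem
  have hcT : ∀ y ω, y ∈ T → X.nb y ω ∈ T → c y ω = ω := by
    intro y ω hy hy'
    by_cases hyF : y ∈ forestVerts X.graph T
    · obtain ⟨w, hw, hyw⟩ := hyF
      rw [hc1 w hw y hyw]
      have := eq_of_mem_branch hyw hy
      subst this
      exact X.localPerm_apply_of_fixed (ht y hw).2.1 ((ht y hw).2.2 _ hy' (X.adj_nb y ω))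
    · rw [hc2 y hyF]
      rfl
  have hcase : ∀ y ω, (∃ w ∈ leaves X.graph T, y ∈ branch X.graph T w ∧
      X.nb y ω ∈ branch X.graph T w) ∨ (y ∈ T ∧ X.nb y ω ∈ T) := by
    intro y ω
    by_cases hy : y ∈ forestVerts X.graph T
    · obtain ⟨w, hw, hyw⟩ := hy
      obtain ⟨u, ⟨hu, hwu⟩, -⟩ := hw.2
      rcases branch_adj X.isTree hT.connected hw hu hwu hyw (X.adj_nb y ω) with h | ⟨h1, h2⟩
      · exact Or.inl ⟨w, hw, hyw, h⟩
      · exact Or.inr ⟨h1 ▸ hw.1, h2 ▸ hu⟩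
    · have hyT : y ∈ T := by
        by_contra h
        exact hy (cover X.isTree hT fun h' => absurd h' h)
      exact Or.inr ⟨hyT, hT.full y hyT (fun h => hy ⟨y, h, self_mem_branch⟩) _ (X.adj_nb y ω)⟩
  have hc : ∀ y ω, c (X.nb y ω) ω = c y ω := by
    intro y ω
    rcases hcase y ω with ⟨w, hw, h1, h2⟩ | ⟨h1, h2⟩
    · rw [hc1 w hw _ h1, hc1 w hw _ h2, X.localPerm_nb]
    · rw [hcT y ω h1 h2, hcT _ ω h2 (by rwa [X.nb_nb])]
  obtain ⟨s, hs, hsl⟩ := ColouredTree.exists_localPerm_eq hc b b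
  have hsT : ∀ y ∈ T, s y = y := by
    have key : ∀ (x y : T), (X.graph.induce T).Walk x y → (y : V) = b → s x = x := by
      intro x y p
      induction p with
      | nil => intro h; rw [h, hs]
      | @cons x x' y hadj q ih =>
        intro h
        obtain ⟨ω, hω⟩ := X.exists_eq_nb (show X.graph.Adj x' x from hadj.symm)
        have hx := ih h
        rw [hω, X.apply_nb, hx, hsl, hcT x' ω x'.2 (hω ▸ x.2)]
    intro y hy
    obtain ⟨p⟩ := hT.connected.preconnected ⟨y, hy⟩ ⟨b, hT.base_mem⟩
    exact key _ _ p rfl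
  refine ⟨s, fun x => by rw [hsl]; exact hcF x, hsT, fun w hw => ?_⟩
  exact X.eqOn_of_localPerm_eq ((hsT w hw.1).trans (ht w hw).2.1.symm)
    (fun x hx hne => branch_closer hcon hx hne) (fun x hx => by rw [hsl, hc1 w hw x hx])

/-- Honest almost automorphisms conjugate elements of `U(F)` fixing the domain to elements of `U(F)`
fixing the codomain. -/
theorem Honest.exists_conj {f : V → V} (hf : Honest b (universalGroup X F) T T' f)
    {s : X.graph ≃g X.graph} (hs : s ∈ universalGroup X F) (hsT : ∀ x ∈ T, s x = x) :
    ∃ s' ∈ universalGroup X F, (∀ y ∈ T', s' y = y) ∧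
      ∀ x ∈ forestVerts X.graph T, s' (f x) = f (s x) := by
  have hcon := X.isTree.connected
  -- On the branch at `f v` the conjugate is h s h⁻¹ with `h` the local form of `f`. It fixes the
  -- root and its neighbour in `T'`, since these are images under `h` of fixed vertices of `T`; this
  -- is what gluing requires.
  have hloc : ∀ w ∈ leaves X.graph T', ∃ t, (t ∈ universalGroup X F ∧ t w = w ∧
      ∀ u ∈ T', X.graph.Adj w u → t u = u) ∧
      ∀ v ∈ leaves X.graph T, f v = w → ∀ x ∈ branch X.graph T v, t (f x) = f (s x) := by
    intro w hw
    obtain ⟨v, hv, rfl⟩ := hf.bij.surjOn hw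
    obtain ⟨h, hH, h1, h2⟩ := hf.honest v hv
    obtain ⟨u, ⟨hu, huv⟩, -⟩ := hv.2
    have hconj : ∀ x, (h * s * h⁻¹) (h x) = h (s x) := by
      intro x
      change h (s (h.symm (h x))) = _
      rw [h.symm_apply_apply]
    have hfv := h2 v self_mem_branch
    refine ⟨h * s * h⁻¹, ⟨mul_mem (mul_mem hH hs) (inv_mem hH), ?_, ?_⟩, ?_⟩
    · rw [hfv, hconj, hsT v hv.1]
    · intro u' hu' huv'
      rw [← (root_eq X.isTree hf.cod_complete.connected hw hu huv hu' huv' h1).2, hconj, hsT u hu]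
    · intro v' hv' hvv x hx
      rw [hf.bij.injOn hv' hv hvv] at hx
      rw [h2 x hx, hconj, h2 _ (apply_mem_branch hcon hsT hv.1 hx)]
  choose! t ht ht' using hloc
  obtain ⟨s', hs', h1, h2⟩ := exists_glue hf.cod_complete t ht
  refine ⟨s', hs', h1, ?_⟩
  rintro x ⟨v, hv, hx⟩
  have hmem : f x ∈ branch X.graph T' (f v) := by
    obtain ⟨h, -, k1, k2⟩ := hf.honest v hv
    rw [k2 x hx]
    exact (k1 x).1 hx
  rw [h2 _ (hf.bij.mapsTo hv) _ hmem]
  exact ht' _ (hf.bij.mapsTo hv) v hv rfl x hx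

/-- The inverse of `f` on the forest is honest too, and this is `Honest.exists_conj` for it. -/
theorem Honest.exists_conj_symm {f : V → V} (hf : Honest b (universalGroup X F) T T' f)
    {s : X.graph ≃g X.graph} (hs : s ∈ universalGroup X F) (hsT : ∀ x ∈ T', s x = x) :
    ∃ s' ∈ universalGroup X F, (∀ y ∈ T, s' y = y) ∧
      ∀ x ∈ forestVerts X.graph T, f (s' x) = s (f x) := by
  have hcon := X.isTree.connected
  obtain ⟨b₀⟩ := hcon.nonempty
  have : Nonempty V := ⟨b₀⟩
  have hb := hf.bijOn hcon
  have hk := hb.invOn_invFunOn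
  obtain ⟨s', hs', h1, h2⟩ := (hf.symm fun x hx => hk.1 hx).exists_conj hs hsT
  refine ⟨s', hs', h1, fun x hx => ?_⟩
  have h3 := h2 (f x) (hb.mapsTo hx)
  rw [hk.1 hx] at h3
  rw [h3]
  refine hk.2 ?_
  obtain ⟨w, hw, hxw⟩ := hb.mapsTo hx
  exact ⟨w, hw, apply_mem_branch hcon hsT hw.1 hxw⟩

/-- Automorphisms of the tree which agree outside a finite set are equal. -/
theorem eq_of_finite_ne {g h : X.graph ≃g X.graph} (hgh : {x | g x ≠ h x}.Finite) : g = h := by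
  obtain ⟨b⟩ := X.isTree.connected.nonempty
  obtain ⟨n, -, hn⟩ := exists_ball_superset X.graph b hgh
  have hfin := X.finite_colours
  -- Agreement is propagated inwards from sphere to sphere. Since `d ≥ 3`, each `x` has two
  -- neighbours farther from b; in a tree their images have only one common neighbour, so `g x = h
  -- x`.
  have key : ∀ n, (∀ x, n ≤ X.graph.dist x b → g x = h x) → ∀ x, g x = h x := by
    intro n
    induction n with
    | zero => exact fun H x => H x (Nat.zero_le _)
    | succ n ih =>
      refine fun H => ih fun x hx => ?_
      rcases hx.lt_or_eq with hlt | heq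
      · exact H x hlt
      · -- two children of `x`
        obtain ⟨ω, ω', hne, h1, h2⟩ : ∃ ω ω' : Ω, ω ≠ ω' ∧
            X.graph.dist (X.nb x ω) b = n + 1 ∧ X.graph.dist (X.nb x ω') b = n + 1 := by
          have := Fintype.ofFinite Ω
          have h3 := X.three_le
          rw [Nat.card_eq_fintype_card] at h3
          obtain ⟨α, β, γ, hαβ, hαγ, hβγ⟩ := Fintype.two_lt_card_iff.1 h3
          have hpar : ∀ ω ω' : Ω, ω ≠ ω' →
              X.graph.dist x b = X.graph.dist (X.nb x ω) b + 1 →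
              X.graph.dist (X.nb x ω') b = n + 1 := by
            intro ω ω' hne hω
            rcases X.dist_nb b x ω' with h | h
            · exact absurd (X.parent_unique (b := b) (x := x) (ω := ω) (ω' := ω')
                (by omega) (by omega)) hne
            · omega
          rcases X.dist_nb b x α with hα | hα
          · exact ⟨β, γ, hβγ, hpar α β hαβ hα, hpar α γ hαγ hα⟩
          rcases X.dist_nb b x β with hβ | hβ
          · exact ⟨α, γ, hαγ, hpar β α hαβ.symm hβ, hpar β γ hβγ hβ⟩
          · exact ⟨α, β, hαβ, by omega, by omega⟩
        have e1 := H _ h1.ge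
        have e2 := H _ h2.ge
        have a1 : X.graph.Adj (g (X.nb x ω)) (g x) := g.map_adj_iff.2 (X.adj_nb x ω).symm
        have a2 : X.graph.Adj (g (X.nb x ω)) (h x) := by
          rw [e1]; exact h.map_adj_iff.2 (X.adj_nb x ω).symm
        have a3 : X.graph.Adj (g (X.nb x ω')) (g x) := g.map_adj_iff.2 (X.adj_nb x ω').symm
        have a4 : X.graph.Adj (g (X.nb x ω')) (h x) := by
          rw [e2]; exact h.map_adj_iff.2 (X.adj_nb x ω').symm
        have d1 := X.isTree.dist_eq_dist_add_one_of_adj (g (X.nb x ω')) a1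
        have d3 := SimpleGraph.dist_eq_one_iff_adj.2 a3
        have d4 := SimpleGraph.dist_eq_one_iff_adj.2 a4
        have d0 : X.graph.dist (g (X.nb x ω')) (g (X.nb x ω)) ≠ 0 := by
          intro h0
          have := g.injective (X.isTree.connected.dist_eq_zero_iff.1 h0)
          exact hne (X.nb_injective x this).symm
        exact closer_unique X.isTree (b := g (X.nb x ω')) a1 a2 (by omega) (by omega)
  exact RelIso.ext (key n fun x hx => by_contra fun hne => absurd (hn x hne) (not_lt.2 hx))

theorem autToNearPerm_injective : Function.Injective (autToNearPerm (G := X.graph)) := by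
  intro g h e
  exact eq_of_finite_ne (((NearPerm.rep_autToNearPerm g).eq_iff
    (NearPerm.rep_autToNearPerm h)).1 e)

variable (X b F) in
theorem universalToNeretin_injective : Function.Injective (universalToNeretin X b F) := by
  intro s t h
  exact Subtype.ext (autToNearPerm_injective (congrArg Subtype.val h))

/-- The representative is one of `g⁻¹`, defined outside a ball of radius at least `n`. Elements
fixing a ball that contains its codomain are then pulled back to elements fixing its domain, hence
the ball of radius `n`. -/
theorem conj_universalToNeretin (g : neretinGroup X b F) (n : ℕ) :
    ∃ m, ∀ s ∈ ballFix X b F m, ∃ s' ∈ ballFix X b F n,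
      g * universalToNeretin X b F s * g⁻¹ = universalToNeretin X b F s' := by
  obtain ⟨f, n₀, hr, -, hf⟩ := exists_honest_ball (g⁻¹).2
  obtain ⟨T', hT'⟩ := hf (max n n₀) (le_max_right _ _)
  obtain ⟨m, -, hm⟩ := exists_ball_superset X.graph b hT'.cod_complete.finite
  refine ⟨m, fun s hs => ?_⟩
  obtain ⟨s', hs', h1, h2⟩ := hT'.exists_conj_symm s.2 (fun x hx => hs x (hm x hx).le)
  refine ⟨⟨s', hs'⟩, fun x hx => h1 x (hx.trans (le_max_left _ _)), ?_⟩
  have e : g⁻¹ * universalToNeretin X b F ⟨s', hs'⟩ = universalToNeretin X b F s * g⁻¹ := by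
    apply Subtype.ext
    refine ((hr.mul (NearPerm.rep_autToNearPerm s')).eq_iff
      ((NearPerm.rep_autToNearPerm s.1).mul hr)).2 ?_
    exact (hT'.dom_complete.finite_compl X.isTree).subset fun x hx hxT => hx (h2 x hxT)
  rw [mul_assoc, ← e, mul_inv_cancel_left]

instance : IsTopologicalGroup (neretinGroup X b F) := by
  refine isTopologicalGroup_of_cosetTopology (f := universalToNeretin X b F) rfl
    (universalToNeretin_injective X F b) fun g W hW => ?_
  obtain ⟨n, hn⟩ := exists_ballFix_subset b hW
  obtain ⟨m, hm⟩ := conj_universalToNeretin g n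
  filter_upwards [(isOpen_ballFix (b := b) m).mem_nhds (Subgroup.one_mem _)] with s hs
  obtain ⟨s', hs', e⟩ := hm s hs
  exact ⟨s', hn hs', e⟩

variable (X b F) in
theorem isOpenEmbedding_universalToNeretin :
    Topology.IsOpenEmbedding (universalToNeretin X b F) :=
  isOpenEmbedding_of_cosetTopology rfl (universalToNeretin_injective X F b)

instance : NonarchimedeanGroup (neretinGroup X b F) :=
  NonarchimedeanGroup.nonarchimedean_of_emb _ (isOpenEmbedding_universalToNeretin X F b)

instance : T2Space (neretinGroup X b F) := by
  refine IsTopologicalGroup.t2Space_of_one_sep fun x hx => ?_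
  have hemb := isOpenEmbedding_universalToNeretin X F b
  by_cases h : x ∈ Set.range (universalToNeretin X b F)
  · obtain ⟨s, rfl⟩ := h
    have hs : s ≠ 1 := fun h => hx (by rw [h, map_one])
    refine ⟨_ '' {s}ᶜ, (hemb.isOpenMap _ isOpen_compl_singleton).mem_nhds
      ⟨1, hs.symm, map_one _⟩, ?_⟩
    rw [hemb.injective.mem_set_image]
    simp
  · exact ⟨_, hemb.isOpen_range.mem_nhds ⟨1, map_one _⟩, h⟩

end Conjugation

/-! ### The commensurator of a vertex stabilizer of `U(F(p))` in `N(F)` -/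

section Permutations

variable {Ω : Type*} {F Fp : Subgroup (Equiv.Perm Ω)}

/-- At the root of a branch an almost automorphism determines the images of all colours but that of
the edge leaving the branch; the last value is then forced. -/
theorem perm_eq_of_eq_of_ne {σ τ : Equiv.Perm Ω} (ω₀ : Ω) (h : ∀ ω, ω ≠ ω₀ → σ ω = τ ω) :
    σ = τ := by
  have h0 : σ ω₀ = τ ω₀ := by
    by_cases h1 : σ.symm (τ ω₀) = ω₀
    · rw [Equiv.symm_apply_eq] at h1
      exact h1.symm
    · have h2 := h _ h1
      rw [Equiv.apply_symm_apply] at h2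
      exact absurd (τ.injective h2).symm h1
  ext ω
  by_cases hω : ω = ω₀
  · rw [hω, h0]
  · exact h ω hω

theorem le_orbitHull (F : Subgroup (Equiv.Perm Ω)) : F ≤ orbitHull F := fun σ hσ _ =>
  MulAction.orbit_eq_iff.2 ⟨⟨σ, hσ⟩, rfl⟩

/-- By equality of orbits there is t ∈ Fp with tω = σω. Then t⁻¹σ fixes ω, lies in the orbit hull
and conjugates the stabilizer of ω in Fp into itself, hence normalizes it by finiteness; `hnorm`
puts it in Fp. -/
theorem mem_of_conj_stabilizer_le [Finite Ω] (hle : Fp ≤ F)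
    (horb : ∀ ω : Ω, MulAction.orbit F ω = MulAction.orbit Fp ω)
    (hnorm : ∀ ω : Ω,
      (orbitHull F ⊓ MulAction.stabilizer (Equiv.Perm Ω) ω) ⊓
        Subgroup.normalizer (Fp ⊓ MulAction.stabilizer (Equiv.Perm Ω) ω : Subgroup (Equiv.Perm Ω)) =
        Fp ⊓ MulAction.stabilizer (Equiv.Perm Ω) ω)
    {σ : Equiv.Perm Ω} (hσ : σ ∈ F) {ω : Ω} (h : ∀ a ∈ Fp, a ω = ω → σ * a * σ⁻¹ ∈ Fp) :
    σ ∈ Fp := by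
  have h1 : σ ω ∈ MulAction.orbit Fp ω := by
    rw [← horb]
    exact ⟨⟨σ, hσ⟩, rfl⟩
  obtain ⟨⟨t, ht⟩, htω⟩ := h1
  have htω' : t ω = σ ω := htω
  have hρω : (t⁻¹ * σ) ω = ω := by
    rw [Equiv.Perm.mul_apply, ← htω', ← Equiv.Perm.mul_apply, inv_mul_cancel, Equiv.Perm.one_apply]
  have hρ' : (t⁻¹ * σ)⁻¹ ω = ω := by
    rw [Equiv.Perm.inv_eq_iff_eq, hρω]
  have hmem : t⁻¹ * σ ∈ (orbitHull F ⊓ MulAction.stabilizer (Equiv.Perm Ω) ω) ⊓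
      Subgroup.normalizer
        (Fp ⊓ MulAction.stabilizer (Equiv.Perm Ω) ω : Subgroup (Equiv.Perm Ω)) := by
    refine ⟨⟨le_orbitHull F (F.mul_mem (F.inv_mem (hle ht)) hσ), hρω⟩, ?_⟩
    have hconj : ∀ a ∈ Fp ⊓ MulAction.stabilizer (Equiv.Perm Ω) ω,
        t⁻¹ * σ * a * (t⁻¹ * σ)⁻¹ ∈ Fp ⊓ MulAction.stabilizer (Equiv.Perm Ω) ω := by
      rintro a ⟨ha, haω⟩
      have haω' : a ω = ω := haω
      refine ⟨?_, ?_⟩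
      · have := Fp.mul_mem (Fp.mul_mem (Fp.inv_mem ht) (h a ha haω')) ht
        simpa [mul_assoc] using this
      · change (t⁻¹ * σ * a * (t⁻¹ * σ)⁻¹) ω = ω
        rw [Equiv.Perm.mul_apply, hρ', Equiv.Perm.mul_apply, haω', hρω]
    exact Subgroup.mem_normalizer_fintype hconj
  rw [hnorm] at hmem
  have := Fp.mul_mem ht hmem.1
  simpa using this

end Permutations

/-- Pigeonhole on the finitely many cosets of `D ∩ S` in `S`. -/
theorem exists_ne_inv_mul_mem {G ι : Type*} [Group G] [Infinite ι] {D S : Subgroup G}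
    (h : D.relIndex S ≠ 0) (s : ι → G) (hs : ∀ i, s i ∈ S) :
    ∃ i j, i ≠ j ∧ (s i)⁻¹ * s j ∈ D := by
  have : Finite (S ⧸ D.subgroupOf S) := Nat.finite_of_card_ne_zero h
  obtain ⟨i, j, hij, e⟩ := Finite.exists_ne_map_eq_of_infinite
    fun i => ((⟨s i, hs i⟩ : S) : S ⧸ D.subgroupOf S)
  have h1 : (⟨s i, hs i⟩ : S)⁻¹ * ⟨s j, hs j⟩ ∈ D.subgroupOf S := QuotientGroup.eq.1 e
  exact ⟨i, j, hij, h1⟩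

section Commensurator

variable {V Ω : Type*} {X : ColouredTree V Ω} {F Fp : Subgroup (Equiv.Perm Ω)} {b : V}

theorem universalGroup_mono (hle : Fp ≤ F) : universalGroup X Fp ≤ universalGroup X F :=
  fun _ hg x => hle (hg x)

theorem neretinGroup_mono (hle : Fp ≤ F) : neretinGroup X b Fp ≤ neretinGroup X b F := by
  intro g hg
  obtain ⟨T, T', f, hf, hr⟩ := mem_almostAutGroup_iff.1 hg
  exact (hf.mono (universalGroup_mono hle)).rep_mem hr

variable (X b) in
/-- The inclusion of `U(Fp)` into `N(F)`, for `Fp ≤ F`. -/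
noncomputable def subUniversalToNeretin (hle : Fp ≤ F) : universalGroup X Fp →* neretinGroup X b F :=
  (universalToNeretin X b F).comp (Subgroup.inclusion (universalGroup_mono hle))

theorem isEmbedding_subUniversalToNeretin (hle : Fp ≤ F) :
    Topology.IsEmbedding (subUniversalToNeretin X b hle) :=
  (isOpenEmbedding_universalToNeretin X F b).isEmbedding
    |>.comp (Topology.IsEmbedding.inclusion (universalGroup_mono hle))

variable (X b) in
/-- The stabilizer of `b` in `U(Fp)`, as a subgroup of `N(F)`. -/
noncomputable def vertexStab (hle : Fp ≤ F) : Subgroup (neretinGroup X b F) :=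
  (ballFix X b Fp 0).map (subUniversalToNeretin X b hle)

theorem relIndex_ballFix_ne_zero (m : ℕ) :
    (ballFix X b F m).relIndex (ballFix X b F 0) ≠ 0 := by
  have : CompactSpace (ballFix X b F 0) := isCompact_iff_compactSpace.1 isCompact_ballFix_zero
  have : Finite (ballFix X b F 0 ⧸ (ballFix X b F m).subgroupOf (ballFix X b F 0)) :=
    Subgroup.quotient_finite_of_isOpen _ ((isOpen_ballFix m).preimage continuous_subtype_val)
  exact Subgroup.index_ne_zero_of_finite

/-- By `conj_universalToNeretin` for `Fp`, conjugation by `g` maps the fixator in `U(Fp)` of a large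
ball into the vertex stabilizer, where this fixator has finite index. -/
theorem relIndex_conj_vertexStab_ne_zero (hle : Fp ≤ F) {g : neretinGroup X b F}
    (hg : (g : NearPerm V) ∈ neretinGroup X b Fp) :
    (ConjAct.toConjAct g⁻¹ • vertexStab X b hle).relIndex (vertexStab X b hle) ≠ 0 := by
  obtain ⟨m, hm⟩ := conj_universalToNeretin (⟨g, hg⟩ : neretinGroup X b Fp) 0
  have h1 : (ballFix X b Fp m).map (subUniversalToNeretin X b hle) ≤
      ConjAct.toConjAct g⁻¹ • vertexStab X b hle := by
    rintro _ ⟨s, hs, rfl⟩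
    obtain ⟨s', hs', e⟩ := hm s hs
    rw [Subgroup.mem_pointwise_smul_iff_inv_smul_mem, ← map_inv, inv_inv, ConjAct.toConjAct_smul]
    refine ⟨s', hs', Subtype.ext ?_⟩
    exact (congrArg Subtype.val e).symm
  have h2 : ((ballFix X b Fp m).map (subUniversalToNeretin X b hle)).relIndex
      (vertexStab X b hle) ≠ 0 := by
    rw [vertexStab, Subgroup.relIndex_map_map_of_injective _ _
      (isEmbedding_subUniversalToNeretin hle).injective]
    exact relIndex_ballFix_ne_zero m
  exact fun h => h2 (Subgroup.relIndex_eq_zero_of_le_left h1 h)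

theorem mem_commensurator_of_mem (hle : Fp ≤ F) {g : neretinGroup X b F}
    (hg : (g : NearPerm V) ∈ neretinGroup X b Fp) :
    g ∈ Subgroup.Commensurable.commensurator (vertexStab X b hle) := by
  rw [Subgroup.Commensurable.commensurator_mem_iff]
  have h1 := relIndex_conj_vertexStab_ne_zero hle (g := g⁻¹) (inv_mem hg)
  have h2 := relIndex_conj_vertexStab_ne_zero hle hg
  rw [inv_inv] at h1
  refine ⟨h1, ?_⟩
  -- Conjugation by `g` turns the index of S ∩ g⁻¹Sg in S into the index of S ∩ gSg⁻¹ in gSg⁻¹.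
  have e := Nat.card_congr (Subgroup.quotConjEquiv
    (ConjAct.toConjAct g⁻¹ • vertexStab X b hle) (vertexStab X b hle) (ConjAct.toConjAct g))
  rw [← mul_smul, ← map_mul, mul_inv_cancel, map_one, one_smul] at e
  intro h0
  exact h2 (e.trans h0)

/-- Vertices of a half-tree not containing `b` other than its root are farther from `b`. -/
theorem dist_lt_of_mem_half {x y : V} {ω : Ω}
    (hω : X.graph.dist x b = X.graph.dist (X.nb x ω) b + 1) (hy : y ∈ half X x (X.nb x ω)) :
    y = x ∨ X.graph.dist x b < X.graph.dist y b := by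
  suffices ∀ n y, X.graph.dist y b = n → y ∈ half X x (X.nb x ω) →
      y = x ∨ X.graph.dist x b < X.graph.dist y b from this _ y rfl hy
  intro n
  induction n with
  | zero =>
    intro y hn hy
    rw [X.isTree.connected.dist_eq_zero_iff.1 hn] at hy
    have hy' : X.graph.dist b x < X.graph.dist b (X.nb x ω) := hy
    rw [SimpleGraph.dist_comm, SimpleGraph.dist_comm (v := X.nb x ω)] at hy'
    omega
  | succ n ih =>
    intro y hn hy
    have hne : y ≠ b := by
      rintro rfl
      rw [SimpleGraph.dist_self] at hn
      omega
    obtain ⟨ω', hω'⟩ := X.exists_parent b hne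
    by_cases hz : X.nb y ω' ∈ half X x (X.nb x ω)
    · rcases ih _ (by omega) hz with h | h
      · rw [h] at hω'
        right; omega
      · right; omega
    · exact Or.inl (half_sep (X.adj_nb x ω) hy hz).1

/-- Outside a finite set, almost automorphisms agree with automorphisms on stars. -/
theorem Honest.exists_eq_on_star {n : ℕ} {T' : Set V} {f : V → V}
    (hf : Honest b (universalGroup X F) {x | X.graph.dist x b ≤ n} T' f) {x : V}
    (hx : n < X.graph.dist x b) : ∃ h ∈ universalGroup X F, f x = h x ∧
      ∀ ω, f (X.nb x ω) = h (X.nb x ω) := by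
  have hT := hf.dom_complete
  have hxT : x ∉ {x | X.graph.dist x b ≤ n} := not_le.2 hx
  obtain ⟨v, hv, hxv⟩ := cover X.isTree hT fun h => absurd h hxT
  obtain ⟨u, ⟨hu, hvu⟩, -⟩ := hv.2
  obtain ⟨h, hH, -, h2⟩ := hf.honest v hv
  refine ⟨h, hH, h2 x hxv, fun ω => h2 _ ?_⟩
  refine (branch_adj X.isTree hT.connected hv hu hvu hxv (X.adj_nb x ω)).resolve_right ?_
  rintro ⟨rfl, -⟩
  exact hxT hv.1

/-- If conjugation by `g` maps an element fixing a ball into `U(Fp)`, then the local permutations of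
a representative of `g` conjugate those of this element into `Fp`. -/
theorem localPerm_conj_mem {g : neretinGroup X b F} {T T' : Set V} {f : V → V}
    (hr : NearPerm.Rep (g : NearPerm V) f) (hf : Honest b (universalGroup X F) T T' f)
    {d s : universalGroup X F} (hd : ∀ x ∈ T, d.1 x = x) (hs : s.1 ∈ universalGroup X Fp)
    (e : g * universalToNeretin X b F d * g⁻¹ = universalToNeretin X b F s)
    {x : V} (hxT : x ∉ T) (hx' : ∀ ω, X.nb x ω ∈ forestVerts X.graph T) (hdx : d.1 x = x)
    {k : X.graph ≃g X.graph} (hk : f x = k x) (hkn : ∀ ω, f (X.nb x ω) = k (X.nb x ω)) :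
    X.localPerm k x * X.localPerm d.1 x * (X.localPerm k x)⁻¹ ∈ Fp := by
  obtain ⟨s', hs', -, h2⟩ := hf.exists_conj d.2 hd
  -- Both automorphisms represent the conjugate of `d` by `g` as near permutations, and an
  -- automorphism is determined by its near permutation.
  have e' : s' = s.1 := by
    apply autToNearPerm_injective
    have h3 : autToNearPerm s' * (g : NearPerm V) = (g : NearPerm V) * autToNearPerm d.1 := by
      refine (((NearPerm.rep_autToNearPerm s').mul hr).eq_iff
        (hr.mul (NearPerm.rep_autToNearPerm d.1))).2 ?_
      exact (hf.dom_complete.finite_compl X.isTree).subset fun y hy hyT => hy (h2 y hyT)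
    have h4 : (g : NearPerm V) * autToNearPerm d.1 * (g : NearPerm V)⁻¹ = autToNearPerm s.1 :=
      congrArg Subtype.val e
    rw [← h4, ← h3, mul_inv_cancel_right]
  rw [e'] at h2
  have hxF : x ∈ forestVerts X.graph T := cover X.isTree hf.dom_complete fun h => absurd h hxT
  -- On the star of `x` the map `f` may be replaced by the automorphism `k`, so `s * k` and `k * d`
  -- agree there; the chain rule for local permutations then gives the claim.
  have h5 : X.localPerm (s.1 * k) x = X.localPerm (k * d.1) x := by
    refine X.localPerm_congr ?_ fun ω => ?_
    · change s.1 (k x) = k (d.1 x)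
      rw [← hk, h2 x hxF, hdx, hk]
    · change s.1 (k (X.nb x ω)) = k (d.1 (X.nb x ω))
      rw [← hkn, h2 _ (hx' ω), X.apply_nb, hdx, hkn]
  rw [X.localPerm_mul, X.localPerm_mul, hdx] at h5
  rw [← h5, mul_inv_cancel_right]
  exact hs _

/-- Failure at infinitely many vertices would yield infinitely many twists in the vertex stabilizer
that a subgroup of finite index cannot accommodate. Beyond a large ball all local permutations
therefore lie in `Fp`, and on each branch the element of `U(F)` can be exchanged for one of `U(Fp)`.
-/
theorem mem_of_mem_commensurator (hle : Fp ≤ F)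
    (horb : ∀ ω : Ω, MulAction.orbit F ω = MulAction.orbit Fp ω)
    (hnorm : ∀ ω : Ω,
      (orbitHull F ⊓ MulAction.stabilizer (Equiv.Perm Ω) ω) ⊓
        Subgroup.normalizer (Fp ⊓ MulAction.stabilizer (Equiv.Perm Ω) ω : Subgroup (Equiv.Perm Ω)) =
        Fp ⊓ MulAction.stabilizer (Equiv.Perm Ω) ω)
    {g : neretinGroup X b F}
    (hg : g ∈ Subgroup.Commensurable.commensurator (vertexStab X b hle)) :
    (g : NearPerm V) ∈ neretinGroup X b Fp := by
  have hΩ := X.finite_colours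
  obtain ⟨f, n, hr, hn, hf⟩ := exists_honest_ball g.2
  obtain ⟨T', hT'⟩ := hf n le_rfl
  -- The sphere of radius `n` must be included, as it contains neighbours of vertices at distance `n
  -- + 1`; its vertices are leaves of the ball because `1 ≤ n`.
  have hmemF : ∀ y, n ≤ X.graph.dist y b →
      y ∈ forestVerts X.graph {x | X.graph.dist x b ≤ n} := by
    intro y hy
    refine cover X.isTree hT'.dom_complete fun hyT => ?_
    by_contra hcon
    have hyb : y ≠ b := by
      rintro rfl
      rw [SimpleGraph.dist_self] at hy
      omega
    apply hcon
    obtain ⟨ω, hω⟩ := X.exists_parent b hyb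
    have hyT' : X.graph.dist y b ≤ n := hyT
    refine ⟨hyT, X.nb y ω, ⟨show X.graph.dist (X.nb y ω) b ≤ n by omega, X.adj_nb y ω⟩, ?_⟩
    rintro z ⟨hz, hyz⟩
    obtain ⟨ω', rfl⟩ := X.exists_eq_nb hyz
    have hz' : X.graph.dist (X.nb y ω') b ≤ n := hz
    have := X.dist_nb b y ω'
    rw [X.parent_unique (b := b) (x := y) (ω := ω') (ω' := ω) (by omega) (by omega)]
  choose! k hkF hk hkn using fun x (hx : n < X.graph.dist x b) => hT'.exists_eq_on_star hx
  -- the set of vertices where the local permutations do not normalize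
  set B : Set V := {x | n < X.graph.dist x b ∧ ∃ ω a,
    X.graph.dist x b = X.graph.dist (X.nb x ω) b + 1 ∧ a ∈ Fp ∧ a ω = ω ∧
    X.localPerm (k x) x * a * (X.localPerm (k x) x)⁻¹ ∉ Fp} with hB
  -- For each bad vertex `x`, `s x` is a twist of the half-tree behind `x` with a bad permutation at
  -- `x`. It fixes the ball of radius `n`, so `localPerm_conj_mem` applies to quotients of such
  -- twists.
  have hBfin : B.Finite := by
    by_contra hinf
    have : Infinite B := Set.infinite_coe_iff.2 hinf
    have hB' : ∀ x : B, ∃ ω a, X.graph.dist (x : V) b = X.graph.dist (X.nb x ω) b + 1 ∧ a ∈ Fp ∧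
        a ω = ω ∧ X.localPerm (k x) x * a * (X.localPerm (k x) x)⁻¹ ∉ Fp := fun x => x.2.2
    choose ω a hω ha haω hbad using hB'
    choose s hs hsa hsx hsoff using fun x : B => exists_twist_half (ha x) (haω x) (x : V)
    have hsn : ∀ x, (⟨s x, hs x⟩ : universalGroup X Fp) ∈ ballFix X b Fp n := by
      intro x y hy
      refine (hsoff x y fun hyh => ?_).1
      have hxn : n < X.graph.dist (x : V) b := x.2.1
      rcases dist_lt_of_mem_half (hω x) hyh with h | h
      · rw [h] at hy; omega
      · omega
    -- The inverse is used because the group of finite index in S should be S ∩ g⁻¹Sg: its elements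
    -- are conjugated by `g` into S.
    have hg' := inv_mem hg
    rw [Subgroup.Commensurable.commensurator_mem_iff] at hg'
    obtain ⟨i, j, hij, hmem⟩ := exists_ne_inv_mul_mem hg'.1
      (fun x : B => subUniversalToNeretin X b hle ⟨s x, hs x⟩)
      (fun x => ⟨_, ballFix_anti (Nat.zero_le n) (hsn x), rfl⟩)
    rw [← map_inv, ← map_mul, Subgroup.mem_pointwise_smul_iff_inv_smul_mem, ← map_inv, inv_inv,
      ConjAct.toConjAct_smul] at hmem
    obtain ⟨s', hs', e⟩ := hmem
    set d : universalGroup X Fp := ⟨s i, hs i⟩⁻¹ * ⟨s j, hs j⟩ with hd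
    have hdn : d ∈ ballFix X b Fp n := mul_mem (inv_mem (hsn i)) (hsn j)
    have key : ∀ x : B, d.1 x = x →
        X.localPerm (k x) x * X.localPerm d.1 x * (X.localPerm (k x) x)⁻¹ ∈ Fp := by
      intro x hdx
      have hxn : n < X.graph.dist (x : V) b := x.2.1
      refine localPerm_conj_mem (d := Subgroup.inclusion (universalGroup_mono hle) d)
        (s := Subgroup.inclusion (universalGroup_mono hle) s') hr hT' hdn s'.2 e.symm
        (not_le.2 hxn) (fun ω => hmemF _ ?_) hdx (hk x hxn) (hkn x hxn)
      have := X.dist_nb b (x : V) ω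
      omega
    have hd' : d.1 = (s i)⁻¹ * s j := rfl
    have hinv : ∀ {x : V} {t : X.graph ≃g X.graph}, t x = x → t⁻¹ x = x := by
      intro x t h
      change t.symm x = x
      rw [RelIso.symm_apply_eq, h]
    have hinvl : ∀ {x : V} {t : X.graph ≃g X.graph}, t x = x →
        X.localPerm t⁻¹ x = (X.localPerm t x)⁻¹ := by
      intro x t h
      have := X.localPerm_inv t x
      rwa [h] at this
    -- Two distinct vertices cannot each lie in the half-tree behind the other, as each would be
    -- farther from b. Hence one twist is trivial around the root of the other, and there `d` has
    -- local permutation `a j` or the inverse of `a i`.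
    by_cases hcase : (i : V) ∈ half X (j : V) (X.nb j (ω j))
    · have hcase' : (j : V) ∉ half X (i : V) (X.nb i (ω i)) := by
        intro h
        have h1 := (dist_lt_of_mem_half (hω j) hcase).resolve_left fun h => hij (Subtype.ext h)
        have h2 := (dist_lt_of_mem_half (hω i) h).resolve_left fun h => hij (Subtype.ext h.symm)
        omega
      obtain ⟨h1, h2⟩ := hsoff i _ hcase'
      refine hbad j ?_
      have h3 := key j (by
        rw [hd']
        change (s i)⁻¹ (s j j) = j
        rw [hsx, hinv h1])
      rwa [hd', X.localPerm_mul, hsx, hinvl h1, h2, inv_one, one_mul, hsa] at h3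
    · obtain ⟨h1, h2⟩ := hsoff j _ hcase
      refine hbad i ?_
      have h3 := key i (by
        rw [hd']
        change (s i)⁻¹ (s j i) = i
        rw [h1, hinv (hsx i)])
      rw [hd', X.localPerm_mul, h1, hinvl (hsx i), h2, mul_one, hsa] at h3
      have h4 := inv_mem h3
      simpa [mul_assoc] using h4
  have hgood : ∀ x, n < X.graph.dist x b → x ∉ B → X.localPerm (k x) x ∈ Fp := by
    intro x hx hxB
    have hxb : x ≠ b := by
      rintro rfl
      rw [SimpleGraph.dist_self] at hx
      omega
    obtain ⟨ω, hω⟩ := X.exists_parent b hxb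
    refine mem_of_conj_stabilizer_le hle horb hnorm (hkF x hx x) (ω := ω) fun a ha haω => ?_
    by_contra hcon
    exact hxB ⟨hx, ω, a, hω, ha, haω, hcon⟩
  obtain ⟨m₀, -, hm₀⟩ := exists_ball_superset X.graph b hBfin
  obtain ⟨T₂, hT₂⟩ := hf (max m₀ (n + 1)) (by omega)
  -- All vertices in branches of this ball are at distance at least `m`, so they avoid `B` and lie
  -- where `k` is available.
  set m := max m₀ (n + 1) with hm
  refine Honest.rep_mem (T := {x | X.graph.dist x b ≤ m}) (T' := T₂)
    ⟨hT₂.dom_complete, hT₂.cod_complete, hT₂.bij, fun v hv => ?_⟩ hr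
  obtain ⟨h, hH, h1, h2⟩ := hT₂.honest v hv
  obtain ⟨u, ⟨hu, hvu⟩, -⟩ := hv.2
  have hv' := hT₂.bij.mapsTo hv
  obtain ⟨u', ⟨hu', hvu'⟩, -⟩ := hv'.2
  obtain ⟨e1, e2⟩ := root_eq X.isTree hT₂.cod_complete.connected hv' hu hvu hu' hvu' h1
  have hbr : ∀ x, x ∈ branch X.graph {x | X.graph.dist x b ≤ m} v ↔ x ∈ half X v u := fun x =>
    mem_branch_iff_half X.isTree hT₂.dom_complete.connected hv hu hvu
  have hbr' : ∀ x, x ∈ branch X.graph T₂ (f v) ↔ x ∈ half X (f v) u' := fun x =>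
    mem_branch_iff_half X.isTree hT₂.cod_complete.connected hv' hu' hvu'
  obtain ⟨h', hH', h3, h4⟩ := exists_extend_half (F := Fp) hvu h fun x hx => by
    have hxm : m ≤ X.graph.dist x b := le_dist_of_mem_forestVerts_ball X.isTree
      X.nontrivial_neighborSet ⟨v, hv, (hbr x).2 hx⟩
    have hxn : n < X.graph.dist x b := by omega
    have hxB : x ∉ B := fun hxB => by
      have := hm₀ x hxB
      omega
    -- Only the edge from `v` to `u` leaves the branch, so `h` and `k x` are known to agree at every
    -- colour other than `ω₀`.
    obtain ⟨ω₀, hω₀⟩ := X.exists_eq_nb hvu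
    have : X.localPerm h x = X.localPerm (k x) x := by
      refine perm_eq_of_eq_of_ne ω₀ fun ω hω => X.localPerm_apply_eq ?_
      have hin : X.nb x ω ∈ half X v u := by
        by_contra hcon
        obtain ⟨rfl, h5⟩ := half_sep hvu hx hcon
        exact hω (X.nb_injective x (h5.trans hω₀))
      rw [← h2 _ ((hbr _).2 hin), ← h2 _ ((hbr _).2 hx), hkn x hxn, hk x hxn, X.apply_nb]
    rw [this]
    exact hgood x hxn hxB
  have hv0 : h' v = f v := by rw [h3 v (self_mem_half hvu), e1]
  refine ⟨h', hH', fun x => ?_, fun x hx => ?_⟩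
  -- The branches are half-trees, and `h'` agrees with `h` on both ends `v` and `u` of the edge
  -- defining the half-tree, so it maps branch onto branch.
  · have d1 := dist_apply X.isTree.connected h' x v
    have d2 := dist_apply X.isTree.connected h' x u
    rw [hv0] at d1
    rw [h4, e2] at d2
    rw [hbr, hbr']
    change X.graph.dist x v < X.graph.dist x u ↔
      X.graph.dist (h' x) (f v) < X.graph.dist (h' x) u'
    rw [d1, d2]
  · rw [h2 x hx, h3 x ((hbr x).1 hx)]

end Commensurator

/-! ### The vertex stabilizer of `U(F(p))` is a local Sylow subgroup of `N(F)` -/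

section Sylow

variable {V Ω : Type*} {X : ColouredTree V Ω} {F Fp : Subgroup (Equiv.Perm Ω)} {b : V}
  {p : ℕ}

/-- In a finite `p`-group, proper subgroups are properly contained in their normalizers. -/
theorem le_of_isPGroup_of_normalizer_le [Fact p.Prime] {G : Type*} [Group G] [Finite G] {I J : Subgroup G}
    (hI : IsPGroup p I) (hJI : J ≤ I)
    (h : ∀ z ∈ I, (∀ a ∈ J, z * a * z⁻¹ ∈ J) → z ∈ J) : I ≤ J := by
  have hnil : Group.IsNilpotent I := hI.isNilpotent
  rw [← Subgroup.subgroupOf_eq_top]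
  by_contra hne
  have hlt := Group.normalizerCondition_of_isNilpotent (J.subgroupOf I) (lt_top_iff_ne_top.2 hne)
  obtain ⟨z, hz, hzJ⟩ := SetLike.exists_of_lt hlt
  refine hzJ (h z z.2 fun a ha => ?_)
  exact (Subgroup.mem_normalizer_iff.1 hz ⟨a, hJI ha⟩).1 ha

/-- The local permutations at `x` of the elements of `R` fixing `x`. -/
def localGroup (R : Subgroup (universalGroup X F)) (x : V) : Subgroup (Equiv.Perm Ω) where
  carrier := {a | ∃ r ∈ R, r.1 x = x ∧ X.localPerm r.1 x = a}
  one_mem' := ⟨1, R.one_mem, rfl, X.localPerm_one x⟩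
  mul_mem' := by
    rintro _ _ ⟨r, hr, hrx, rfl⟩ ⟨t, ht, htx, rfl⟩
    refine ⟨r * t, R.mul_mem hr ht, ?_, ?_⟩
    · change r.1 (t.1 x) = x
      rw [htx, hrx]
    · change X.localPerm (r.1 * t.1) x = _
      rw [X.localPerm_mul, htx]
  inv_mem' := by
    rintro _ ⟨r, hr, hrx, rfl⟩
    refine ⟨r⁻¹, R.inv_mem hr, ?_, ?_⟩
    · change r.1.symm x = x
      rw [RelIso.symm_apply_eq, hrx]
    · have := X.localPerm_inv r.1 x
      rw [hrx] at this
      exact this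

theorem localGroup_le (R : Subgroup (universalGroup X F)) (x : V) : localGroup R x ≤ F := by
  rintro _ ⟨r, -, -, rfl⟩
  exact r.2 x

/-- Some `p`-power of `r` fixes a ball containing the whole star of `x`, so the same power of its
local permutation is trivial. -/
theorem isPGroup_localGroup {R : Subgroup (universalGroup X F)}
    (hR : ∀ s ∈ R, ∀ n, ∃ k : ℕ, s ^ p ^ k ∈ ballFix X b F n) (x : V) :
    IsPGroup p (localGroup R x) := by
  rintro ⟨_, r, hr, hrx, rfl⟩
  obtain ⟨k, hk⟩ := hR r hr (X.graph.dist x b + 1)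
  refine ⟨k, Subtype.ext ?_⟩
  change X.localPerm r.1 x ^ p ^ k = 1
  rw [← (X.localPerm_pow r.1 hrx _).1]
  refine X.localPerm_eq fun ω => ?_
  have h1 : (r.1 ^ p ^ k) x = x := hk x (Nat.le_succ _)
  have h2 : (r.1 ^ p ^ k) (X.nb x ω) = X.nb x ω := by
    refine hk _ ?_
    have := X.dist_nb b x ω
    omega
  rw [h1, h2, Equiv.Perm.one_apply]

variable [Fact p.Prime]

/-- A subgroup of a vertex stabilizer of `U(F)` which contains the vertex stabilizer of `U(F(p))`
and acts on all balls as a `p`-group lies in `U(F(p))`. -/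
theorem mem_universalGroup_of_isPGroup (hFp : ∃ P : Sylow p F, Fp = (P : Subgroup F).map F.subtype)
    (horb : ∀ ω : Ω, MulAction.orbit F ω = MulAction.orbit Fp ω)
    (hnorm : ∀ ω : Ω,
      (orbitHull F ⊓ MulAction.stabilizer (Equiv.Perm Ω) ω) ⊓
        Subgroup.normalizer (Fp ⊓ MulAction.stabilizer (Equiv.Perm Ω) ω : Subgroup (Equiv.Perm Ω)) =
        Fp ⊓ MulAction.stabilizer (Equiv.Perm Ω) ω)
    {R : Subgroup (universalGroup X F)} (hRb : R ≤ ballFix X b F 0)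
    (hRp : ∀ s : universalGroup X F, s.1 ∈ universalGroup X Fp → s.1 b = b → s ∈ R)
    (hR : ∀ s ∈ R, ∀ n, ∃ k : ℕ, s ^ p ^ k ∈ ballFix X b F n) {s : universalGroup X F}
    (hs : s ∈ R) : s.1 ∈ universalGroup X Fp := by
  have hΩ := X.finite_colours
  have hle : Fp ≤ F := by
    obtain ⟨P, rfl⟩ := hFp
    exact Subgroup.map_subtype_le _
  have hlocal : ∀ x, localGroup R x ≤ Fp := by
    intro x
    have hpg := isPGroup_localGroup hR x
    by_cases hx : x = b
    · subst hx
      obtain ⟨P, rfl⟩ := hFp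
      -- At b all of `Fp` is realized by elements of `R` (constant families of local permutations),
      -- so maximality of the Sylow subgroup decides.
      have h1 : (P : Subgroup F) ≤ (localGroup R x).subgroupOf F := by
        intro a ha
        obtain ⟨t, ht, hta, htx⟩ := exists_twist (X := X)
          (F := (P : Subgroup F).map F.subtype) ⟨a, ha, rfl⟩ x
        exact ⟨⟨t, universalGroup_mono hle ht⟩, hRp _ ht htx, htx, hta⟩
      have h2 := P.is_maximal' (hpg.comap_subtype (K := F)) h1
      intro a ha
      have haF := localGroup_le R x ha
      refine ⟨⟨a, haF⟩, ?_, rfl⟩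
      have : (⟨a, haF⟩ : F) ∈ (localGroup R x).subgroupOf F := ha
      rw [← h2]
      exact this
    · obtain ⟨ω, hω⟩ := X.exists_parent b hx
      have hfix : ∀ a ∈ localGroup R x, a ω = ω := by
        rintro _ ⟨r, hr, hrx, rfl⟩
        have hrb : r.1 b = b := mem_ballFix_zero.1 (hRb hr)
        have h1 := dist_apply_of_fixed hrb (X.nb x ω)
        rw [X.apply_nb, hrx] at h1
        exact X.parent_unique (b := b) (x := x) (by omega) (by omega)
      -- Away from b, the stabilizer of `ω` in `Fp` is realized by twists of the half-tree behind
      -- `x`, which fix b. It is its own normalizer in the local group, hence everything.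
      refine (le_of_isPGroup_of_normalizer_le hpg
        (J := Fp ⊓ MulAction.stabilizer (Equiv.Perm Ω) ω) ?_ ?_).trans inf_le_left
      · rintro a ⟨ha, haω⟩
        obtain ⟨t, ht, hta, htx, htoff⟩ := exists_twist_half (X := X) ha haω x
        have htb : t b = b := by
          refine (htoff b fun hb => ?_).1
          rcases dist_lt_of_mem_half hω hb with h | h
          · exact hx h.symm
          · rw [SimpleGraph.dist_self] at h
            omega
        exact ⟨⟨t, universalGroup_mono hle ht⟩, hRp _ ht htb, htx, hta⟩
      · intro z hz hconj
        exact ⟨mem_of_conj_stabilizer_le hle horb hnorm (localGroup_le R x hz) (ω := ω)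
          fun a ha haω => (hconj a ⟨ha, haω⟩).1, hfix z hz⟩
  suffices ∀ n, ∀ s ∈ R, ∀ x, X.graph.dist x b < n → X.localPerm s.1 x ∈ Fp from
    fun x => this _ s hs x (Nat.lt_succ_self _)
  intro n
  induction n with
  | zero => exact fun s _ x hx => absurd hx (Nat.not_lt_zero _)
  | succ n ih =>
    intro s hs x hx
    -- By induction `s` agrees on the ball of radius `n` with some `t` in `U(Fp)`; for `n = 0`, `t =
    -- 1` serves since `s` fixes b. Then t⁻¹s ∈ R fixes `x`, and `hlocal` applies to it.
    obtain ⟨t, ht, hts⟩ : ∃ t ∈ universalGroup X Fp, ∀ y, X.graph.dist y b ≤ n → t y = s.1 y := by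
      cases n with
      | zero =>
        refine ⟨1, one_mem _, fun y hy => ?_⟩
        exact (hRb hs y hy).symm
      | succ n => exact exists_extend_ball n s.1 fun y hy => ih s hs y (Nat.lt_succ_of_le hy)
    have htb : t b = b := by
      rw [hts b (by simp)]
      exact mem_ballFix_zero.1 (hRb hs)
    set t' : universalGroup X F := ⟨t, universalGroup_mono hle ht⟩ with ht'
    have htR : t' ∈ R := hRp _ ht htb
    have hx' : X.graph.dist x b ≤ n := Nat.lt_succ_iff.1 hx
    have hfix : (t'⁻¹ * s).1 x = x := by
      change t.symm (s.1 x) = x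
      rw [RelIso.symm_apply_eq, hts x hx']
    have h1 := hlocal x ⟨t'⁻¹ * s, R.mul_mem (R.inv_mem htR) hs, hfix, rfl⟩
    have h2 : X.localPerm s.1 x = X.localPerm t x * X.localPerm (t'⁻¹ * s).1 x := by
      have h3 := X.localPerm_mul t (t'⁻¹ * s).1 x
      rw [hfix] at h3
      rw [← h3]
      congr 1
      exact (mul_inv_cancel_left t s.1).symm
    rw [h2]
    exact Fp.mul_mem (ht x) h1

theorem isProP_vertexStab (hle : Fp ≤ F) (hFp : IsPGroup p Fp) :
    IsProP p (vertexStab X b hle) :=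
  (isProP_ballFix_zero hFp).map_of_isEmbedding _ (isEmbedding_subUniversalToNeretin hle)

/-- The ambient compact open group is the stabilizer of b in `U(F)`. A larger pro-`p` subgroup pulls
back to a group `R` as in `mem_universalGroup_of_isPGroup`, hence is not larger. -/
theorem isLocalSylow_vertexStab (hFp : ∃ P : Sylow p F, Fp = (P : Subgroup F).map F.subtype)
    (horb : ∀ ω : Ω, MulAction.orbit F ω = MulAction.orbit Fp ω)
    (hnorm : ∀ ω : Ω,
      (orbitHull F ⊓ MulAction.stabilizer (Equiv.Perm Ω) ω) ⊓
        Subgroup.normalizer (Fp ⊓ MulAction.stabilizer (Equiv.Perm Ω) ω : Subgroup (Equiv.Perm Ω)) =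
        Fp ⊓ MulAction.stabilizer (Equiv.Perm Ω) ω) (hle : Fp ≤ F) :
    IsLocalSylow p (vertexStab X b hle) := by
  have hemb := isOpenEmbedding_universalToNeretin X F b
  have hFp' : IsPGroup p Fp := by
    obtain ⟨P, rfl⟩ := hFp
    exact P.isPGroup'.map _
  refine ⟨(ballFix X b F 0).map (universalToNeretin X b F), ?_, ?_, ⟨?_, ?_⟩, ?_⟩
  · rw [Subgroup.coe_map]
    exact isCompact_ballFix_zero.image hemb.continuous
  · rw [Subgroup.coe_map]
    exact hemb.isOpenMap _ (isOpen_ballFix 0)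
  · rintro _ ⟨s, hs, rfl⟩
    exact ⟨Subgroup.inclusion (universalGroup_mono hle) s, hs, rfl⟩
  · exact isProP_vertexStab hle hFp'
  · rintro S ⟨hSK, hS⟩ hle'
    set R : Subgroup (universalGroup X F) := S.comap (universalToNeretin X b F) with hR
    have hRb : R ≤ ballFix X b F 0 := by
      intro s hs
      obtain ⟨s', hs', e⟩ := hSK hs
      rwa [← hemb.injective e]
    have hpow : ∀ s ∈ R, ∀ n, ∃ k : ℕ, s ^ p ^ k ∈ ballFix X b F n := by
      intro s hs n
      -- The elements of `S` fixing the ball of radius `n` form an open subgroup, normal because `S`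
      -- fixes b and so preserves the ball. Its index `p ^ k` provides the exponent.
      let N : Subgroup S := ((ballFix X b F n).map (universalToNeretin X b F)).subgroupOf S
      have hN : N.Normal := by
        refine ⟨?_⟩
        rintro ⟨x, hx⟩ ⟨t, ht, e⟩ ⟨y, hy⟩
        obtain ⟨r, hr, rfl⟩ := hSK hy
        have hxt : x = universalToNeretin X b F t := e.symm
        subst hxt
        refine ⟨r * t * r⁻¹, fun z hz => ?_, ?_⟩
        · have hrb : (r⁻¹).1 b = b := mem_ballFix_zero.1 ((ballFix X b F 0).inv_mem hr)
          change r.1 (t.1 ((r⁻¹).1 z)) = z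
          rw [ht _ (by rw [dist_apply_of_fixed hrb]; exact hz)]
          exact r.1.apply_symm_apply z
        · rw [map_mul, map_mul, map_inv]
          rfl
      obtain ⟨k, hk⟩ := hS.index_eq N hN
        ((hemb.isOpenMap _ (isOpen_ballFix n)).preimage continuous_subtype_val)
      refine ⟨k, ?_⟩
      have h1 : (⟨_, hs⟩ : S) ^ N.index ∈ N := N.pow_index_mem _
      rw [hk] at h1
      obtain ⟨t, ht, e⟩ := h1
      have e' : universalToNeretin X b F t = universalToNeretin X b F (s ^ p ^ k) := by
        rw [map_pow]
        exact e
      rwa [← hemb.injective e']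
    have hRp : ∀ s : universalGroup X F, s.1 ∈ universalGroup X Fp → s.1 b = b → s ∈ R := by
      intro s hs hsb
      exact hle' ⟨⟨s.1, hs⟩, mem_ballFix_zero.2 hsb, rfl⟩
    intro x hx
    obtain ⟨s, hs, rfl⟩ := hSK hx
    have h1 := mem_universalGroup_of_isPGroup hFp horb hnorm hRb hRp hpow (s := s) hx
    exact ⟨⟨s.1, h1⟩, mem_ballFix_zero.2 (mem_ballFix_zero.1 hs), rfl⟩

end Sylow

/-! ### Comparison of the localized topology with that of `N(F(p))`. -/

section Localization

variable {V Ω : Type*} {X : ColouredTree V Ω} {F Fp : Subgroup (Equiv.Perm Ω)} {b : V}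

/-- If the commensurator of the vertex stabilizer of `U(Fp)` in `N(F)` is `N(Fp)`, then the
localized topology is the topology of `N(Fp)`. -/
theorem exists_localization_vertexStab_equiv (hle : Fp ≤ F)
    (h : ∀ g ∈ Subgroup.Commensurable.commensurator (vertexStab X b hle),
      (g : NearPerm V) ∈ neretinGroup X b Fp) :
    ∃ e : PLocalization (vertexStab X b hle) ≃ₜ* neretinGroup X b Fp, ∀ x,
      ((e x : neretinGroup X b Fp) : NearPerm V) = (PLocalization.val (vertexStab X b hle) x : NearPerm V) := by
  have hemb := isEmbedding_subUniversalToNeretin (X := X) (b := b) hle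
  let e : PLocalization (vertexStab X b hle) ≃* neretinGroup X b Fp :=
    { toFun := fun x => ⟨(PLocalization.val (vertexStab X b hle) x : NearPerm V), h _ x.2⟩
      invFun := fun y => ⟨⟨y, neretinGroup_mono hle y.2⟩, mem_commensurator_of_mem hle y.2⟩
      left_inv := fun _ => rfl
      right_inv := fun _ => rfl
      map_mul' := fun _ _ => rfl }
  -- Both coset topologies are tested on this one group: it carries the localized topology on one
  -- side, and is the open subgroup `ballFix X b Fp 0` of `U(Fp)` on the other.
  let i := mapEquivOfIsEmbedding _ hemb (ballFix X b Fp 0)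
  refine ⟨⟨e, ?_, ?_⟩, fun x => rfl⟩
  · refine continuous_of_cosetTopology (f := PLocalization.incl (vertexStab X b hle))
      (f' := universalToNeretin X b Fp) rfl rfl e.toMonoidHom (MonoidHom.id _)
      ((ballFix X b Fp 0).subtype.comp i.symm.toMulEquiv.toMonoidHom) IsOpenMap.id
      (continuous_subtype_val.comp i.symm.continuous) fun x => ?_
    have := mapEquivOfIsEmbedding_symm_apply _ hemb (ballFix X b Fp 0) x
    exact Subtype.ext (congrArg Subtype.val this).symm
  · exact continuous_of_cosetTopology (f := universalToNeretin X b Fp)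
      (f' := PLocalization.incl (vertexStab X b hle)) rfl rfl e.symm.toMonoidHom
      (ballFix X b Fp 0).subtype i.toMulEquiv.toMonoidHom
      (isOpen_ballFix 0).isOpenMap_subtype_val i.continuous fun x => rfl

end Localization

end NeretinLoc

/-! ### The theorem. -/

open NeretinLoc in
theorem theorem4p5 {V Ω : Type*} (X : ColouredTree V Ω) (b : V) (p : ℕ) [Fact p.Prime]
    (F Fp : Subgroup (Equiv.Perm Ω)) (hFp : ∃ P : Sylow p F, Fp = (P : Subgroup F).map F.subtype)
    (horb : ∀ ω : Ω, MulAction.orbit F ω = MulAction.orbit Fp ω)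
    (hnorm : ∀ ω : Ω,
      (orbitHull F ⊓ MulAction.stabilizer (Equiv.Perm Ω) ω) ⊓
        Subgroup.normalizer (Fp ⊓ MulAction.stabilizer (Equiv.Perm Ω) ω : Subgroup (Equiv.Perm Ω)) =
        Fp ⊓ MulAction.stabilizer (Equiv.Perm Ω) ω) :
    (∃ S : Subgroup (neretinGroup X b F), IsLocalSylow p S ∧
      ∃ e : PLocalization S ≃ₜ* neretinGroup X b Fp,
        ∀ x, ((e x : neretinGroup X b Fp) : NearPerm V) = (PLocalization.val S x : NearPerm V)) ∧
    (∀ S : Subgroup (neretinGroup X b F), IsLocalSylow p S →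
      ∃ g : neretinGroup X b F, ∃ e : PLocalization S ≃ₜ* neretinGroup X b Fp,
        ∀ x, ((e x : neretinGroup X b Fp) : NearPerm V) =
          ((g * PLocalization.val S x * g⁻¹ : neretinGroup X b F) : NearPerm V)) := by
  have hle : Fp ≤ F := by
    obtain ⟨P, rfl⟩ := hFp
    exact Subgroup.map_subtype_le _
  have hS₀ := isLocalSylow_vertexStab (X := X) (b := b) hFp horb hnorm hle
  obtain ⟨e, he⟩ := exists_localization_vertexStab_equiv (X := X) (b := b) hle
    fun g hg => mem_of_mem_commensurator hle horb hnorm hg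
  refine ⟨⟨_, hS₀, e, he⟩, fun S hS => ?_⟩
  obtain ⟨k, L, hL, hinf⟩ := hS.exists_conj hS₀
  have hcompact : ∀ {S : Subgroup (neretinGroup X b F)}, IsLocalSylow p S →
      IsCompact (S : Set (neretinGroup X b F)) := by
    rintro S ⟨_, -, -, h⟩
    exact isCompact_iff_compactSpace.2 h.1.2.compact
  obtain ⟨e', he'⟩ := PLocalization.exists_equiv_of_inf_eq (hcompact hS) (hcompact hS₀) hL hinf
  -- `S` agrees on `L` with the conjugate by `k` of the vertex stabilizer, so `k⁻¹` conjugates back.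
  refine ⟨k⁻¹, e'.trans e, fun x => ?_⟩
  rw [inv_inv, ← he' x]
  exact he (e' x)
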